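/- Let $M$ be a smooth (Hausdorff) three-manifold with a strictly pseudoconvex CR structure $(H,J)$. A contact form is a smooth real one-form $\theta$ with $\ker\theta=H$ and $d\theta(\cdot,J\cdot)$ positive definite on $H$; $T$ is its Reeb field, i.e. $\theta(T)=1$ and $d\theta(T,\cdot)=0$. For an admissible coframe $\{\theta,\theta^1,\theta^{\bar 1}\}$ with $d\theta=i\,h_{1\bar 1}\theta^1\wedge\theta^{\bar 1}$, the Tanaka--Webster connection form $\omega_1{}^1$ and torsion $A_{11}$ are determined by $d\theta^1=\theta^1\wedge\omega_1{}^1+\theta\wedge A^1{}_{\bar 1}\theta^{\bar 1}$ and $\omega_{1\bar 1}+\omega_{\bar 1 1}=dh_{1\bar 1}$, and the scalar curvature $R$ by $d\omega_1{}^1=R\,h_{1\bar 1}\theta^1\wedge\theta^{\bar 1}$ mod $\theta$. Let $\nabla_\alpha$ be the covariant derivative, indices being raised with $h$, and put $\Delta_b=-(\nabla^\alpha\nabla_\alpha+\nabla_\alpha\nabla^\alpha)$ and $W_\alpha=\nabla_\alpha R-i\nabla^\beta A_{\alpha\beta}$. The form $\theta$ is pseudo-Einstein if $W_\alpha=0$.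 A function $u\in C^\infty(M;\mathbb R)$ is CR pluriharmonic if it is locally the real part of a smooth complex function $v$ with $\nabla_{\bar\alpha}v=0$. Define \begin{align*} P_4f&=\Delta_b^2f+T^2f-4\,\mathrm{Im}\,\nabla^\alpha(A_{\alpha\beta}\nabla^\beta f),\\ P_4'f&=4\Delta_b^2f-8\,\mathrm{Im}\,\nabla^\alpha(A_{\alpha\beta}\nabla^\beta f)-4\,\mathrm{Re}\,\nabla^\alpha(R\nabla_\alpha f)+\tfrac83\mathrm{Re}(W_\alpha\nabla^\alpha f)+\tfrac23\left(\Delta_bR-2\,\mathrm{Im}\,\nabla^\alpha\nabla^\beta A_{\alpha\beta}\right)f,\\ Q_4'&=2\Delta_bR-4A_{\alpha\beta}A^{\alpha\beta}+R^2, \end{align*} where $P_4'$ acts on CR pluriharmonic functions $f$ and $Q_4'$ is considered for pseudo-Einstein $\theta$. Proposition. Let $\theta$ be a pseudo-Einstein contact form. Then $Q_4'$ is smooth. If $\sigma$ is CR pluriharmonic, then $\hat\theta=e^\sigma\theta$ is again a pseudo-Einstein contact form, and its $Q'$-curvature $\hat Q_4'$ satisfies $$e^{2\sigma}\hat Q_4'=Q_4'+P_4'(\sigma)+\tfrac12P_4(\sigma^2).$$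 Moreover, if $M$ is compact, then $\int_M\hat Q_4'\,\hat\theta\wedge d\hat\theta=\int_MQ_4'\,\theta\wedge d\theta$ for any two pseudo-Einstein contact forms $\theta,\hat\theta$ on $(M,H,J)$. -/

import Mathlib

open scoped Manifold ContDiff Topology

noncomputable section

/-- The model space `ℝ³` of a three-manifold. -/
abbrev R3 : Type := EuclideanSpace ℝ (Fin 3)

/-- Real one-forms on `M` (sections of the cotangent bundle, no regularity required here). -/
abbrev OneForm (M : Type*) [TopologicalSpace M] [ChartedSpace R3 M] : Type _ :=
  ∀ x : M, TangentSpace (𝓡 3) x →L[ℝ] ℝ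

/-- A one-form is smooth if it is a smooth section of the cotangent bundle. -/
def OneForm.IsSmooth {M : Type*} [TopologicalSpace M] [ChartedSpace R3 M]
    [IsManifold (𝓡 3) ∞ M] (θ : OneForm M) : Prop :=
  ContMDiff (𝓡 3) ((𝓡 3).prod 𝓘(ℝ, R3 →L[ℝ] ℝ)) ∞
    (fun x => Bundle.TotalSpace.mk' (R3 →L[ℝ] ℝ)
      (E := fun x : M => (TangentSpace (𝓡 3) x →L[ℝ] ℝ)) x (θ x))

/-- The expression of a one-form in the chart around `c`: its pullback by the inverse chart. -/
def OneForm.inChart {M : Type*} [TopologicalSpace M] [ChartedSpace R3 M]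
    (θ : OneForm M) (c : M) (y : R3) : R3 →L[ℝ] ℝ :=
  (θ ((extChartAt (𝓡 3) c).symm y)).comp
    (mfderiv 𝓘(ℝ, R3) (𝓡 3) (extChartAt (𝓡 3) c).symm y)

/-- The exterior derivative of `θ`, expressed in the chart around `c`. -/
def OneForm.extDerivInChart {M : Type*} [TopologicalSpace M] [ChartedSpace R3 M]
    (θ : OneForm M) (c : M) (y v w : R3) : ℝ :=
  fderiv ℝ (θ.inChart c) y v w - fderiv ℝ (θ.inChart c) y w v

/-- The exterior derivative `dθ` at the point `x`, computed in the chart around `x`.  The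
convention is `dθ(V, W) = V(θ(W)) - W(θ(V)) - θ([V, W])`. -/
def OneForm.extDeriv {M : Type*} [TopologicalSpace M] [ChartedSpace R3 M]
    (θ : OneForm M) (x : M) (v w : TangentSpace (𝓡 3) x) : ℝ :=
  θ.extDerivInChart x (extChartAt (𝓡 3) x x)
    (mfderiv (𝓡 3) 𝓘(ℝ, R3) (extChartAt (𝓡 3) x) x v)
    (mfderiv (𝓡 3) 𝓘(ℝ, R3) (extChartAt (𝓡 3) x) x w)

/-- The conformal multiple `e^σ θ`. -/
def OneForm.expSmul {M : Type*} [TopologicalSpace M] [ChartedSpace R3 M]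
    (σ : M → ℝ) (θ : OneForm M) : OneForm M :=
  fun x => Real.exp (σ x) • θ x

/-- The coefficient of `θ ∧ dθ` with respect to `dx⁰ ∧ dx¹ ∧ dx²` in the chart around `c`. -/
def OneForm.volumeCoeff {M : Type*} [TopologicalSpace M] [ChartedSpace R3 M]
    (θ : OneForm M) (c : M) (y : R3) : ℝ :=
  let e : Fin 3 → R3 := fun j => EuclideanSpace.single j 1
  θ.inChart c y (e 0) * θ.extDerivInChart c y (e 1) (e 2)
    + θ.inChart c y (e 1) * θ.extDerivInChart c y (e 2) (e 0)
    + θ.inChart c y (e 2) * θ.extDerivInChart c y (e 0) (e 1)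

/-- The integral `∫_M f θ ∧ dθ` over a compact three-manifold oriented by the volume form
`θ ∧ dθ`, computed with a smooth partition of unity subordinate to the charts.  (Because of the
orientation, the coefficient of the volume form enters through its absolute value.) -/
def OneForm.contactIntegral {M : Type*} [TopologicalSpace M] [ChartedSpace R3 M]
    [IsManifold (𝓡 3) ∞ M] [T2Space M] [CompactSpace M] (θ : OneForm M) (f : M → ℝ) : ℝ :=
  let ρ := (SmoothPartitionOfUnity.exists_isSubordinate_chartAt_source (𝓡 3) M).choose
  ∑ᶠ c : M, ∫ y in (extChartAt (𝓡 3) c).target,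
    ρ c ((extChartAt (𝓡 3) c).symm y) * f ((extChartAt (𝓡 3) c).symm y) * |θ.volumeCoeff c y|

/-- The differential `df(v)` of a complex valued function at a real tangent vector. -/
def diffAt {M : Type*} [TopologicalSpace M] [ChartedSpace R3 M]
    (f : M → ℂ) (x : M) (v : TangentSpace (𝓡 3) x) : ℂ :=
  mfderiv (𝓡 3) 𝓘(ℝ, ℂ) f x v

/-- The derivative `V f` of a complex valued function along a real vector field. -/
def vectorDeriv {M : Type*} [TopologicalSpace M] [ChartedSpace R3 M]
    (V : ∀ x : M, TangentSpace (𝓡 3) x) (f : M → ℂ) (x : M) : ℂ :=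
  diffAt f x (V x)

/-- A CR structure `(H, J)` on a three-manifold: a smooth rank two subbundle `H` of the tangent
bundle together with a smooth complex structure `J` on `H`.  Smoothness of `H` and `J` means that
there are local smooth frames of `H` of the form `X, JX`.  (In dimension three `T^{1,0}` has rank
one, so that formal integrability is automatic.  Maximal nonintegrability and strict
pseudoconvexity are part of `CRStructure.IsContactForm`.) -/
structure CRStructure (M : Type*) [TopologicalSpace M] [ChartedSpace R3 M]
    [IsManifold (𝓡 3) ∞ M] where
  H : ∀ x : M, Submodule ℝ (TangentSpace (𝓡 3) x)
  finrank_H : ∀ x, Module.finrank ℝ (H x) = 2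
  J : ∀ x, H x →ₗ[ℝ] H x
  J_J : ∀ x (v : H x), J x (J x v) = -v
  smooth : ∀ p : M, ∃ U : Set M, IsOpen U ∧ p ∈ U ∧ ∃ X : ∀ x, H x,
    ContMDiffOn (𝓡 3) (𝓡 3).tangent ∞
      (fun x => (⟨x, (X x : TangentSpace (𝓡 3) x)⟩ : TangentBundle (𝓡 3) M)) U ∧
    ContMDiffOn (𝓡 3) (𝓡 3).tangent ∞
      (fun x => (⟨x, (J x (X x) : TangentSpace (𝓡 3) x)⟩ : TangentBundle (𝓡 3) M)) U ∧
    ∀ x ∈ U, X x ≠ 0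

namespace CRStructure

variable {M : Type*} [TopologicalSpace M] [ChartedSpace R3 M] [IsManifold (𝓡 3) ∞ M]

/-- `θ` is a contact form of the strictly pseudoconvex CR manifold `(M, H, J)`: a smooth one-form
with kernel `H` such that `dθ(·, J·)` is positive definite on `H`. -/
structure IsContactForm (S : CRStructure M) (θ : OneForm M) : Prop where
  smooth : θ.IsSmooth
  ker_eq : ∀ x (v : TangentSpace (𝓡 3) x), θ x v = 0 ↔ v ∈ S.H x
  pos : ∀ x (v : S.H x), v ≠ 0 → 0 < θ.extDeriv x v (S.J x v)

/-- CR pluriharmonic functions: smooth real functions that are locally the real part of a CR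
function `v`, i.e. of a smooth complex function annihilated by all `w + i J w`, `w ∈ H`. -/
def IsPluriharmonic (S : CRStructure M) (u : M → ℝ) : Prop :=
  ContMDiff (𝓡 3) 𝓘(ℝ, ℝ) ∞ u ∧
  ∀ p : M, ∃ U : Set M, IsOpen U ∧ p ∈ U ∧ ∃ v : M → ℂ,
    ContMDiffOn (𝓡 3) 𝓘(ℝ, ℂ) ∞ v U ∧
    ∀ x ∈ U, (v x).re = u x ∧
      ∀ w : S.H x, diffAt v x w + Complex.I * diffAt v x (S.J x w) = 0

/-- The Reeb vector field `T` of `θ`: `θ(T) = 1` and `T ⌟ dθ = 0`. -/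
def reeb (θ : OneForm M) (x : M) : TangentSpace (𝓡 3) x :=
  Classical.epsilon fun v => θ x v = 1 ∧ ∀ w, θ.extDeriv x v w = 0

/-! ### Unitary frames

A section `X` of `H` with `dθ(X, JX) = 1` is the same thing as the unitary frame
`Z = (X - i JX) / √2` of `T^{1,0}`, that is, `dθ(Z, Z̄) = i`.  The coframe `θ, θ¹, θ^{\bar 1}` dual to
`T, Z, Z̄` is then an admissible coframe with `h_{1\bar 1} = 1`, i.e. `dθ = i θ¹ ∧ θ^{\bar 1}`.  All
tensors below are given by their components in such a frame. -/

/-- `X` determines a smooth unitary frame of `T^{1,0}` in a neighbourhood of `p`. -/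
def IsUnitaryFrame (S : CRStructure M) (θ : OneForm M) (X : ∀ x, S.H x) (p : M) : Prop :=
  ∃ U : Set M, IsOpen U ∧ p ∈ U ∧
    ContMDiffOn (𝓡 3) (𝓡 3).tangent ∞
      (fun x => (⟨x, (X x : TangentSpace (𝓡 3) x)⟩ : TangentBundle (𝓡 3) M)) U ∧
    ContMDiffOn (𝓡 3) (𝓡 3).tangent ∞
      (fun x => (⟨x, (S.J x (X x) : TangentSpace (𝓡 3) x)⟩ : TangentBundle (𝓡 3) M)) U ∧
    ∀ x ∈ U, θ.extDeriv x (X x) (S.J x (X x)) = 1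

/-- Some unitary frame around `p`. -/
def frameAt (S : CRStructure M) (θ : OneForm M) (p : M) : ∀ x, S.H x :=
  Classical.epsilon fun X => S.IsUnitaryFrame θ X p

/-- The section `X` of `H` as a vector field. -/
def vecX (S : CRStructure M) (X : ∀ x, S.H x) (x : M) : TangentSpace (𝓡 3) x := X x

/-- The vector field `Y = J X`. -/
def vecY (S : CRStructure M) (X : ∀ x, S.H x) (x : M) : TangentSpace (𝓡 3) x := S.J x (X x)

/-- `Z f`, where `Z = (X - i JX) / √2`; this is `∇₁ f`. -/
def dZ (S : CRStructure M) (X : ∀ x, S.H x) (f : M → ℂ) (x : M) : ℂ :=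
  (vectorDeriv (S.vecX X) f x - Complex.I * vectorDeriv (S.vecY X) f x) / (√2 : ℝ)

/-- `Z̄ f`; this is `∇_{\bar 1} f = ∇¹ f`. -/
def dZbar (S : CRStructure M) (X : ∀ x, S.H x) (f : M → ℂ) (x : M) : ℂ :=
  (vectorDeriv (S.vecX X) f x + Complex.I * vectorDeriv (S.vecY X) f x) / (√2 : ℝ)

/-- `T f = ∇₀ f`. -/
def dT (θ : OneForm M) (f : M → ℂ) (x : M) : ℂ := vectorDeriv (reeb θ) f x

/-- The admissible `(1,0)`-form `θ¹`: it vanishes on `T` and `Z̄`, and `θ¹(Z) = 1`.  Since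
`dθ = i θ¹ ∧ θ^{\bar 1}`, it is `θ¹ = -i dθ(·, Z̄)`. -/
def coframe (S : CRStructure M) (θ : OneForm M) (X : ∀ x, S.H x) (x : M)
    (v : TangentSpace (𝓡 3) x) : ℂ :=
  -Complex.I * ((θ.extDeriv x v (S.vecX X x) : ℂ)
    + Complex.I * (θ.extDeriv x v (S.vecY X x) : ℂ)) / (√2 : ℝ)

/-! The connection form `ω = ω₁¹` and the torsion `A = A₁₁` of the Tanaka-Webster connection are
determined by the structure equations
`dθ¹ = θ¹ ∧ ω + θ ∧ τ¹`, `τ¹ = A_{\bar 1\bar 1} θ^{\bar 1}`, `ω + ω̄ = 0`.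
Evaluating the first one on `(Z, Z̄)`, `(Z, T)` and `(T, Z̄)` gives
`ω(Z̄) = θ¹([Z̄, Z])`, `ω(T) = θ¹([T, Z])` and `A_{\bar 1\bar 1} = -θ¹([T, Z̄])`. -/

/-- `ω(Z̄) = θ¹([Z̄, Z]) = -i θ¹([X, JX])`. -/
def omegaZbar (S : CRStructure M) (θ : OneForm M) (X : ∀ x, S.H x) (x : M) : ℂ :=
  -Complex.I * S.coframe θ X x (VectorField.mlieBracket (𝓡 3) (S.vecX X) (S.vecY X) x)

/-- `ω(Z) = - conj (ω(Z̄))`. -/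
def omegaZ (S : CRStructure M) (θ : OneForm M) (X : ∀ x, S.H x) (x : M) : ℂ :=
  -(starRingEnd ℂ) (S.omegaZbar θ X x)

/-- `ω(T) = θ¹([T, Z])`. -/
def omegaT (S : CRStructure M) (θ : OneForm M) (X : ∀ x, S.H x) (x : M) : ℂ :=
  (S.coframe θ X x (VectorField.mlieBracket (𝓡 3) (reeb θ) (S.vecX X) x)
    - Complex.I * S.coframe θ X x (VectorField.mlieBracket (𝓡 3) (reeb θ) (S.vecY X) x))
    / (√2 : ℝ)

/-- The connection form `ω = ω(T) θ + ω(Z) θ¹ + ω(Z̄) θ^{\bar 1}` on a real tangent vector. -/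
def omega (S : CRStructure M) (θ : OneForm M) (X : ∀ x, S.H x) (x : M)
    (v : TangentSpace (𝓡 3) x) : ℂ :=
  S.omegaT θ X x * (θ x v : ℂ) + S.omegaZ θ X x * S.coframe θ X x v
    + S.omegaZbar θ X x * (starRingEnd ℂ) (S.coframe θ X x v)

/-- The torsion component `A₁₁`, the conjugate of `A_{\bar 1\bar 1} = -θ¹([T, Z̄])`. -/
def torsion (S : CRStructure M) (θ : OneForm M) (X : ∀ x, S.H x) (x : M) : ℂ :=
  (starRingEnd ℂ) (-((S.coframe θ X x (VectorField.mlieBracket (𝓡 3) (reeb θ) (S.vecX X) x)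
    + Complex.I * S.coframe θ X x (VectorField.mlieBracket (𝓡 3) (reeb θ) (S.vecY X) x))
    / (√2 : ℝ)))

/-- The Webster scalar curvature, defined by `dω = R θ¹ ∧ θ^{\bar 1}` modulo `θ`, so that
`R = dω(Z, Z̄) = i dω(X, Y)` with `Y = JX` and `dω(X, Y) = X(ω(Y)) - Y(ω(X)) - ω([X, Y])`. -/
def scalarCurv (S : CRStructure M) (θ : OneForm M) (X : ∀ x, S.H x) (x : M) : ℝ :=
  (Complex.I * (vectorDeriv (S.vecX X) (fun y => S.omega θ X y (S.vecY X y)) x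
    - vectorDeriv (S.vecY X) (fun y => S.omega θ X y (S.vecX X y)) x
    - S.omega θ X x (VectorField.mlieBracket (𝓡 3) (S.vecX X) (S.vecY X) x))).re

/-- The divergence `∇^α τ_α = Z̄ τ₁ - ω(Z̄) τ₁` of the `(1,0)`-form `τ₁ θ¹`. -/
def div (S : CRStructure M) (θ : OneForm M) (X : ∀ x, S.H x) (τ : M → ℂ) (x : M) : ℂ :=
  S.dZbar X τ x - S.omegaZbar θ X x * τ x

/-- The sublaplacian `Δ_b f = -(∇^α ∇_α f + ∇_α ∇^α f)`; here
`∇_α ∇^α f = Z Z̄ f - conj (ω(Z̄)) Z̄ f`. -/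
def subLap (S : CRStructure M) (θ : OneForm M) (X : ∀ x, S.H x) (f : M → ℂ) (x : M) : ℂ :=
  -(S.div θ X (S.dZ X f) x
    + (S.dZ X (S.dZbar X f) x - (starRingEnd ℂ) (S.omegaZbar θ X x) * S.dZbar X f x))

/-- The divergence `∇^β A_{αβ}` of the torsion: its component
`∇_{\bar 1} A₁₁ = Z̄ A₁₁ - 2 ω(Z̄) A₁₁`. -/
def divTorsion (S : CRStructure M) (θ : OneForm M) (X : ∀ x, S.H x) (x : M) : ℂ :=
  S.dZbar X (S.torsion θ X) x - 2 * S.omegaZbar θ X x * S.torsion θ X x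

/-- The `(1,0)`-form `W_α = ∇_α R - i ∇^β A_{αβ}`. -/
def W (S : CRStructure M) (θ : OneForm M) (X : ∀ x, S.H x) (x : M) : ℂ :=
  S.dZ X (fun y => (S.scalarCurv θ X y : ℂ)) x - Complex.I * S.divTorsion θ X x

/-- The pseudo-Einstein condition in dimension three: `∇_α R - i ∇^β A_{αβ} = 0`. -/
def IsPseudoEinstein (S : CRStructure M) (θ : OneForm M) : Prop :=
  ∀ (p : M) (X : ∀ x, S.H x), S.IsUnitaryFrame θ X p → S.W θ X p = 0

/-- `∇^α (A_{αβ} ∇^β f)`. -/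
def divTorsionGrad (S : CRStructure M) (θ : OneForm M) (X : ∀ x, S.H x) (f : M → ℂ) (x : M) : ℂ :=
  S.div θ X (fun y => S.torsion θ X y * S.dZbar X f y) x

/-- The CR Paneitz operator
`P₄ f = Δ_b² f + T² f - 4 Im ∇^α (A_{αβ} ∇^β f)`, computed in the unitary frame given by `X`. -/
def paneitzIn (S : CRStructure M) (θ : OneForm M) (X : ∀ x, S.H x) (f : M → ℂ) (x : M) : ℝ :=
  (S.subLap θ X (S.subLap θ X f) x).re + (dT θ (dT θ f) x).re
    - 4 * (S.divTorsionGrad θ X f x).im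

/-- The `P'`-operator
`P'₄ f = 4 Δ_b² f - 8 Im ∇^α (A_{αβ} ∇^β f) - 4 Re ∇^α (R ∇_α f) + (8/3) Re (W_α ∇^α f)
  + (2/3) (Δ_b R - 2 Im ∇^α ∇^β A_{αβ}) f`,
computed in the unitary frame given by `X`. -/
def pPrimeIn (S : CRStructure M) (θ : OneForm M) (X : ∀ x, S.H x) (f : M → ℂ) (x : M) : ℝ :=
  4 * (S.subLap θ X (S.subLap θ X f) x).re
    - 8 * (S.divTorsionGrad θ X f x).im
    - 4 * (S.div θ X (fun y => (S.scalarCurv θ X y : ℂ) * S.dZ X f y) x).re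
    + 8 / 3 * (S.W θ X x * S.dZbar X f x).re
    + 2 / 3 * ((S.subLap θ X (fun y => (S.scalarCurv θ X y : ℂ)) x).re
        - 2 * (S.div θ X (S.divTorsion θ X) x).im) * (f x).re

/-- The `Q'`-curvature `Q'₄ = 2 Δ_b R - 4 |A|² + R²`, computed in the unitary frame given by `X`. -/
def qPrimeIn (S : CRStructure M) (θ : OneForm M) (X : ∀ x, S.H x) (x : M) : ℝ :=
  2 * (S.subLap θ X (fun y => (S.scalarCurv θ X y : ℂ)) x).re
    - 4 * ‖S.torsion θ X x‖ ^ 2 + S.scalarCurv θ X x ^ 2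

/-! The three scalars do not depend on the unitary frame; at `p` they are computed in some unitary
frame around `p`. -/

/-- The CR Paneitz operator `P₄` of `θ` on real functions. -/
def paneitz (S : CRStructure M) (θ : OneForm M) (f : M → ℝ) (p : M) : ℝ :=
  S.paneitzIn θ (S.frameAt θ p) (fun y => (f y : ℂ)) p

/-- The operator `P'₄` of `θ`, to be applied to CR pluriharmonic functions. -/
def pPrime (S : CRStructure M) (θ : OneForm M) (f : M → ℝ) (p : M) : ℝ :=
  S.pPrimeIn θ (S.frameAt θ p) (fun y => (f y : ℂ)) p

/-- The `Q'`-curvature of a pseudo-Einstein contact form `θ`. -/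
def qPrime (S : CRStructure M) (θ : OneForm M) (p : M) : ℝ :=
  S.qPrimeIn θ (S.frameAt θ p) p

end CRStructure

end

open scoped ComplexConjugate

set_option linter.unusedSectionVars false
set_option linter.unusedSimpArgs false

/-! ### Pseudohermitian calculus as pure algebra: derivations, conformal change, divergence form. -/

section

/-! In a unitary frame, all quantities involved are noncommutative polynomials in the derivations Z,
Z̄, T applied to the connection coefficients, the torsion and σ. They are governed by three
commutation relations, so the conformal part of the proposition is an identity in a commutative ring
with three derivations (`WebsterAlgebra`).

A conformal change together with a change of frame is Z' = gZ with g ḡ = e^{-σ}. The new commutators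
determine the new Reeb field, connection, torsion and curvature, because T, Z, Z̄ are linearly
independent; this yields the laws for R, A, Δ_b, W and Q'. Two facts carry the proof. First, W' = g²
ḡ (W - 3 P₁σ) (`W'_eq`), where P₁ is a third order operator that kills real parts of CR functions
(`WebsterAlgebra.P1_eq_zero`); hence e^σ θ stays pseudo-Einstein. Second, e^{2σ} Q̂' has its cubic
and quartic terms in σ cancelling identically, and if W = 0 and P₁σ = 0, its linear and quadratic
terms are P'σ and ½P(σ²) (`two_mul_conformal_Q`). When W = 0 the terms of P' containing W or no
derivative of f vanish, so only the remaining part of P' is compared.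

The geometry is transported to the algebra through the ring of germs of smooth functions at a point
(`smoothGerm`, `IsContactForm.webster`): an identity of germs may be differentiated again, and
evaluation at the point returns the scalar statement. That ω(T) is imaginary follows from the Jacobi
identity. With g of modulus one the same formulas show that Q' does not depend on the frame, hence
is smooth.

For the integral, any two contact forms satisfy θ' = e^σ θ, with σ the logarithm of θ'(T). If both
are pseudo-Einstein, the law of W gives P₁σ = 0 directly, and this is all that the transformation
law uses; it is never needed that σ is then pluriharmonic. Finally 2P'σ + P(σ²) is the divergence,
with respect to θ ∧ dθ, of a vector field defined on all of M (`two_mul_pPrime_add_paneitz`,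
`fluxField`), and θ̂ ∧ dθ̂ = e^{2σ} θ ∧ dθ. The divergence theorem (`contactIntegral_fieldDiv`) is
proved by charts and a partition of unity. -/

theorem Derivation.map_ofNat_eq_zero {𝒜 : Type*} [CommRing 𝒜] (D : Derivation ℤ 𝒜 𝒜) (n : ℕ)
    [n.AtLeastTwo] : D (ofNat(n) : 𝒜) = 0 :=
  D.map_natCast n

/-- Structure functions of the Tanaka-Webster connection in a unitary frame `Z, Z̄, T`, for
derivations of a commutative ring with an imaginary unit `i`. -/
structure WebsterAlgebra {𝒜 : Type*} [CommRing 𝒜] (i : 𝒜) where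
  Z : Derivation ℤ 𝒜 𝒜
  Zb : Derivation ℤ 𝒜 𝒜
  T : Derivation ℤ 𝒜 𝒜
  w : 𝒜
  wb : 𝒜
  t : 𝒜
  A : 𝒜
  Ab : 𝒜
  i_sq : i * i = -1
  Z_i : Z i = 0
  Zb_i : Zb i = 0
  T_i : T i = 0
  comm_Zb_Z : ∀ f, Zb (Z f) = Z (Zb f) + i * T f + w * Z f - wb * Zb f
  comm_T_Z : ∀ f, T (Z f) = Z (T f) + t * Z f - A * Zb f
  comm_T_Zb : ∀ f, T (Zb f) = Zb (T f) - t * Zb f - Ab * Z f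
  -- Independence of T, Z, Z̄ over the ring: it allows coefficients to be compared in first order
  -- operators.
  indep : ∀ a b c, (∀ f, a * T f + b * Z f + c * Zb f = 0) → a = 0 ∧ b = 0 ∧ c = 0

namespace WebsterAlgebra

variable {𝒜 : Type*} [CommRing 𝒜] {i : 𝒜} (P P' : WebsterAlgebra i)

/-- The scalar curvature. -/
def R : 𝒜 := P.Z P.w + P.Zb P.wb + i * P.t - 2 * P.w * P.wb

/-- The divergence of a `(1,0)`-form. -/
def div (f : 𝒜) : 𝒜 := P.Zb f - P.w * f

/-- The divergence of a `(0,1)`-form. -/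
def divb (f : 𝒜) : 𝒜 := P.Z f - P.wb * f

/-- The sublaplacian. -/
def lap (f : 𝒜) : 𝒜 := -(P.div (P.Z f) + P.divb (P.Zb f))

/-- The divergence of the torsion. -/
def divA : 𝒜 := P.Zb P.A - 2 * P.w * P.A

/-- The conjugate of the divergence of the torsion. -/
def divAb : 𝒜 := P.Z P.Ab - 2 * P.wb * P.Ab

/-- The form `W = ∇R - i ∇A`. -/
def W : 𝒜 := P.Z P.R - i * P.divA

/-- The conjugate of `W`. -/
def Wb : 𝒜 := P.Zb P.R + i * P.divAb

/-- The operator `P₁` whose vanishing characterizes CR pluriharmonic functions. -/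
def P1 (s : 𝒜) : 𝒜 := P.Z (P.divb (P.Zb s)) + i * P.A * P.Zb s

/-- The conjugate of `P₁`. -/
def P1b (s : 𝒜) : 𝒜 := P.Zb (P.div (P.Z s)) - i * P.Ab * P.Z s

/-- The `Q'`-curvature. -/
def Q : 𝒜 := 2 * P.lap P.R - 4 * P.A * P.Ab + P.R ^ 2

/-- The torsion part `∇^α (A_{αβ} ∇^β f)` of the Paneitz operator. -/
def divAgrad (f : 𝒜) : 𝒜 := P.div (P.A * P.Zb f)

/-- The conjugate of `divAgrad`. -/
def divAgradb (f : 𝒜) : 𝒜 := P.divb (P.Ab * P.Z f)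

/-- The Paneitz operator; `-4 Im z = 2 i (z - z̄)`. -/
def paneitz (f : 𝒜) : 𝒜 :=
  P.lap (P.lap f) + P.T (P.T f) + 2 * i * (P.divAgrad f - P.divAgradb f)

/-- The part of the `P'`-operator that does not involve `W`. -/
def pPrime (f : 𝒜) : 𝒜 :=
  4 * P.lap (P.lap f) + 4 * i * (P.divAgrad f - P.divAgradb f)
    - 2 * (P.div (P.R * P.Z f) + P.divb (P.R * P.Zb f))

/-- The `Q'`-curvature of `e^s θ`, up to the factor `e^{-2s}`, in terms of `θ`. -/
def conformalQ (s : 𝒜) : 𝒜 :=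
  2 * (P.lap (P.R + 2 * P.lap s - 2 * P.Z s * P.Zb s)
      - (P.R + 2 * P.lap s - 2 * P.Z s * P.Zb s) * P.lap s
      + P.Z s * P.Zb (P.R + 2 * P.lap s - 2 * P.Z s * P.Zb s)
      + P.Zb s * P.Z (P.R + 2 * P.lap s - 2 * P.Z s * P.Zb s))
    - 4 * (P.A + i * (P.Z (P.Z s) + P.wb * P.Z s) - i * P.Z s ^ 2)
      * (P.Ab - i * (P.Zb (P.Zb s) + P.w * P.Zb s) + i * P.Zb s ^ 2)
    + (P.R + 2 * P.lap s - 2 * P.Z s * P.Zb s) ^ 2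

/-- D = ∇^1∇_1 s, E = ∇_1∇_1 s and their conjugates are named as independent symbols. The hypotheses
rewrite their higher derivatives into a normal form, after which both sides are the same polynomial
modulo i² = -1. The factor 2 is kept because 2 need not be invertible in `𝒜`. -/
theorem two_mul_conformal_Q_of_jets (D Db E Eb : 𝒜) (hZ1 : P.Z (P.Z s) = E - P.wb * P.Z s)
    (hZb1 : P.Zb (P.Z s) = D + P.w * P.Z s) (hZ2 : P.Z (P.Zb s) = Db + P.wb * P.Zb s)
    (hZb2 : P.Zb (P.Zb s) = Eb - P.w * P.Zb s) (hT : P.T s = i * (Db - D))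
    (hZDb : P.Z Db = -i * P.A * P.Zb s) (hZbD : P.Zb D = i * P.Ab * P.Z s)
    (hZbZD : P.Zb (P.Z D) = P.Z (P.Zb D) + i * P.T D + P.w * P.Z D - P.wb * P.Zb D)
    (hZZbDb : P.Z (P.Zb Db) = P.Zb (P.Z Db) - i * P.T Db - P.w * P.Z Db + P.wb * P.Zb Db)
    (hZbE : P.Zb E = 2 * P.Z D + 2 * P.w * E + P.R * P.Z s)
    (hZEb : P.Z Eb = 2 * P.Zb Db + 2 * P.wb * Eb + P.R * P.Zb s)
    (hW : P.Z P.R = i * P.divA) (hWb : P.Zb P.R = -i * P.divAb) :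
    2 * P.conformalQ s = 2 * P.Q + 2 * P.pPrime s + P.paneitz (s ^ 2) := by
  have hlap : P.lap s = -(D + Db) := by
    unfold lap div divb
    rw [hZb1, hZ2]; ring
  unfold conformalQ Q pPrime paneitz divAgrad divAgradb
  rw [hlap]
  have e1 : P.lap (s ^ 2) = -2 * s * (D + Db) - 4 * P.Z s * P.Zb s := by
    unfold lap div divb
    simp only [Derivation.leibniz, smul_eq_mul, map_add, pow_two, hZb1, hZ2]
    ring
  have e2 : P.Z (P.Z s * P.Zb s) = E * P.Zb s + P.Z s * Db := by
    simp only [Derivation.leibniz, smul_eq_mul, hZ1, hZ2]; ring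
  have e3 : P.Zb (P.Z s * P.Zb s) = D * P.Zb s + P.Z s * Eb := by
    simp only [Derivation.leibniz, smul_eq_mul, hZb1, hZb2]; ring
  rw [e1]
  unfold lap div divb
  simp only [map_sub, map_add, map_neg, pow_two, mul_assoc, Derivation.map_ofNat_eq_zero]
  simp only [Derivation.leibniz, smul_eq_mul, map_add, map_sub, map_neg, e2, e3, hZ1, hZb1, hZ2, hZb2, hT, hZDb, hZbD, hZbZD, hZZbDb, hZbE, hZEb, P.Z_i, P.Zb_i, P.T_i, Derivation.map_ofNat_eq_zero, map_zero, hW, hWb, divA, divAb]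
  linear_combination (8 * E * Eb - 8 * E * P.Zb s ^ 2 - 8 * P.Z s ^ 2 * Eb
    + 8 * P.Z s ^ 2 * P.Zb s ^ 2 + 4 * D * Db - 2 * D ^ 2 - 2 * Db ^ 2) * P.i_sq

variable {P} in
-- Supplies the jet relations. T s comes from the commutator [Z̄, Z] s, and P₁s = 0 removes Z(∇_1∇^1
-- s). The curvature enters by commuting Z̄ past the second derivative ∇_1∇_1 s, where the defining
-- combination of R appears.
theorem two_mul_conformal_Q {s : 𝒜} (h1 : P.P1 s = 0) (h1b : P.P1b s = 0)
    (hW : P.W = 0) (hWb : P.Wb = 0) : 2 * P.conformalQ s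
      = 2 * P.Q + 2 * P.pPrime s + P.paneitz (s ^ 2) := by
  have hR : P.R = P.Z P.w + P.Zb P.wb + i * P.t - 2 * P.w * P.wb := rfl
  unfold P1 at h1
  unfold P1b at h1b
  have hT : P.T s = i * (P.divb (P.Zb s) - P.div (P.Z s)) := by
    unfold div divb
    linear_combination i * P.comm_Zb_Z s + P.T s * P.i_sq
  have hZT : P.Z (P.T s) = i * (P.Z (P.divb (P.Zb s)) - P.Z (P.div (P.Z s))) := by
    rw [hT, Derivation.leibniz, map_sub, P.Z_i]
    simp
  have hZbT : P.Zb (P.T s) = i * (P.Zb (P.divb (P.Zb s)) - P.Zb (P.div (P.Z s))) := by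
    rw [hT, Derivation.leibniz, map_sub, P.Zb_i]
    simp
  have hZbZ : P.Zb (P.Z s) = P.div (P.Z s) + P.w * P.Z s := by unfold div; ring
  have hZZb : P.Z (P.Zb s) = P.divb (P.Zb s) + P.wb * P.Zb s := by unfold divb; ring
  apply P.two_mul_conformal_Q_of_jets (s := s) (D := P.div (P.Z s)) (Db := P.divb (P.Zb s))
    (E := P.Z (P.Z s) + P.wb * P.Z s) (Eb := P.Zb (P.Zb s) + P.w * P.Zb s) (hT := hT)
    (hZb1 := hZbZ) (hZ2 := hZZb)
  · ring
  · ring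
  · linear_combination h1
  · linear_combination h1b
  · exact P.comm_Zb_Z _
  · linear_combination -P.comm_Zb_Z (P.divb (P.Zb s))
  · have h := P.comm_Zb_Z (P.Z s)
    rw [P.comm_T_Z, hZT, hZbZ] at h
    simp only [Derivation.leibniz, smul_eq_mul, map_add, hZbZ] at h ⊢
    linear_combination h - P.Z s * hR - h1
      + (P.Z (P.divb (P.Zb s)) - P.Z (P.div (P.Z s))) * P.i_sq
  · have h := P.comm_Zb_Z (P.Zb s)
    rw [P.comm_T_Zb, hZbT, hZZb] at h
    simp only [Derivation.leibniz, smul_eq_mul, map_add, hZZb] at h ⊢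
    linear_combination -h - P.Zb s * hR - h1b
      + (P.Zb (P.div (P.Z s)) - P.Zb (P.divb (P.Zb s))) * P.i_sq
  · unfold W at hW
    linear_combination hW
  · unfold Wb at hWb
    linear_combination hWb

variable {P} in
-- The CR part is killed by Z̄. For the anti-CR part, Z vb = 0 turns [Z̄, Z] vb into ∇_1∇^1 vb = -i
-- T vb and [T, Z] vb into Z T vb = A Z̄ vb; the two terms of P₁ then cancel.
theorem P1_eq_zero {v vb : 𝒜} (hv : P.Zb v = 0) (hvb : P.Z vb = 0) : P.P1 (v + vb) = 0 := by
  have h : P.divb (P.Zb vb) = -i * P.T vb := by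
    have h := P.comm_Zb_Z vb
    rw [hvb, map_zero] at h
    unfold divb
    linear_combination -h
  have h2 := P.comm_T_Z vb
  rw [hvb, map_zero] at h2
  unfold P1
  rw [map_add, hv, zero_add, h, Derivation.leibniz, map_neg, P.Z_i]
  simp only [smul_eq_mul]
  linear_combination i * h2

variable {P} in
/-- The coefficient of `Z̄` in the vector field whose divergence is `2 P' s + P (s²)`. -/
def flux (s : 𝒜) : 𝒜 :=
  -P.Z (8 * P.lap s + P.lap (s ^ 2)) + 2 * i * P.A * P.Zb (4 * s + s ^ 2) - 4 * P.R * P.Z s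

/-- The coefficient of `Z` in the vector field whose divergence is `2 P' s + P (s²)`. -/
def fluxb (s : 𝒜) : 𝒜 :=
  -P.Zb (8 * P.lap s + P.lap (s ^ 2)) - 2 * i * P.Ab * P.Z (4 * s + s ^ 2) - 4 * P.R * P.Zb s

/-- All terms are divergences from the start, once the W terms of P' are dropped; `T²(s²)` is one
too because the Reeb field is divergence free (`fieldDiv_reeb`). -/
theorem two_mul_pPrime_add_paneitz (s : 𝒜) : 2 * P.pPrime s + P.paneitz (s ^ 2)
    = P.T (P.T (s ^ 2)) + P.div (P.flux s) + P.divb (P.fluxb s) := by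
  unfold pPrime paneitz flux fluxb divAgrad divAgradb
  generalize s ^ 2 = q
  have h : ∀ f, P.lap f = -(P.div (P.Z f) + P.divb (P.Zb f)) := fun f => rfl
  rw [h (P.lap s), h (P.lap q)]
  generalize P.lap s = u
  generalize P.lap q = v
  unfold div divb
  simp only [map_sub, map_add, map_neg, Derivation.leibniz, smul_eq_mul, P.Z_i, P.Zb_i,
    Derivation.map_ofNat_eq_zero, map_zero]
  ring

/-- The change of unitary frames `Z' = g Z` under `θ' = e^σ θ`, so that `g ḡ = e^{-σ}`. -/
structure FrameChange (s : 𝒜) where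
  g : 𝒜
  gb : 𝒜
  gi : 𝒜
  gbi : 𝒜
  g_gi : g * gi = 1
  gb_gbi : gb * gbi = 1
  Z_eq : ∀ f, P'.Z f = g * P.Z f
  Zb_eq : ∀ f, P'.Zb f = gb * P.Zb f
  -- The relation g ḡ = e^{-s} is recorded only through its derivatives along Z and Z̄, so no
  -- exponential is needed in the ring.
  Z_e : P.Z (g * gb) = -(g * gb) * P.Z s
  Zb_e : P.Zb (g * gb) = -(g * gb) * P.Zb s

namespace FrameChange

variable {P P'} {s : 𝒜} (C : FrameChange P P' s)

/-- The logarithmic derivative `Z g / g`. -/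
def n : 𝒜 := C.gi * P.Z C.g

/-- The logarithmic derivative `Z̄ g / g`. -/
def m : 𝒜 := C.gi * P.Zb C.g

/-- The logarithmic derivative `T g / g`. -/
def r : 𝒜 := C.gi * P.T C.g

theorem Z_g : P.Z C.g = C.g * C.n := by
  unfold n; linear_combination -P.Z C.g * C.g_gi

theorem Zb_g : P.Zb C.g = C.g * C.m := by
  unfold m; linear_combination -P.Zb C.g * C.g_gi

theorem T_g : P.T C.g = C.g * C.r := by
  unfold r; linear_combination -P.T C.g * C.g_gi

theorem Z_gb : P.Z C.gb = C.gb * (-P.Z s - C.n) := by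
  have h := C.Z_e
  simp only [Derivation.leibniz, smul_eq_mul, C.Z_g] at h
  linear_combination C.gi * h - (P.Z C.gb + C.gb * (P.Z s + C.n)) * C.g_gi

theorem Zb_gb : P.Zb C.gb = C.gb * (-P.Zb s - C.m) := by
  have h := C.Zb_e
  simp only [Derivation.leibniz, smul_eq_mul, C.Zb_g] at h
  linear_combination C.gi * h - (P.Zb C.gb + C.gb * (P.Zb s + C.m)) * C.g_gi

theorem cancel_g {a b : 𝒜} (h : C.g * a = C.g * b) : a = b := by
  linear_combination C.gi * h - (a - b) * C.g_gi

theorem cancel_gb {a b : 𝒜} (h : C.gb * a = C.gb * b) : a = b := by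
  linear_combination C.gbi * h - (a - b) * C.gb_gbi

/-- The relation for [Z̄, Z] applied to g and divided by g; it is the integrability condition for
log g. -/
theorem Zb_n : P.Zb C.n = P.Z C.m + i * C.r + P.w * C.n - P.wb * C.m := by
  have h := P.comm_Zb_Z C.g
  simp only [Derivation.leibniz, smul_eq_mul, C.Z_g, C.Zb_g, C.T_g] at h
  apply C.cancel_g
  linear_combination h

/-- The new Reeb derivative is forced to be the remainder of [Z̄', Z']. At this stage it still
contains the unknown connection coefficients w', w̄'. -/
theorem T'_eq_aux (f : 𝒜) : P'.T f = C.g * C.gb * P.T f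
    + i * (P'.w * C.g - C.gb * C.g * C.m - C.g * C.gb * P.w) * P.Z f
    + i * (C.g * C.gb * P.wb - C.g * C.gb * (P.Z s + C.n) - P'.wb * C.gb) * P.Zb f := by
  have h := P'.comm_Zb_Z f
  simp only [C.Z_eq, C.Zb_eq, Derivation.leibniz, smul_eq_mul, C.Z_gb, C.Zb_g, P.comm_Zb_Z] at h
  linear_combination i * h + (P'.T f - C.g * C.gb * P.T f) * P.i_sq

/-- With an ansatz for T', the relation [T', Z'] becomes a first order operator in the old frame
that vanishes identically. Its T coefficient fixes β, its Z coefficient gives t' and its Z̄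
coefficient gives A'. -/
theorem comm_T'_Z'_coefficients (α β : 𝒜)
    (hT : ∀ f, P'.T f = C.g * C.gb * P.T f + α * P.Z f + β * P.Zb f) :
    β = i * C.g * C.gb * P.Z s ∧
    P'.t = C.g * C.gb * (C.r + P.t) + α * C.n + β * (C.m + P.w) - P.Z α ∧
    C.gb * P'.A = C.g * (C.g * C.gb * P.A + P.Z β + β * P.wb) := by
  have h : ∀ f, (C.g * (i * β + C.g * C.gb * P.Z s)) * P.T f
      + (C.g * (C.g * C.gb * (C.r + P.t) + α * C.n + β * (C.m + P.w) - P.Z α - P'.t)) * P.Z f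
      + (C.gb * P'.A - C.g * (C.g * C.gb * P.A + P.Z β + β * P.wb)) * P.Zb f = 0 := by
    intro f
    have h := P'.comm_T_Z f
    simp only [C.Z_eq, C.Zb_eq, Derivation.leibniz, smul_eq_mul, C.Z_gb, C.Zb_g, C.Z_g, C.T_g,
      P.comm_Zb_Z, P.comm_T_Z, hT, map_add] at h
    linear_combination h
  obtain ⟨h1, h2, h3⟩ := P.indep _ _ _ h
  refine ⟨?_, ?_, sub_eq_zero.1 h3⟩
  · have h4 : i * β + C.g * C.gb * P.Z s = 0 := C.cancel_g (by rw [h1, mul_zero])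
    linear_combination -i * h4 + β * P.i_sq
  · linear_combination -C.cancel_g (h2.trans (mul_zero C.g).symm)

theorem comm_T'_Zb'_coefficients (α β : 𝒜)
    (hT : ∀ f, P'.T f = C.g * C.gb * P.T f + α * P.Z f + β * P.Zb f) :
    α = -i * C.g * C.gb * P.Zb s ∧
    C.g * P'.Ab = C.gb * (C.g * C.gb * P.Ab + P.Zb α + α * P.w) := by
  have h : ∀ f, (C.gb * (-i * α + C.g * C.gb * P.Zb s)) * P.T f
      + (C.g * P'.Ab - C.gb * (C.g * C.gb * P.Ab + P.Zb α + α * P.w)) * P.Z f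
      + (P.T C.gb * (C.g * C.gb) - α * (C.gb * (P.Z s + C.n)) - β * (C.gb * (P.Zb s + C.m))
        - C.gb * P.Zb β - C.g * C.gb * C.gb * P.t + α * C.gb * P.wb + P'.t * C.gb) * P.Zb f = 0 := by
    intro f
    have h := P'.comm_T_Zb f
    simp only [C.Z_eq, C.Zb_eq, Derivation.leibniz, smul_eq_mul, C.Z_gb, C.Zb_g,
      C.Zb_gb, P.comm_Zb_Z, P.comm_T_Zb, hT, map_add] at h
    linear_combination h
  obtain ⟨h1, h2, h3⟩ := P.indep _ _ _ h
  refine ⟨?_, sub_eq_zero.1 h2⟩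
  have h4 : -i * α + C.g * C.gb * P.Zb s = 0 := C.cancel_gb (by rw [h1, mul_zero])
  linear_combination i * h4 + α * P.i_sq

/-- The Z and Z̄ coefficients of T' are now known twice: from [Z̄', Z'], where they contain w' and
w̄', and from the T coefficients of the other two commutators. Equating them solves for the
connection. -/
theorem w'_eq_and_wb'_eq : P'.w = C.gb * (P.w - P.Zb s + C.m) ∧
    P'.wb = C.g * (P.wb - 2 * P.Z s - C.n) := by
  obtain ⟨hβ, -, -⟩ := C.comm_T'_Z'_coefficients _ _ C.T'_eq_aux
  obtain ⟨hα, -⟩ := C.comm_T'_Zb'_coefficients _ _ C.T'_eq_aux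
  constructor
  · apply C.cancel_g
    linear_combination -i * hα
      + (P'.w * C.g - C.gb * C.g * C.m - C.g * C.gb * (P.w - P.Zb s)) * P.i_sq
  · apply C.cancel_gb
    linear_combination i * hβ
      - (C.g * C.gb * (P.wb - P.Z s - P.Z s - C.n) - P'.wb * C.gb) * P.i_sq

theorem w'_eq : P'.w = C.gb * (P.w - P.Zb s + C.m) := C.w'_eq_and_wb'_eq.1

theorem wb'_eq : P'.wb = C.g * (P.wb - 2 * P.Z s - C.n) := C.w'_eq_and_wb'_eq.2

theorem T'_eq (f : 𝒜) : P'.T f =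
    C.g * C.gb * P.T f + -i * C.g * C.gb * P.Zb s * P.Z f + i * C.g * C.gb * P.Z s * P.Zb f := by
  obtain ⟨hβ, -, -⟩ := C.comm_T'_Z'_coefficients _ _ C.T'_eq_aux
  obtain ⟨hα, -⟩ := C.comm_T'_Zb'_coefficients _ _ C.T'_eq_aux
  rw [C.T'_eq_aux, hα, hβ]

theorem t'_eq : P'.t = C.g * C.gb * (C.r + P.t - i * P.Zb s * C.n
    + i * P.Z s * (C.m + P.w) - i * P.Z s * P.Zb s + i * P.Z (P.Zb s)) := by
  rw [(C.comm_T'_Z'_coefficients _ _ C.T'_eq).2.1]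
  simp only [Derivation.leibniz, smul_eq_mul, map_neg, P.Z_i, C.Z_gb, C.Z_g]
  ring

theorem A'_eq : P'.A =
    C.g ^ 2 * (P.A + i * (P.Z (P.Z s) + P.wb * P.Z s) - i * P.Z s ^ 2) := by
  apply C.cancel_gb
  rw [(C.comm_T'_Z'_coefficients _ _ C.T'_eq).2.2]
  simp only [Derivation.leibniz, smul_eq_mul, map_neg, P.Z_i, C.Z_gb, C.Z_g]
  ring

theorem Ab'_eq : P'.Ab =
    C.gb ^ 2 * (P.Ab - i * (P.Zb (P.Zb s) + P.w * P.Zb s) + i * P.Zb s ^ 2) := by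
  apply C.cancel_g
  rw [(C.comm_T'_Zb'_coefficients _ _ C.T'_eq).2]
  simp only [Derivation.leibniz, smul_eq_mul, map_neg, P.Zb_i, C.Zb_gb, C.Zb_g]
  ring

/-- The logarithmic derivatives of g cancel by `Zb_n`, so the phase of the frame leaves no trace and
only s remains. -/
theorem R'_eq : P'.R = C.g * C.gb * (P.R + 2 * P.lap s - 2 * P.Z s * P.Zb s) := by
  unfold R lap div divb
  rw [C.Z_eq, C.Zb_eq, C.w'_eq, C.wb'_eq, C.t'_eq]
  simp only [Derivation.leibniz, smul_eq_mul, map_neg, map_add, map_sub, Derivation.map_ofNat_eq_zero, P.Zb_i, C.Zb_gb, C.Zb_g, C.Z_g, C.Z_gb, C.Zb_n, P.comm_Zb_Z]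
  linear_combination C.g * C.gb * (P.w * P.Z s - P.Zb s * P.Z s - P.Zb s * C.n + C.m * P.Z s + P.Z (P.Zb s)) * P.i_sq

theorem lap'_eq (f : 𝒜) : P'.lap f =
    C.g * C.gb * (P.lap f - P.Z s * P.Zb f - P.Zb s * P.Z f) := by
  unfold lap div divb
  simp only [C.Z_eq, C.Zb_eq, C.w'_eq, C.wb'_eq, Derivation.leibniz, smul_eq_mul, C.Zb_g, C.Z_gb]
  ring

theorem divA'_eq : P'.divA = C.g ^ 2 * C.gb *
    (P.Zb (P.A + i * (P.Z (P.Z s) + P.wb * P.Z s) - i * P.Z s ^ 2)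
      - 2 * (P.w - P.Zb s) * (P.A + i * (P.Z (P.Z s) + P.wb * P.Z s) - i * P.Z s ^ 2)) := by
  unfold divA
  rw [C.Zb_eq, C.A'_eq, C.w'_eq, pow_two C.g]
  simp only [Derivation.leibniz, smul_eq_mul, C.Zb_g]
  ring

/-- The nonlinear terms in s cancel. This makes P₁s the exact obstruction to preserving W = 0, and
it is read in both directions later. -/
theorem W'_eq : P'.W = C.g ^ 2 * C.gb * (P.W - 3 * P.P1 s) := by
  unfold W
  rw [C.Z_eq, C.R'_eq, C.divA'_eq]
  unfold P1 lap div divb divA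
  simp only [Derivation.leibniz, smul_eq_mul, C.Z_e, map_neg, map_add, map_sub, pow_two,
    Derivation.map_ofNat_eq_zero, P.Zb_i, P.Z_i, P.comm_Zb_Z, P.comm_T_Z]
  have hR : P.R = P.Z P.w + P.Zb P.wb + i * P.t - 2 * P.w * P.wb := rfl
  linear_combination (- C.g ^ 2 * C.gb * P.Z (P.Z (P.Zb s)) + C.g ^ 2 * C.gb * P.w * P.Z s * P.wb * 2 - C.g ^ 2 * C.gb * P.Z (P.Z s) * P.Zb s * 2 - C.g ^ 2 * C.gb * P.Z s * P.Z P.w - C.g ^ 2 * C.gb * P.Z s * P.wb * P.Zb s * 4 + C.g ^ 2 * C.gb * P.Z s * P.Z (P.Zb s) * 2 - C.g ^ 2 * C.gb * P.Z s * P.Zb P.wb + C.g ^ 2 * C.gb * P.Z s ^ 2 * P.Zb s * 2 + C.g ^ 2 * C.gb * P.wb * P.Z (P.Zb s) + C.g ^ 2 * C.gb * P.Zb s * P.Z P.wb - i * C.g ^ 2 * C.gb * P.Z (P.T s) * 2 + i * C.g ^ 2 * C.gb * P.T s * P.Z s * 2 - i * C.g ^ 2 * C.gb * P.Z s * P.t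 + i * C.g ^ 2 * C.gb * P.Zb s * P.A) * P.i_sq - C.g ^ 2 * C.gb * P.Z s * hR

theorem Q'_eq : P'.Q = (C.g * C.gb) ^ 2 *
    P.conformalQ s := by
  unfold Q conformalQ
  rw [C.lap'_eq, C.R'_eq, C.A'_eq, C.Ab'_eq]
  -- The new curvature is only differentiated as a whole, so it can stay opaque.
  generalize P.R + 2 * P.lap s - 2 * P.Z s * P.Zb s = ρ
  unfold lap div divb
  simp only [Derivation.leibniz, smul_eq_mul, map_neg, map_add, map_sub, C.Z_e, C.Zb_e, C.Z_eq, C.Zb_eq]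
  simp only [mul_assoc C.g, Derivation.leibniz, smul_eq_mul, map_neg, map_add, map_sub, C.Z_e, C.Zb_e, C.Z_eq, C.Zb_eq]
  ring

/-- For s = 0 the frame is only rotated, and the flux transforms like the component of a (1,0)-form.
This is why the local flux fields glue to a global vector field. -/
theorem flux'_eq (C : FrameChange P P' 0) (hg : C.g * C.gb = 1) (s : 𝒜) :
    P'.flux s = C.g * P.flux s := by
  have hl : ∀ f, P'.lap f = P.lap f := fun f => by simp [C.lap'_eq, hg]
  have hR : P'.R = P.R := by simp [C.R'_eq, hg, lap, div, divb]
  have hA : P'.A = C.g ^ 2 * P.A := by simp [C.A'_eq]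
  unfold flux
  rw [hl, hl, hR, hA, C.Z_eq, C.Z_eq, C.Zb_eq]
  linear_combination 2 * i * C.g * P.A * P.Zb (4 * s + s ^ 2) * hg

end FrameChange

end WebsterAlgebra

end

/-! ### Vector fields, brackets and exterior derivatives in charts. -/

section

section Charts

theorem two_le_infty : (2 : WithTop ℕ∞) ≤ ∞ :=
  show ((2 : ℕ∞) : WithTop ℕ∞) ≤ ((⊤ : ℕ∞) : WithTop ℕ∞) from WithTop.coe_le_coe.2 le_top

theorem three_le_infty : (3 : WithTop ℕ∞) ≤ ∞ :=
  show ((3 : ℕ∞) : WithTop ℕ∞) ≤ ((⊤ : ℕ∞) : WithTop ℕ∞) from WithTop.coe_le_coe.2 le_top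

theorem mlieBracket_eq_lieBracket (V W : R3 → R3) :
    VectorField.mlieBracket 𝓘(ℝ, R3) V W = VectorField.lieBracket ℝ V W :=
  (VectorField.mlieBracketWithin_univ (I := 𝓘(ℝ, R3)) (V := V) (W := W)).symm.trans
    ((VectorField.mlieBracketWithin_eq_lieBracketWithin (V := V) (W := W)).trans
      VectorField.lieBracketWithin_univ)

variable {M : Type*} [TopologicalSpace M] [ChartedSpace R3 M] [IsManifold (𝓡 3) ∞ M]

/-- A vector field is smooth at a point, as a section of the tangent bundle. -/
abbrev SmoothFieldAt (V : ∀ x : M, TangentSpace (𝓡 3) x) (x : M) : Prop :=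
  ContMDiffAt (𝓡 3) (𝓡 3).tangent ∞ (fun x => (⟨x, V x⟩ : TangentBundle (𝓡 3) M)) x

theorem mfderiv_extChartAt_symm_apply {c x : M} (hx : x ∈ (extChartAt (𝓡 3) c).source)
    (v : TangentSpace (𝓡 3) x) :
    mfderiv 𝓘(ℝ, R3) (𝓡 3) (extChartAt (𝓡 3) c).symm (extChartAt (𝓡 3) c x)
      (mfderiv (𝓡 3) 𝓘(ℝ, R3) (extChartAt (𝓡 3) c) x v) = v := by
  have : IsManifold (𝓡 3) 1 M := IsManifold.of_le (n := ∞) (by simp)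
  have h := mfderivWithin_extChartAt_symm_comp_mfderiv_extChartAt' (I := 𝓡 3) hx
  simp only [modelWithCornersSelf_coe, Set.range_id, mfderivWithin_univ] at h
  exact DFunLike.congr_fun h v

theorem mfderiv_extChartAt_apply {c : M} {y : R3} (hy : y ∈ (extChartAt (𝓡 3) c).target)
    (v : R3) :
    mfderiv (𝓡 3) 𝓘(ℝ, R3) (extChartAt (𝓡 3) c) ((extChartAt (𝓡 3) c).symm y)
      (mfderiv 𝓘(ℝ, R3) (𝓡 3) (extChartAt (𝓡 3) c).symm y v) = v := by
  have : IsManifold (𝓡 3) 1 M := IsManifold.of_le (n := ∞) (by simp)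
  have h := mfderiv_extChartAt_comp_mfderivWithin_extChartAt_symm (I := 𝓡 3) hy
  simp only [modelWithCornersSelf_coe, Set.range_id, mfderivWithin_univ] at h
  exact DFunLike.congr_fun h v

theorem isInvertible_mfderiv_extChartAt_symm' {c : M} {y : R3}
    (hy : y ∈ (extChartAt (𝓡 3) c).target) :
    (mfderiv 𝓘(ℝ, R3) (𝓡 3) (extChartAt (𝓡 3) c).symm y).IsInvertible := by
  have : IsManifold (𝓡 3) 1 M := IsManifold.of_le (n := ∞) (by simp)
  have h := isInvertible_mfderivWithin_extChartAt_symm (I := 𝓡 3) hy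
  simpa only [modelWithCornersSelf_coe, Set.range_id, mfderivWithin_univ] using h

theorem contMDiffAt_extChartAt_symm' {c : M} {y : R3} (hy : y ∈ (extChartAt (𝓡 3) c).target) :
    ContMDiffAt 𝓘(ℝ, R3) (𝓡 3) ∞ (extChartAt (𝓡 3) c).symm y :=
  (contMDiffOn_extChartAt_symm c).contMDiffAt ((isOpen_extChartAt_target c).mem_nhds hy)

/-- A vector field in the chart around `c`. -/
noncomputable def chartField (c : M) (V : ∀ x : M, TangentSpace (𝓡 3) x) (y : R3) : R3 :=
  VectorField.mpullback 𝓘(ℝ, R3) (𝓡 3) (extChartAt (𝓡 3) c).symm V y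

theorem mfderiv_chartField {c : M} {y : R3} (hy : y ∈ (extChartAt (𝓡 3) c).target)
    (V : ∀ x : M, TangentSpace (𝓡 3) x) :
    mfderiv 𝓘(ℝ, R3) (𝓡 3) (extChartAt (𝓡 3) c).symm y (chartField c V y)
      = V ((extChartAt (𝓡 3) c).symm y) := by
  unfold chartField
  rw [VectorField.mpullback_apply]
  exact (isInvertible_mfderiv_extChartAt_symm' hy).self_apply_inverse _

theorem chartField_eq_mfderiv {c x : M} (hx : x ∈ (extChartAt (𝓡 3) c).source)
    (V : ∀ x : M, TangentSpace (𝓡 3) x) :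
    chartField c V (extChartAt (𝓡 3) c x) = mfderiv (𝓡 3) 𝓘(ℝ, R3) (extChartAt (𝓡 3) c) x (V x) := by
  have hy := (extChartAt (𝓡 3) c).map_source hx
  have h := mfderiv_extChartAt_apply hy (chartField c V (extChartAt (𝓡 3) c x))
  rw [mfderiv_chartField hy, (extChartAt (𝓡 3) c).left_inv hx] at h
  exact h.symm

theorem contDiffAt_chartField {c : M} {y : R3} (hy : y ∈ (extChartAt (𝓡 3) c).target)
    {V : ∀ x : M, TangentSpace (𝓡 3) x} (hV : SmoothFieldAt V ((extChartAt (𝓡 3) c).symm y)) :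
    ContDiffAt ℝ ∞ (chartField c V) y :=
  contMDiffAt_vectorSpace_iff_contDiffAt.1 (ContMDiffAt.mpullback_vectorField_preimage hV
    (contMDiffAt_extChartAt_symm' hy) (isInvertible_mfderiv_extChartAt_symm' hy) (by simp))

/-- The derivative of a function along a vector field. -/
noncomputable def fieldDeriv {F : Type*} [NormedAddCommGroup F] [NormedSpace ℝ F]
    (V : ∀ x : M, TangentSpace (𝓡 3) x) (f : M → F) (x : M) : F :=
  mfderiv (𝓡 3) 𝓘(ℝ, F) f x (V x)

theorem fieldDeriv_eq_fderiv_chartField {F : Type*} [NormedAddCommGroup F] [NormedSpace ℝ F]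
    {c : M} {y : R3} (hy : y ∈ (extChartAt (𝓡 3) c).target) {f : M → F}
    (hf : MDifferentiableAt (𝓡 3) 𝓘(ℝ, F) f ((extChartAt (𝓡 3) c).symm y))
    (V : ∀ x : M, TangentSpace (𝓡 3) x) :
    fieldDeriv V f ((extChartAt (𝓡 3) c).symm y)
      = fderiv ℝ (f ∘ (extChartAt (𝓡 3) c).symm) y (chartField c V y) := by
  unfold fieldDeriv
  rw [← mfderiv_eq_fderiv, mfderiv_comp y hf
    ((contMDiffAt_extChartAt_symm' hy).mdifferentiableAt (by simp))]
  exact congrArg _ (mfderiv_chartField hy V).symm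

theorem chartField_mlieBracket {c : M} {y : R3} (hy : y ∈ (extChartAt (𝓡 3) c).target)
    {V W : ∀ x : M, TangentSpace (𝓡 3) x} (hV : SmoothFieldAt V ((extChartAt (𝓡 3) c).symm y))
    (hW : SmoothFieldAt W ((extChartAt (𝓡 3) c).symm y)) :
    chartField c (VectorField.mlieBracket (𝓡 3) V W) y
      = VectorField.lieBracket ℝ (chartField c V) (chartField c W) y := by
  have : IsManifold (𝓡 3) (minSmoothness ℝ 3) M :=
    IsManifold.of_le (n := ∞) (by simp [three_le_infty])
  have h := VectorField.mpullback_mlieBracket (n := ∞) (hV.mdifferentiableAt (by simp))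
    (hW.mdifferentiableAt (by simp)) (contMDiffAt_extChartAt_symm' hy)
    (by simp [two_le_infty])
  exact h.trans (congrFun (mlieBracket_eq_lieBracket (chartField c V) (chartField c W)) y)

theorem SmoothFieldAt.mlieBracket {V W : ∀ x : M, TangentSpace (𝓡 3) x} {x : M}
    (hV : SmoothFieldAt V x) (hW : SmoothFieldAt W x) :
    SmoothFieldAt (VectorField.mlieBracket (𝓡 3) V W) x := by
  have : IsManifold (𝓡 3) (((⊤ : ℕ∞) : WithTop ℕ∞) + 1) M := by simpa
  have : IsManifold (𝓡 3) (minSmoothness ℝ 3) M :=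
    IsManifold.of_le (n := ∞) (by simp [three_le_infty])
  have : IsManifold (𝓡 3) (minSmoothness ℝ 2) M :=
    IsManifold.of_le (n := ∞) (by simp [two_le_infty])
  exact ContMDiffAt.mlieBracket_vectorField (m := ⊤) (n := ⊤) hV hW (by simp)

theorem ContMDiffAt.mfderiv_field {E F HF N : Type*} [NormedAddCommGroup E] [NormedSpace ℝ E]
    [NormedAddCommGroup F] [NormedSpace ℝ F] [TopologicalSpace HF]
    {I : ModelWithCorners ℝ F HF} [TopologicalSpace N] [ChartedSpace HF N] [IsManifold I ∞ N]
    {H M : Type*} [TopologicalSpace H] {J : ModelWithCorners ℝ E H} [TopologicalSpace M]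
    [ChartedSpace H M] [IsManifold J ∞ M]
    {f : M → N} {V : ∀ x : M, TangentSpace J x} {x : M} (hf : ContMDiffAt J I ∞ f x)
    (hV : ContMDiffAt J J.tangent ∞ (fun x => (⟨x, V x⟩ : TangentBundle J M)) x) :
    ContMDiffAt J I.tangent ∞
      (fun x => (⟨f x, mfderiv J I f x (V x)⟩ : TangentBundle I N)) x := by
  have : IsManifold J 1 M := IsManifold.of_le (n := ∞) (by simp)
  have : IsManifold I 1 N := IsManifold.of_le (n := ∞) (by simp)
  exact (hf.mfderiv_const (m := ∞) (by simp)).clm_apply_of_inCoordinates hV hf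

theorem ContMDiffAt.fieldDeriv {F : Type*} [NormedAddCommGroup F] [NormedSpace ℝ F]
    {f : M → F} {V : ∀ x : M, TangentSpace (𝓡 3) x} {x : M}
    (hf : ContMDiffAt (𝓡 3) 𝓘(ℝ, F) ∞ f x) (hV : SmoothFieldAt V x) :
    ContMDiffAt (𝓡 3) 𝓘(ℝ, F) ∞ (fieldDeriv V f) x :=
  (contMDiff_snd_tangentBundle_modelSpace F 𝓘(ℝ, F)).contMDiffAt.comp x (hf.mfderiv_field hV)

theorem OneForm.IsSmooth.contMDiffAt_apply {θ : OneForm M} (hθ : θ.IsSmooth)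
    {V : ∀ x : M, TangentSpace (𝓡 3) x} {x : M} (hV : SmoothFieldAt V x) :
    ContMDiffAt (𝓡 3) 𝓘(ℝ, ℝ) ∞ (fun x => θ x (V x)) x := by
  have h := ContMDiffAt.clm_bundle_apply (F₁ := R3) (F₂ := ℝ) (E₁ := fun x : M => TangentSpace (𝓡 3) x)
    (E₂ := Bundle.Trivial M ℝ) (b := id) (hθ x) hV
  exact (Bundle.contMDiffAt_section x).1 h

/-- Smoothness in a neighbourhood, for functions. -/
abbrev SmoothNear {F : Type*} [NormedAddCommGroup F] [NormedSpace ℝ F] (f : M → F) (p : M) :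
    Prop :=
  ∀ᶠ x in 𝓝 p, ContMDiffAt (𝓡 3) 𝓘(ℝ, F) ∞ f x

/-- Smoothness in a neighbourhood, for vector fields. -/
abbrev SmoothFieldNear (V : ∀ x : M, TangentSpace (𝓡 3) x) (p : M) : Prop :=
  ∀ᶠ x in 𝓝 p, SmoothFieldAt V x

theorem eventually_extChartAt_symm {c : M} {y : R3} (hy : y ∈ (extChartAt (𝓡 3) c).target)
    {P : M → Prop} (h : ∀ᶠ x in 𝓝 ((extChartAt (𝓡 3) c).symm y), P x) :
    ∀ᶠ z in 𝓝 y, z ∈ (extChartAt (𝓡 3) c).target ∧ P ((extChartAt (𝓡 3) c).symm z) :=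
  (show ∀ᶠ z in 𝓝 y, z ∈ (extChartAt (𝓡 3) c).target from
    (isOpen_extChartAt_target c).mem_nhds hy).and
    ((contMDiffAt_extChartAt_symm' hy).continuousAt.eventually h)

omit [IsManifold (𝓡 3) ∞ M] in
theorem exists_extChartAt_symm_eq {c x : M} (hx : x ∈ (extChartAt (𝓡 3) c).source) :
    ∃ y ∈ (extChartAt (𝓡 3) c).target, (extChartAt (𝓡 3) c).symm y = x :=
  ⟨_, (extChartAt (𝓡 3) c).map_source hx, (extChartAt (𝓡 3) c).left_inv hx⟩

theorem ContMDiffAt.contDiffAt_comp_extChartAt_symm {F : Type*} [NormedAddCommGroup F]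
    [NormedSpace ℝ F] {f : M → F} {c : M} {y : R3} (hy : y ∈ (extChartAt (𝓡 3) c).target)
    (hf : ContMDiffAt (𝓡 3) 𝓘(ℝ, F) ∞ f ((extChartAt (𝓡 3) c).symm y)) :
    ContDiffAt ℝ ∞ (f ∘ (extChartAt (𝓡 3) c).symm) y :=
  (hf.comp y (contMDiffAt_extChartAt_symm' hy)).contDiffAt

theorem fieldDeriv_comp_extChartAt_symm {F : Type*} [NormedAddCommGroup F] [NormedSpace ℝ F]
    {f : M → F} {c : M} {y : R3} (hy : y ∈ (extChartAt (𝓡 3) c).target)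
    (hf : SmoothNear f ((extChartAt (𝓡 3) c).symm y)) (V : ∀ x : M, TangentSpace (𝓡 3) x) :
    fieldDeriv V f ∘ (extChartAt (𝓡 3) c).symm =ᶠ[𝓝 y]
      fun z => fderiv ℝ (f ∘ (extChartAt (𝓡 3) c).symm) z (chartField c V z) := by
  filter_upwards [eventually_extChartAt_symm hy hf] with z hz
  exact fieldDeriv_eq_fderiv_chartField hz.1 (hz.2.mdifferentiableAt (by simp)) V

/-- Pulled back by a chart, this is the formula in ℝ³, which rests on the symmetry of the second
derivative. -/
theorem fieldDeriv_mlieBracket {F : Type*} [NormedAddCommGroup F] [NormedSpace ℝ F]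
    {f : M → F} {V W : ∀ x : M, TangentSpace (𝓡 3) x} {p : M} (hf : SmoothNear f p)
    (hV : SmoothFieldAt V p) (hW : SmoothFieldAt W p) :
    fieldDeriv (VectorField.mlieBracket (𝓡 3) V W) f p
      = fieldDeriv V (fieldDeriv W f) p - fieldDeriv W (fieldDeriv V f) p := by
  -- The centre of the chart is separated from p, so that p can be replaced by the image of a point
  -- y of the model space without disturbing the chart.
  suffices h : ∀ c, p ∈ (extChartAt (𝓡 3) c).source →
      fieldDeriv (VectorField.mlieBracket (𝓡 3) V W) f p
        = fieldDeriv V (fieldDeriv W f) p - fieldDeriv W (fieldDeriv V f) p from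
    h p (mem_extChartAt_source p)
  intro c hc
  obtain ⟨y, hy, rfl⟩ := exists_extChartAt_symm_eq hc
  have hf0 := hf.self_of_nhds
  have d : ∀ {g : M → F}, ContMDiffAt (𝓡 3) 𝓘(ℝ, F) ∞ g ((extChartAt (𝓡 3) c).symm y) →
      MDifferentiableAt (𝓡 3) 𝓘(ℝ, F) g ((extChartAt (𝓡 3) c).symm y) := fun h =>
    h.mdifferentiableAt (by simp)
  rw [fieldDeriv_eq_fderiv_chartField hy (d hf0), fieldDeriv_eq_fderiv_chartField hy
    (d (hf0.fieldDeriv hV)), fieldDeriv_eq_fderiv_chartField hy (d (hf0.fieldDeriv hW)),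
    chartField_mlieBracket hy hV hW, (fieldDeriv_comp_extChartAt_symm hy hf V).fderiv_eq,
    (fieldDeriv_comp_extChartAt_symm hy hf W).fderiv_eq]
  exact VectorField.fderiv_apply_lieBracket (n := ∞) (hf0.contDiffAt_comp_extChartAt_symm hy)
    (by simp [two_le_infty]) ((contDiffAt_chartField hy hW).differentiableAt (by simp))
    ((contDiffAt_chartField hy hV).differentiableAt (by simp))

theorem OneForm.inChart_chartField (θ : OneForm M) {c : M} {y : R3}
    (hy : y ∈ (extChartAt (𝓡 3) c).target) (V : ∀ x : M, TangentSpace (𝓡 3) x) :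
    θ.inChart c y (chartField c V y)
      = θ ((extChartAt (𝓡 3) c).symm y) (V ((extChartAt (𝓡 3) c).symm y)) := by
  unfold OneForm.inChart
  exact congrArg _ (mfderiv_chartField hy V)

/-- In finite dimension, smoothness of an operator valued map may be tested on constant vectors;
each such value is θ applied to a smooth field along the inverse chart. -/
theorem OneForm.IsSmooth.contDiffAt_inChart {θ : OneForm M} (hθ : θ.IsSmooth) {c : M} {y : R3}
    (hy : y ∈ (extChartAt (𝓡 3) c).target) : ContDiffAt ℝ ∞ (θ.inChart c) y := by
  have h : ∀ v : R3, ∀ y ∈ (extChartAt (𝓡 3) c).target,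
      ContDiffAt ℝ ∞ (fun z => θ.inChart c z v) y := by
    intro v y hy
    have h1 : ContMDiffAt 𝓘(ℝ, R3) 𝓘(ℝ, R3).tangent ∞
        (fun z => (⟨z, v⟩ : TangentBundle 𝓘(ℝ, R3) R3)) y :=
      contMDiffAt_vectorSpace_iff_contDiffAt.2 contDiffAt_const
    have h2 := (contMDiffAt_extChartAt_symm' hy).mfderiv_field (V := fun _ => v) h1
    have h3 := ContMDiffAt.clm_bundle_apply (F₁ := R3) (F₂ := ℝ)
      (E₁ := fun x : M => TangentSpace (𝓡 3) x) (E₂ := Bundle.Trivial M ℝ)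
      (b := (extChartAt (𝓡 3) c).symm)
      ((hθ _).comp y (contMDiffAt_extChartAt_symm' hy)) h2
    exact (Bundle.contMDiffAt_totalSpace.1 h3).2.contDiffAt
  exact (contDiffOn_clm_apply.2 fun v z hz => (h v z hz).contDiffWithinAt).contDiffAt
    ((isOpen_extChartAt_target c).mem_nhds hy)

/-- The formula `dθ(V, W) = V(θ(W)) - W(θ(V)) - θ([V, W])`, with `dθ` computed in any chart. -/
theorem OneForm.IsSmooth.extDerivInChart_eq {θ : OneForm M} (hθ : θ.IsSmooth) {c x : M}
    (hx : x ∈ (extChartAt (𝓡 3) c).source) {V W : ∀ x : M, TangentSpace (𝓡 3) x}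
    (hV : SmoothFieldNear V x) (hW : SmoothFieldNear W x) :
    θ.extDerivInChart c (extChartAt (𝓡 3) c x) (chartField c V (extChartAt (𝓡 3) c x))
      (chartField c W (extChartAt (𝓡 3) c x))
    = fieldDeriv V (fun x => θ x (W x)) x - fieldDeriv W (fun x => θ x (V x)) x
      - θ x (VectorField.mlieBracket (𝓡 3) V W x) := by
  obtain ⟨y, hy, rfl⟩ := exists_extChartAt_symm_eq hx
  rw [(extChartAt (𝓡 3) c).right_inv hy]
  have hD : DifferentiableAt ℝ (θ.inChart c) y := (hθ.contDiffAt_inChart hy).differentiableAt (by simp)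
  have hVd := (contDiffAt_chartField hy hV.self_of_nhds).differentiableAt (by simp)
  have hWd := (contDiffAt_chartField hy hW.self_of_nhds).differentiableAt (by simp)
  -- Product rule in the chart. After antisymmetrising, the second summand is exactly θ([V, W]).
  have key : ∀ {V W : ∀ x : M, TangentSpace (𝓡 3) x},
      SmoothFieldNear W ((extChartAt (𝓡 3) c).symm y) →
      fieldDeriv V (fun x => θ x (W x)) ((extChartAt (𝓡 3) c).symm y)
        = fderiv ℝ (θ.inChart c) y (chartField c V y) (chartField c W y)
          + θ.inChart c y (fderiv ℝ (chartField c W) y (chartField c V y)) := by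
    intro V W hW
    rw [fieldDeriv_eq_fderiv_chartField hy
      ((hθ.contMDiffAt_apply hW.self_of_nhds).mdifferentiableAt (by simp))]
    have h : (fun x => θ x (W x)) ∘ (extChartAt (𝓡 3) c).symm =ᶠ[𝓝 y]
        fun z => θ.inChart c z (chartField c W z) := by
      filter_upwards [eventually_extChartAt_symm hy hW] with z hz
      exact (θ.inChart_chartField hz.1 W).symm
    rw [h.fderiv_eq, fderiv_clm_apply hD
      ((contDiffAt_chartField hy hW.self_of_nhds).differentiableAt (by simp))]
    simp [add_comm]
  rw [key hW, key hV, ← θ.inChart_chartField hy, chartField_mlieBracket hy hV.self_of_nhds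
    hW.self_of_nhds, VectorField.lieBracket_eq, map_sub]
  unfold OneForm.extDerivInChart
  ring

theorem OneForm.IsSmooth.extDeriv_eq {θ : OneForm M} (hθ : θ.IsSmooth) {x : M}
    {V W : ∀ x : M, TangentSpace (𝓡 3) x} (hV : SmoothFieldNear V x) (hW : SmoothFieldNear W x) :
    θ.extDeriv x (V x) (W x)
    = fieldDeriv V (fun x => θ x (W x)) x - fieldDeriv W (fun x => θ x (V x)) x
      - θ x (VectorField.mlieBracket (𝓡 3) V W x) := by
  rw [← hθ.extDerivInChart_eq (mem_extChartAt_source x) hV hW,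
    chartField_eq_mfderiv (mem_extChartAt_source x),
    chartField_eq_mfderiv (mem_extChartAt_source x)]
  rfl

/-- The extension has constant coefficients in the chart. It makes formulas stated for fields
available for single tangent vectors. -/
theorem exists_smoothFieldNear (x : M) (v : TangentSpace (𝓡 3) x) :
    ∃ V : ∀ x : M, TangentSpace (𝓡 3) x, SmoothFieldNear V x ∧ V x = v := by
  have : IsManifold (𝓡 3) 1 M := IsManifold.of_le (n := ∞) (by simp)
  let u : R3 := mfderiv (𝓡 3) 𝓘(ℝ, R3) (extChartAt (𝓡 3) x) x v
  refine ⟨VectorField.mpullback (𝓡 3) 𝓘(ℝ, R3) (extChartAt (𝓡 3) x) (fun _ => u), ?_, ?_⟩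
  · filter_upwards [(isOpen_extChartAt_source (I := 𝓡 3) x).mem_nhds (mem_extChartAt_source x)]
      with z hz
    have h1 : ContMDiffAt 𝓘(ℝ, R3) 𝓘(ℝ, R3).tangent ∞
        (fun z => (⟨z, u⟩ : TangentBundle 𝓘(ℝ, R3) R3)) (extChartAt (𝓡 3) x z) :=
      contMDiffAt_vectorSpace_iff_contDiffAt.2 contDiffAt_const
    exact ContMDiffAt.mpullback_vectorField_preimage h1
      (contMDiffAt_extChartAt' (n := ∞) (by rwa [extChartAt_source] at hz))
      (isInvertible_mfderiv_extChartAt hz) (by simp)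
  · change (mfderiv (𝓡 3) 𝓘(ℝ, R3) (extChartAt (𝓡 3) x) x).inverse u = v
    exact (isInvertible_mfderiv_extChartAt (mem_extChartAt_source x)).inverse_apply_eq.2 rfl

/-- The formula V(θ(W)) - W(θ(V)) - θ([V, W]) mentions no chart, so every chart computes the same
dθ. -/
theorem OneForm.IsSmooth.extDerivInChart_mfderiv {θ : OneForm M} (hθ : θ.IsSmooth) {c x : M}
    (hx : x ∈ (extChartAt (𝓡 3) c).source) (v w : TangentSpace (𝓡 3) x) :
    θ.extDerivInChart c (extChartAt (𝓡 3) c x)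
      (mfderiv (𝓡 3) 𝓘(ℝ, R3) (extChartAt (𝓡 3) c) x v)
      (mfderiv (𝓡 3) 𝓘(ℝ, R3) (extChartAt (𝓡 3) c) x w) = θ.extDeriv x v w := by
  obtain ⟨V, hV, rfl⟩ := exists_smoothFieldNear x v
  obtain ⟨W, hW, rfl⟩ := exists_smoothFieldNear x w
  rw [hθ.extDeriv_eq hV hW, ← hθ.extDerivInChart_eq hx hV hW, chartField_eq_mfderiv hx,
    chartField_eq_mfderiv hx]

theorem OneForm.IsSmooth.smoothNear_apply {θ : OneForm M} (hθ : θ.IsSmooth)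
    {V : ∀ x : M, TangentSpace (𝓡 3) x} {x : M} (hV : SmoothFieldNear V x) :
    SmoothNear (fun x => θ x (V x)) x :=
  hV.mono fun _ h => hθ.contMDiffAt_apply h

theorem SmoothNear.fieldDeriv {F : Type*} [NormedAddCommGroup F] [NormedSpace ℝ F]
    {f : M → F} {V : ∀ x : M, TangentSpace (𝓡 3) x} {x : M}
    (hf : SmoothNear f x) (hV : SmoothFieldNear V x) : SmoothNear (fieldDeriv V f) x := by
  filter_upwards [hf, hV] with y h1 h2 using h1.fieldDeriv h2

theorem SmoothFieldNear.mlieBracket {V W : ∀ x : M, TangentSpace (𝓡 3) x} {x : M}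
    (hV : SmoothFieldNear V x) (hW : SmoothFieldNear W x) :
    SmoothFieldNear (VectorField.mlieBracket (𝓡 3) V W) x := by
  filter_upwards [hV, hW] with y h1 h2 using SmoothFieldAt.mlieBracket h1 h2

theorem OneForm.IsSmooth.smoothNear_extDeriv {θ : OneForm M} (hθ : θ.IsSmooth) {x : M}
    {V W : ∀ x : M, TangentSpace (𝓡 3) x} (hV : SmoothFieldNear V x) (hW : SmoothFieldNear W x) :
    SmoothNear (fun x => θ.extDeriv x (V x) (W x)) x := by
  have h : SmoothNear (fun x => _root_.fieldDeriv V (fun x => θ x (W x)) x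
      - _root_.fieldDeriv W (fun x => θ x (V x)) x
      - θ x (VectorField.mlieBracket (𝓡 3) V W x)) x := by
    filter_upwards [(hθ.smoothNear_apply hW).fieldDeriv hV, (hθ.smoothNear_apply hV).fieldDeriv hW,
      hθ.smoothNear_apply (hV.mlieBracket hW)] with y h1 h2 h3 using (h1.sub h2).sub h3
  filter_upwards [h.eventually_nhds, hV.eventually_nhds, hW.eventually_nhds] with y h1 h2 h3
  refine h1.self_of_nhds.congr_of_eventuallyEq ?_
  filter_upwards [h2.eventually_nhds, h3.eventually_nhds] with z h4 h5
  exact hθ.extDeriv_eq h4 h5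

end Charts

section Bilinear

variable {M : Type*} [TopologicalSpace M] [ChartedSpace R3 M] (θ : OneForm M) (x : M)

theorem OneForm.extDeriv_swap (v w : TangentSpace (𝓡 3) x) :
    θ.extDeriv x v w = -θ.extDeriv x w v := by
  simp only [OneForm.extDeriv, OneForm.extDerivInChart]
  ring

theorem OneForm.extDeriv_self (v : TangentSpace (𝓡 3) x) : θ.extDeriv x v v = 0 := by
  simp only [OneForm.extDeriv, OneForm.extDerivInChart, sub_self]

theorem OneForm.extDerivInChart_add_left (c : M) (y u v w : R3) :
    θ.extDerivInChart c y (u + v) w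
      = θ.extDerivInChart c y u w + θ.extDerivInChart c y v w := by
  simp only [OneForm.extDerivInChart, map_add, add_apply]
  ring

theorem OneForm.extDerivInChart_smul_left (c : M) (a : ℝ) (y v w : R3) :
    θ.extDerivInChart c y (a • v) w = a * θ.extDerivInChart c y v w := by
  simp only [OneForm.extDerivInChart, map_smul, smul_apply, smul_eq_mul]
  ring

theorem OneForm.extDeriv_add_left (u v w : TangentSpace (𝓡 3) x) :
    θ.extDeriv x (u + v) w = θ.extDeriv x u w + θ.extDeriv x v w := by
  unfold OneForm.extDeriv
  rw [map_add]
  exact θ.extDerivInChart_add_left x _ _ _ _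

theorem OneForm.extDeriv_smul_left (a : ℝ) (v w : TangentSpace (𝓡 3) x) :
    θ.extDeriv x (a • v) w = a * θ.extDeriv x v w := by
  unfold OneForm.extDeriv
  rw [map_smul]
  exact θ.extDerivInChart_smul_left x _ _ _ _

theorem OneForm.extDeriv_add_right (u v w : TangentSpace (𝓡 3) x) :
    θ.extDeriv x u (v + w) = θ.extDeriv x u v + θ.extDeriv x u w := by
  rw [θ.extDeriv_swap, θ.extDeriv_add_left, θ.extDeriv_swap x u v, θ.extDeriv_swap x u w]
  ring

theorem OneForm.extDeriv_smul_right (a : ℝ) (v w : TangentSpace (𝓡 3) x) :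
    θ.extDeriv x v (a • w) = a * θ.extDeriv x v w := by
  rw [θ.extDeriv_swap, θ.extDeriv_smul_left, θ.extDeriv_swap x v w]
  ring

theorem OneForm.extDeriv_neg_left (v w : TangentSpace (𝓡 3) x) :
    θ.extDeriv x (-v) w = -θ.extDeriv x v w := by
  rw [← neg_one_smul ℝ, θ.extDeriv_smul_left]
  ring

theorem OneForm.extDeriv_neg_right (v w : TangentSpace (𝓡 3) x) :
    θ.extDeriv x v (-w) = -θ.extDeriv x v w := by
  rw [← neg_one_smul ℝ, θ.extDeriv_smul_right]
  ring

end Bilinear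

end

/-! ### Pointwise linear algebra of a contact form and smoothness of the Reeb field. -/

section

namespace CRStructure

variable {M : Type*} [TopologicalSpace M] [ChartedSpace R3 M] [IsManifold (𝓡 3) ∞ M]
  {S : CRStructure M} {θ : OneForm M}

section Pointwise

variable (h : S.IsContactForm θ) {X : ∀ x, S.H x} {x : M}

include h in
theorem IsContactForm.apply_vecX (X : ∀ x, S.H x) (x : M) : θ x (S.vecX X x) = 0 :=
  (h.ker_eq x _).2 (X x).2

include h in
theorem IsContactForm.apply_vecY (X : ∀ x, S.H x) (x : M) : θ x (S.vecY X x) = 0 :=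
  (h.ker_eq x _).2 (S.J x (X x)).2

/-- The frame `X, JX` spans `H` as soon as `X ≠ 0`. -/
theorem exists_eq_smul_add_smul (S : CRStructure M) {x : M} {X : S.H x} (hX : X ≠ 0) (v : S.H x) :
    ∃ a b : ℝ, v = a • X + b • S.J x X := by
  have hli : LinearIndependent ℝ ![X, S.J x X] := by
    rw [LinearIndependent.pair_iff]
    intro a b hab
    have h1 := congrArg (S.J x) hab
    rw [map_add, map_smul, map_smul, S.J_J, map_zero] at h1
    have h2 : (a ^ 2 + b ^ 2) • X = 0 := by
      -- Multiplying the relation by a - bJ gives (a² + b²) X = 0, since J² = -1.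
      have h3 : a • (a • X + b • S.J x X) - b • (a • S.J x X + b • -X) = 0 := by
        rw [hab, h1, smul_zero, smul_zero, sub_zero]
      rw [← h3]
      module
    have h4 : a ^ 2 + b ^ 2 = 0 := (smul_eq_zero.1 h2).resolve_right hX
    constructor <;> nlinarith [sq_nonneg a, sq_nonneg b]
  have hspan := hli.span_eq_top_of_card_eq_finrank (by rw [S.finrank_H]; rfl)
  have hv : v ∈ Submodule.span ℝ (Set.range ![X, S.J x X]) := hspan ▸ Submodule.mem_top
  rw [Matrix.range_cons, Matrix.range_cons, Matrix.range_empty, Set.union_empty,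
    Set.singleton_union, Submodule.mem_span_pair] at hv
  obtain ⟨a, b, hab⟩ := hv
  exact ⟨a, b, hab.symm⟩

theorem ne_zero_of_extDeriv_eq_one (hX : θ.extDeriv x (X x) (S.J x (X x)) = 1) : X x ≠ 0 := by
  intro h0
  have h1 := θ.extDeriv_smul_left x 0 (X x) (S.J x (X x))
  rw [hX, zero_smul, h0, map_zero] at h1
  have h2 := θ.extDeriv_self x (0 : TangentSpace (𝓡 3) x)
  rw [show ((0 : S.H x) : TangentSpace (𝓡 3) x) = 0 from rfl, h2] at h1
  rw [h0, map_zero, show ((0 : S.H x) : TangentSpace (𝓡 3) x) = 0 from rfl, h2] at hX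
  exact zero_ne_one hX

/-- The coefficients are read off by pairing with `X` and `JX` under dθ. -/
theorem eq_of_mem (hX : θ.extDeriv x (S.vecX X x) (S.vecY X x) = 1)
    {v : TangentSpace (𝓡 3) x} (hv : v ∈ S.H x) :
    v = θ.extDeriv x v (S.vecY X x) • S.vecX X x - θ.extDeriv x v (S.vecX X x) • S.vecY X x := by
  obtain ⟨a, b, hab⟩ := S.exists_eq_smul_add_smul (ne_zero_of_extDeriv_eq_one hX) ⟨v, hv⟩
  have hv' : v = a • S.vecX X x + b • S.vecY X x := congrArg Subtype.val hab
  have hX' := θ.extDeriv_swap x (S.vecY X x) (S.vecX X x)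
  rw [hX] at hX'
  have h1 : θ.extDeriv x v (S.vecY X x) = a := by
    rw [hv', θ.extDeriv_add_left, θ.extDeriv_smul_left, θ.extDeriv_smul_left, hX, θ.extDeriv_self]
    ring
  have h2 : θ.extDeriv x v (S.vecX X x) = -b := by
    rw [hv', θ.extDeriv_add_left, θ.extDeriv_smul_left, θ.extDeriv_smul_left, hX', θ.extDeriv_self]
    ring
  rw [h1, h2, neg_smul, sub_neg_eq_add]
  exact hv'

include h in
-- Any N with θ(N) = 1 is corrected by the element of H that makes its dθ-pairings with X and JX
-- vanish. Nondegeneracy of dθ on H gives uniqueness, so the vector selected by `Classical.epsilon`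
-- equals this explicit one.
theorem IsContactForm.reeb_of_frame (hX : θ.extDeriv x (S.vecX X x) (S.vecY X x) = 1)
    {N : TangentSpace (𝓡 3) x} (hN : θ x N = 1) :
    reeb θ x = N - θ.extDeriv x N (S.vecY X x) • S.vecX X x
      + θ.extDeriv x N (S.vecX X x) • S.vecY X x ∧
    θ x (reeb θ x) = 1 ∧ ∀ w, θ.extDeriv x (reeb θ x) w = 0 := by
  have hX' := θ.extDeriv_swap x (S.vecY X x) (S.vecX X x)
  rw [hX] at hX'
  set T : TangentSpace (𝓡 3) x := N - θ.extDeriv x N (S.vecY X x) • S.vecX X x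
      + θ.extDeriv x N (S.vecX X x) • S.vecY X x with hT
  have e1 : ∀ w, θ.extDeriv x T w = θ.extDeriv x N w
      - θ.extDeriv x N (S.vecY X x) * θ.extDeriv x (S.vecX X x) w
      + θ.extDeriv x N (S.vecX X x) * θ.extDeriv x (S.vecY X x) w := by
    intro w
    rw [hT, sub_eq_add_neg, ← neg_smul, θ.extDeriv_add_left, θ.extDeriv_add_left,
      θ.extDeriv_smul_left, θ.extDeriv_smul_left]
    ring
  have h1 : θ x T = 1 := by
    rw [hT, map_add, map_sub, map_smul, map_smul, h.apply_vecX, h.apply_vecY, hN]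
    simp
  have hTX : θ.extDeriv x T (S.vecX X x) = 0 := by
    rw [e1, θ.extDeriv_self, hX']; ring
  have hTY : θ.extDeriv x T (S.vecY X x) = 0 := by
    rw [e1, θ.extDeriv_self, hX]; ring
  have h2 : ∀ w, θ.extDeriv x T w = 0 := by
    intro w
    have hmem : w - θ x w • T ∈ S.H x := by
      rw [← h.ker_eq, map_sub, map_smul, h1, smul_eq_mul, mul_one, sub_self]
    have hw : w = θ x w • T + (w - θ x w • T) := by abel
    rw [hw, θ.extDeriv_add_right, θ.extDeriv_smul_right, θ.extDeriv_self,
      eq_of_mem hX hmem, sub_eq_add_neg, ← neg_smul, θ.extDeriv_add_right,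
      θ.extDeriv_smul_right, θ.extDeriv_smul_right, hTX, hTY]
    ring
  have hex : ∃ v, θ x v = 1 ∧ ∀ w, θ.extDeriv x v w = 0 := ⟨T, h1, h2⟩
  have hr : θ x (reeb θ x) = 1 ∧ ∀ w, θ.extDeriv x (reeb θ x) w = 0 := Classical.epsilon_spec hex
  refine ⟨?_, hr⟩
  have hmem : reeb θ x - T ∈ S.H x := by rw [← h.ker_eq, map_sub, hr.1, h1, sub_self]
  have h0 : ∀ w, θ.extDeriv x (reeb θ x - T) w = 0 := by
    intro w
    rw [sub_eq_add_neg, θ.extDeriv_add_left, θ.extDeriv_neg_left, hr.2, h2]; ring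
  have h3 := eq_of_mem hX hmem
  rw [h0, h0, zero_smul, zero_smul, sub_zero] at h3
  exact sub_eq_zero.1 h3

end Pointwise

section Frame

variable (h : S.IsContactForm θ) {X : ∀ x, S.H x} {p : M} (hX : S.IsUnitaryFrame θ X p)

include hX in
theorem IsUnitaryFrame.eventually : ∀ᶠ q in 𝓝 p, S.IsUnitaryFrame θ X q := by
  obtain ⟨U, hU, hp, h⟩ := hX
  filter_upwards [hU.mem_nhds hp] with q hq using ⟨U, hU, hq, h⟩

include hX in
theorem IsUnitaryFrame.smooth_vecX : SmoothFieldNear (S.vecX X) p := by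
  obtain ⟨U, hU, hp, h, -⟩ := hX
  filter_upwards [hU.mem_nhds hp] with q hq using h.contMDiffAt (hU.mem_nhds hq)

include hX in
theorem IsUnitaryFrame.smooth_vecY : SmoothFieldNear (S.vecY X) p := by
  obtain ⟨U, hU, hp, -, h, -⟩ := hX
  filter_upwards [hU.mem_nhds hp] with q hq using h.contMDiffAt (hU.mem_nhds hq)

include hX in
theorem IsUnitaryFrame.extDeriv_eq : θ.extDeriv p (S.vecX X p) (S.vecY X p) = 1 := by
  obtain ⟨U, hU, hp, -, -, h⟩ := hX
  exact h p hp

omit [IsManifold (𝓡 3) ∞ M] in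
theorem fieldDeriv_zero_fun (V : ∀ x : M, TangentSpace (𝓡 3) x) (a : ℝ) (x : M) :
    fieldDeriv V (fun _ => a) x = 0 := by
  unfold fieldDeriv
  rw [mfderiv_const]
  rfl

include h hX in
-- Since θ kills X and JX, dθ(X, JX) = -θ([X, JX]). Thus -[X, JX] is a smooth field transverse to H,
-- normalised as needed for the formula of the Reeb field.
theorem IsContactForm.apply_bracket_vecX_vecY :
    θ p (VectorField.mlieBracket (𝓡 3) (S.vecX X) (S.vecY X) p) = -1 := by
  have h1 := h.smooth.extDeriv_eq hX.smooth_vecX hX.smooth_vecY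
  simp only [h.apply_vecX, h.apply_vecY, fieldDeriv_zero_fun, hX.extDeriv_eq] at h1
  linarith

include h hX in
theorem IsContactForm.reeb_eq : reeb θ p =
    -VectorField.mlieBracket (𝓡 3) (S.vecX X) (S.vecY X) p
    - θ.extDeriv p (-VectorField.mlieBracket (𝓡 3) (S.vecX X) (S.vecY X) p) (S.vecY X p)
      • S.vecX X p
    + θ.extDeriv p (-VectorField.mlieBracket (𝓡 3) (S.vecX X) (S.vecY X) p) (S.vecX X p)
      • S.vecY X p :=
  (h.reeb_of_frame hX.extDeriv_eq
    (by rw [map_neg, h.apply_bracket_vecX_vecY hX, neg_neg])).1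

include h hX in
theorem IsContactForm.apply_reeb : θ p (reeb θ p) = 1 :=
  (h.reeb_of_frame hX.extDeriv_eq (N := -VectorField.mlieBracket (𝓡 3) (S.vecX X) (S.vecY X) p)
    (by rw [map_neg, h.apply_bracket_vecX_vecY hX, neg_neg])).2.1

include h hX in
theorem IsContactForm.extDeriv_reeb (w : TangentSpace (𝓡 3) p) :
    θ.extDeriv p (reeb θ p) w = 0 :=
  (h.reeb_of_frame hX.extDeriv_eq (N := -VectorField.mlieBracket (𝓡 3) (S.vecX X) (S.vecY X) p)
    (by rw [map_neg, h.apply_bracket_vecX_vecY hX, neg_neg])).2.2 w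

include h hX in
-- The pointwise choice is smooth because it agrees with an expression in brackets of the frame.
theorem IsContactForm.smooth_reeb : SmoothFieldNear (reeb θ) p := by
  have hB : SmoothFieldNear (fun q => -VectorField.mlieBracket (𝓡 3) (S.vecX X) (S.vecY X) q) p :=
    (hX.smooth_vecX.mlieBracket hX.smooth_vecY).mono fun q hq => hq.neg_section
  have h1 := h.smooth.smoothNear_extDeriv hB hX.smooth_vecX
  have h2 := h.smooth.smoothNear_extDeriv hB hX.smooth_vecY
  filter_upwards [h1, h2, hB, hX.smooth_vecX, hX.smooth_vecY, hX.eventually.eventually_nhds]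
    with q h1 h2 h3 h4 h5 h6
  refine ((h3.sub_section (h2.smul_section h4)).add_section
    (h1.smul_section h5)).congr_of_eventuallyEq ?_
  filter_upwards [h6] with r hr
  exact congrArg _ (h.reeb_eq hr)

include h hX in
theorem IsContactForm.eq_frame (w : TangentSpace (𝓡 3) p) :
    w = θ p w • reeb θ p + (θ.extDeriv p w (S.vecY X p) • S.vecX X p
      - θ.extDeriv p w (S.vecX X p) • S.vecY X p) := by
  have hmem : w - θ p w • reeb θ p ∈ S.H p := by
    rw [← h.ker_eq, map_sub, map_smul, h.apply_reeb hX, smul_eq_mul, mul_one, sub_self]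
  have e : ∀ u, θ.extDeriv p (w - θ p w • reeb θ p) u = θ.extDeriv p w u := by
    intro u
    rw [sub_eq_add_neg, ← neg_smul, θ.extDeriv_add_left, θ.extDeriv_smul_left,
      h.extDeriv_reeb hX]
    ring
  have h1 := eq_of_mem hX.extDeriv_eq hmem
  rw [e, e] at h1
  rw [← h1]
  abel

end Frame

end CRStructure

end

/-! ### Derivatives and smoothness of complex valued functions. -/

section

section ComplexFunctions

variable {M : Type*} [TopologicalSpace M] [ChartedSpace R3 M]

theorem diffAt_add_right (f : M → ℂ) (x : M) (v w : TangentSpace (𝓡 3) x) :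
    diffAt f x (v + w) = diffAt f x v + diffAt f x w :=
  map_add (mfderiv (𝓡 3) 𝓘(ℝ, ℂ) f x) v w

theorem diffAt_smul_right (f : M → ℂ) (x : M) (a : ℝ) (v : TangentSpace (𝓡 3) x) :
    diffAt f x (a • v) = a * diffAt f x v :=
  (map_smul (mfderiv (𝓡 3) 𝓘(ℝ, ℂ) f x) a v).trans (Complex.real_smul (x := a))

theorem diffAt_sub_right (f : M → ℂ) (x : M) (v w : TangentSpace (𝓡 3) x) :
    diffAt f x (v - w) = diffAt f x v - diffAt f x w :=
  map_sub (mfderiv (𝓡 3) 𝓘(ℝ, ℂ) f x) v w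

theorem Filter.EventuallyEq.diffAt_eq {f g : M → ℂ} {x : M} (h : f =ᶠ[𝓝 x] g)
    (v : TangentSpace (𝓡 3) x) : diffAt f x v = diffAt g x v := by
  unfold diffAt
  rw [h.mfderiv_eq]
  rfl

theorem diffAt_add {f g : M → ℂ} {x : M} (hf : MDifferentiableAt (𝓡 3) 𝓘(ℝ, ℂ) f x)
    (hg : MDifferentiableAt (𝓡 3) 𝓘(ℝ, ℂ) g x) (v : TangentSpace (𝓡 3) x) :
    diffAt (fun y => f y + g y) x v = diffAt f x v + diffAt g x v :=
  DFunLike.congr_fun (hf.hasMFDerivAt.add hg.hasMFDerivAt).mfderiv v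

theorem diffAt_mul {f g : M → ℂ} {x : M} (hf : MDifferentiableAt (𝓡 3) 𝓘(ℝ, ℂ) f x)
    (hg : MDifferentiableAt (𝓡 3) 𝓘(ℝ, ℂ) g x) (v : TangentSpace (𝓡 3) x) :
    diffAt (fun y => f y * g y) x v = f x * diffAt g x v + g x * diffAt f x v :=
  DFunLike.congr_fun (hf.hasMFDerivAt.mul hg.hasMFDerivAt).mfderiv v

theorem diffAt_const (a : ℂ) (x : M) (v : TangentSpace (𝓡 3) x) :
    diffAt (fun _ => a) x v = 0 := by
  unfold diffAt
  rw [mfderiv_const]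
  rfl

theorem diffAt_clm_comp (L : ℂ →L[ℝ] ℂ) {f : M → ℂ} {x : M}
    (hf : MDifferentiableAt (𝓡 3) 𝓘(ℝ, ℂ) f x) (v : TangentSpace (𝓡 3) x) :
    diffAt (fun y => L (f y)) x v = L (diffAt f x v) :=
  DFunLike.congr_fun
    (HasMFDerivAt.comp x (L.hasMFDerivAt (x := f x)) hf.hasMFDerivAt).mfderiv v

theorem diffAt_conj {f : M → ℂ} {x : M} (hf : MDifferentiableAt (𝓡 3) 𝓘(ℝ, ℂ) f x)
    (v : TangentSpace (𝓡 3) x) :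
    diffAt (fun y => (starRingEnd ℂ) (f y)) x v = (starRingEnd ℂ) (diffAt f x v) :=
  diffAt_clm_comp (Complex.conjCLE : ℂ →L[ℝ] ℂ) hf v

theorem diffAt_const_mul (a : ℂ) {f : M → ℂ} {x : M}
    (hf : MDifferentiableAt (𝓡 3) 𝓘(ℝ, ℂ) f x) (v : TangentSpace (𝓡 3) x) :
    diffAt (fun y => a * f y) x v = a * diffAt f x v := by
  rw [diffAt_mul mdifferentiableAt_const hf, diffAt_const, mul_zero, add_zero]

theorem diffAt_ofReal {f : M → ℝ} {x : M} (hf : MDifferentiableAt (𝓡 3) 𝓘(ℝ, ℝ) f x)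
    (v : TangentSpace (𝓡 3) x) :
    diffAt (fun y => (f y : ℂ)) x v = Complex.ofReal (mfderiv (𝓡 3) 𝓘(ℝ, ℝ) f x v) :=
  DFunLike.congr_fun
    (HasMFDerivAt.comp x (Complex.ofRealCLM.hasMFDerivAt (x := f x)) hf.hasMFDerivAt).mfderiv v

variable {p : M}

theorem SmoothNear.congr {F : Type*} [NormedAddCommGroup F] [NormedSpace ℝ F] {f g : M → F}
    (hf : SmoothNear f p) (h : g =ᶠ[𝓝 p] f) : SmoothNear g p := by
  filter_upwards [hf, h.eventually_nhds] with x h1 h2 using h1.congr_of_eventuallyEq h2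

theorem SmoothNear.const {F : Type*} [NormedAddCommGroup F] [NormedSpace ℝ F] (a : F) :
    SmoothNear (fun _ : M => a) p :=
  Filter.Eventually.of_forall fun _ => contMDiffAt_const

theorem SmoothNear.contDiff_comp {F G : Type*} [NormedAddCommGroup F] [NormedSpace ℝ F]
    [NormedAddCommGroup G] [NormedSpace ℝ G] {L : F → G} (hL : ContDiff ℝ ∞ L) {f : M → F}
    (hf : SmoothNear f p) : SmoothNear (fun x => L (f x)) p :=
  hf.mono fun _ h => hL.contDiffAt.comp_contMDiffAt h

theorem SmoothNear.contDiff_comp₂ {F₁ F₂ G : Type*} [NormedAddCommGroup F₁] [NormedSpace ℝ F₁]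
    [NormedAddCommGroup F₂] [NormedSpace ℝ F₂] [NormedAddCommGroup G] [NormedSpace ℝ G]
    {L : F₁ × F₂ → G} (hL : ContDiff ℝ ∞ L) {f : M → F₁} {g : M → F₂}
    (hf : SmoothNear f p) (hg : SmoothNear g p) : SmoothNear (fun x => L (f x, g x)) p := by
  filter_upwards [hf, hg] with x h1 h2 using hL.contDiffAt.comp_contMDiffAt (h1.prodMk_space h2)

theorem SmoothNear.add {F : Type*} [NormedAddCommGroup F] [NormedSpace ℝ F] {f g : M → F}
    (hf : SmoothNear f p) (hg : SmoothNear g p) : SmoothNear (fun x => f x + g x) p :=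
  hf.contDiff_comp₂ (contDiff_fst.add contDiff_snd) hg

theorem SmoothNear.sub {F : Type*} [NormedAddCommGroup F] [NormedSpace ℝ F] {f g : M → F}
    (hf : SmoothNear f p) (hg : SmoothNear g p) : SmoothNear (fun x => f x - g x) p :=
  hf.contDiff_comp₂ (contDiff_fst.sub contDiff_snd) hg

theorem SmoothNear.neg {F : Type*} [NormedAddCommGroup F] [NormedSpace ℝ F] {f : M → F}
    (hf : SmoothNear f p) : SmoothNear (fun x => -f x) p :=
  hf.contDiff_comp contDiff_neg

theorem SmoothNear.mul {F : Type*} [NormedRing F] [NormedAlgebra ℝ F] {f g : M → F}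
    (hf : SmoothNear f p) (hg : SmoothNear g p) : SmoothNear (fun x => f x * g x) p :=
  hf.contDiff_comp₂ (contDiff_fst.mul contDiff_snd) hg

theorem SmoothNear.ofReal {f : M → ℝ} (hf : SmoothNear f p) :
    SmoothNear (fun x => (f x : ℂ)) p :=
  hf.contDiff_comp Complex.ofRealCLM.contDiff

theorem SmoothNear.conj {f : M → ℂ} (hf : SmoothNear f p) :
    SmoothNear (fun x => (starRingEnd ℂ) (f x)) p :=
  hf.contDiff_comp (Complex.conjCLE : ℂ →L[ℝ] ℂ).contDiff

theorem SmoothNear.re {f : M → ℂ} (hf : SmoothNear f p) : SmoothNear (fun x => (f x).re) p :=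
  hf.contDiff_comp Complex.reCLM.contDiff

theorem SmoothNear.div_const {f : M → ℂ} (hf : SmoothNear f p) (a : ℂ) :
    SmoothNear (fun x => f x / a) p := by
  simp only [div_eq_mul_inv]
  exact hf.mul (SmoothNear.const _)

theorem SmoothNear.mdifferentiableAt {F : Type*} [NormedAddCommGroup F] [NormedSpace ℝ F]
    {f : M → F} (hf : SmoothNear f p) : MDifferentiableAt (𝓡 3) 𝓘(ℝ, F) f p :=
  hf.self_of_nhds.mdifferentiableAt (by simp)

end ComplexFunctions

end

/-! ### The operators Z, Z̄, T and their commutators. -/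

section

namespace CRStructure

theorem sqrt_two_mul_self : ((√2 : ℝ) : ℂ) * ((√2 : ℝ) : ℂ) = 2 := by
  rw [← Complex.ofReal_mul, Real.mul_self_sqrt (by norm_num)]
  norm_num

variable {M : Type*} [TopologicalSpace M] [ChartedSpace R3 M] [IsManifold (𝓡 3) ∞ M]
  {S : CRStructure M} {θ : OneForm M}

section Operators

variable {X : ∀ x, S.H x} {p : M} {f g : M → ℂ}

theorem vectorDeriv_vecX (f : M → ℂ) (x : M) :
    vectorDeriv (S.vecX X) f x = (S.dZ X f x + S.dZbar X f x) / (√2 : ℝ) := by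
  unfold dZ dZbar
  field_simp
  linear_combination vectorDeriv (S.vecX X) f x * sqrt_two_mul_self

theorem vectorDeriv_vecY (f : M → ℂ) (x : M) :
    vectorDeriv (S.vecY X) f x = Complex.I * (S.dZ X f x - S.dZbar X f x) / (√2 : ℝ) := by
  unfold dZ dZbar
  field_simp
  linear_combination vectorDeriv (S.vecY X) f x * sqrt_two_mul_self
    + 2 * vectorDeriv (S.vecY X) f x * Complex.I_mul_I

theorem dZ_congr (h : f =ᶠ[𝓝 p] g) : S.dZ X f =ᶠ[𝓝 p] S.dZ X g := by
  filter_upwards [h.eventually_nhds] with x hx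
  have hx : f =ᶠ[𝓝 x] g := hx
  simp only [dZ, vectorDeriv, hx.diffAt_eq]

theorem dZbar_congr (h : f =ᶠ[𝓝 p] g) : S.dZbar X f =ᶠ[𝓝 p] S.dZbar X g := by
  filter_upwards [h.eventually_nhds] with x hx
  have hx : f =ᶠ[𝓝 x] g := hx
  simp only [dZbar, vectorDeriv, hx.diffAt_eq]

theorem dT_congr (h : f =ᶠ[𝓝 p] g) : dT θ f =ᶠ[𝓝 p] dT θ g := by
  filter_upwards [h.eventually_nhds] with x hx
  have hx : f =ᶠ[𝓝 x] g := hx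
  simp only [dT, vectorDeriv, hx.diffAt_eq]

theorem dZ_add (hf : SmoothNear f p) (hg : SmoothNear g p) :
    S.dZ X (fun x => f x + g x) p = S.dZ X f p + S.dZ X g p := by
  simp only [dZ, vectorDeriv, diffAt_add hf.mdifferentiableAt hg.mdifferentiableAt]
  ring

theorem dZbar_add (hf : SmoothNear f p) (hg : SmoothNear g p) :
    S.dZbar X (fun x => f x + g x) p = S.dZbar X f p + S.dZbar X g p := by
  simp only [dZbar, vectorDeriv, diffAt_add hf.mdifferentiableAt hg.mdifferentiableAt]
  ring

theorem dT_add (hf : SmoothNear f p) (hg : SmoothNear g p) :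
    dT θ (fun x => f x + g x) p = dT θ f p + dT θ g p := by
  simp only [dT, vectorDeriv, diffAt_add hf.mdifferentiableAt hg.mdifferentiableAt]

theorem dZ_mul (hf : SmoothNear f p) (hg : SmoothNear g p) :
    S.dZ X (fun x => f x * g x) p = f p * S.dZ X g p + g p * S.dZ X f p := by
  simp only [dZ, vectorDeriv, diffAt_mul hf.mdifferentiableAt hg.mdifferentiableAt]
  ring

theorem dZbar_mul (hf : SmoothNear f p) (hg : SmoothNear g p) :
    S.dZbar X (fun x => f x * g x) p = f p * S.dZbar X g p + g p * S.dZbar X f p := by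
  simp only [dZbar, vectorDeriv, diffAt_mul hf.mdifferentiableAt hg.mdifferentiableAt]
  ring

theorem dT_mul (hf : SmoothNear f p) (hg : SmoothNear g p) :
    dT θ (fun x => f x * g x) p = f p * dT θ g p + g p * dT θ f p := by
  simp only [dT, vectorDeriv, diffAt_mul hf.mdifferentiableAt hg.mdifferentiableAt]

theorem dZ_const (a : ℂ) : S.dZ X (fun _ => a) p = 0 := by
  simp [dZ, vectorDeriv, diffAt_const]

theorem dZbar_const (a : ℂ) : S.dZbar X (fun _ => a) p = 0 := by
  simp [dZbar, vectorDeriv, diffAt_const]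

theorem dT_const (a : ℂ) : dT θ (fun _ => a) p = 0 := by
  simp [dT, vectorDeriv, diffAt_const]

theorem dZ_conj (hf : SmoothNear f p) :
    S.dZ X (fun x => conj (f x)) p = conj (S.dZbar X f p) := by
  simp only [dZ, dZbar, vectorDeriv, diffAt_conj hf.mdifferentiableAt, map_div₀, map_add, map_mul,
    Complex.conj_I, Complex.conj_ofReal]
  ring

theorem dZbar_conj (hf : SmoothNear f p) :
    S.dZbar X (fun x => conj (f x)) p = conj (S.dZ X f p) := by
  simp only [dZ, dZbar, vectorDeriv, diffAt_conj hf.mdifferentiableAt, map_div₀, map_sub, map_mul,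
    Complex.conj_I, Complex.conj_ofReal]
  ring

theorem dT_conj (hf : SmoothNear f p) : dT θ (fun x => conj (f x)) p = conj (dT θ f p) := by
  simp only [dT, vectorDeriv, diffAt_conj hf.mdifferentiableAt]

end Operators

section Commutators

variable (h : S.IsContactForm θ) {X : ∀ x, S.H x} {p : M} (hX : S.IsUnitaryFrame θ X p)
  {f : M → ℂ}

include hX in
theorem IsUnitaryFrame.smooth_dZ (hf : SmoothNear f p) : SmoothNear (S.dZ X f) p :=
  SmoothNear.div_const (SmoothNear.sub (hf.fieldDeriv hX.smooth_vecX)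
    ((SmoothNear.const Complex.I).mul (hf.fieldDeriv hX.smooth_vecY))) _

include hX in
theorem IsUnitaryFrame.smooth_dZbar (hf : SmoothNear f p) : SmoothNear (S.dZbar X f) p :=
  SmoothNear.div_const (SmoothNear.add (hf.fieldDeriv hX.smooth_vecX)
    ((SmoothNear.const Complex.I).mul (hf.fieldDeriv hX.smooth_vecY))) _

include h hX in
theorem IsContactForm.smooth_dT (hf : SmoothNear f p) : SmoothNear (dT θ f) p :=
  hf.fieldDeriv (h.smooth_reeb hX)

include h hX in
theorem IsContactForm.smooth_coframe {V : ∀ x : M, TangentSpace (𝓡 3) x}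
    (hV : SmoothFieldNear V p) : SmoothNear (fun x => S.coframe θ X x (V x)) p := by
  unfold coframe
  exact ((SmoothNear.const _).mul (SmoothNear.add
    (h.smooth.smoothNear_extDeriv hV hX.smooth_vecX).ofReal
    ((SmoothNear.const _).mul (h.smooth.smoothNear_extDeriv hV hX.smooth_vecY).ofReal))).div_const _

include h hX in
theorem IsContactForm.smooth_omegaZbar : SmoothNear (S.omegaZbar θ X) p :=
  (SmoothNear.const _).mul (h.smooth_coframe hX (hX.smooth_vecX.mlieBracket hX.smooth_vecY))

include h hX in
theorem IsContactForm.smooth_omegaT : SmoothNear (S.omegaT θ X) p :=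
  ((h.smooth_coframe hX ((h.smooth_reeb hX).mlieBracket hX.smooth_vecX)).sub
    ((SmoothNear.const _).mul
      (h.smooth_coframe hX ((h.smooth_reeb hX).mlieBracket hX.smooth_vecY)))).div_const _

include h hX in
theorem IsContactForm.smooth_torsion : SmoothNear (S.torsion θ X) p :=
  (((h.smooth_coframe hX ((h.smooth_reeb hX).mlieBracket hX.smooth_vecX)).add
    ((SmoothNear.const _).mul
      (h.smooth_coframe hX ((h.smooth_reeb hX).mlieBracket hX.smooth_vecY)))).div_const _).neg.conj

include h hX in
theorem IsContactForm.diffAt_eq (f : M → ℂ) (w : TangentSpace (𝓡 3) p) :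
    diffAt f p w = θ p w * dT θ f p + S.coframe θ X p w * S.dZ X f p
      + conj (S.coframe θ X p w) * S.dZbar X f p := by
  have h1 : diffAt f p w = θ p w * dT θ f p + (θ.extDeriv p w (S.vecY X p)
      * vectorDeriv (S.vecX X) f p - θ.extDeriv p w (S.vecX X p)
      * vectorDeriv (S.vecY X) f p) := by
    conv_lhs => rw [h.eq_frame hX w]
    rw [diffAt_add_right, diffAt_sub_right, diffAt_smul_right, diffAt_smul_right,
      diffAt_smul_right]
    rfl
  rw [h1, vectorDeriv_vecX, vectorDeriv_vecY]
  simp only [coframe, map_div₀, map_add, map_mul, map_neg, Complex.conj_I, Complex.conj_ofReal]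
  linear_combination (θ.extDeriv p w (S.vecY X p) *
    (S.dZ X f p + S.dZbar X f p) / (√2 : ℝ)) * Complex.I_mul_I

include h hX in
-- θ(T) = 1 and θ(X) = 0 are constant and T ⌟ dθ = 0, so the formula for dθ(T, X) leaves only θ([T,
-- X]).
theorem IsContactForm.apply_bracket_reeb_vecX :
    θ p (VectorField.mlieBracket (𝓡 3) (reeb θ) (S.vecX X) p) = 0 := by
  have h1 := h.smooth.extDeriv_eq (h.smooth_reeb hX) hX.smooth_vecX
  have h2 : (fun x => θ x (reeb θ x)) =ᶠ[𝓝 p] fun _ => 1 :=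
    hX.eventually.mono fun q hq => h.apply_reeb hq
  have h3 : fieldDeriv (S.vecX X) (fun x => θ x (reeb θ x)) p = 0 := by
    unfold fieldDeriv
    rw [h2.mfderiv_eq, mfderiv_const]
    rfl
  simp only [h.apply_vecX, fieldDeriv_zero_fun, h3, h.extDeriv_reeb hX] at h1
  linarith

include h hX in
theorem IsContactForm.apply_bracket_reeb_vecY :
    θ p (VectorField.mlieBracket (𝓡 3) (reeb θ) (S.vecY X) p) = 0 := by
  have h1 := h.smooth.extDeriv_eq (h.smooth_reeb hX) hX.smooth_vecY
  have h2 : (fun x => θ x (reeb θ x)) =ᶠ[𝓝 p] fun _ => 1 :=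
    hX.eventually.mono fun q hq => h.apply_reeb hq
  have h3 : fieldDeriv (S.vecY X) (fun x => θ x (reeb θ x)) p = 0 := by
    unfold fieldDeriv
    rw [h2.mfderiv_eq, mfderiv_const]
    rfl
  simp only [h.apply_vecY, fieldDeriv_zero_fun, h3, h.extDeriv_reeb hX] at h1
  linarith

theorem vectorDeriv_commutator {V W : ∀ x : M, TangentSpace (𝓡 3) x} (hf : SmoothNear f p)
    (hV : SmoothFieldNear V p) (hW : SmoothFieldNear W p) :
    vectorDeriv V (vectorDeriv W f) p - vectorDeriv W (vectorDeriv V f) p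
      = diffAt f p (VectorField.mlieBracket (𝓡 3) V W p) :=
  (fieldDeriv_mlieBracket hf hV.self_of_nhds hW.self_of_nhds).symm

theorem vectorDeriv_linear (V : ∀ x : M, TangentSpace (𝓡 3) x) {f g : M → ℂ}
    (hf : SmoothNear f p) (hg : SmoothNear g p) (a b : ℂ) :
    vectorDeriv V (fun x => (f x + a * g x) / b) p
      = (vectorDeriv V f p + a * vectorDeriv V g p) / b := by
  have h1 : (fun x => (f x + a * g x) / b) = fun x => b⁻¹ * (f x + a * g x) := by
    funext x; ring
  unfold vectorDeriv
  rw [h1, diffAt_const_mul _ (hf.add ((SmoothNear.const a).mul hg)).mdifferentiableAt,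
    diffAt_add hf.mdifferentiableAt ((SmoothNear.const a).mul hg).mdifferentiableAt,
    diffAt_const_mul _ hg.mdifferentiableAt]
  ring

include hX in
theorem IsUnitaryFrame.vectorDeriv_dZ (V : ∀ x : M, TangentSpace (𝓡 3) x) (hf : SmoothNear f p) :
    vectorDeriv V (S.dZ X f) p = (vectorDeriv V (vectorDeriv (S.vecX X) f) p
      - Complex.I * vectorDeriv V (vectorDeriv (S.vecY X) f) p) / (√2 : ℝ) := by
  have h1 := vectorDeriv_linear V (hf.fieldDeriv hX.smooth_vecX) (hf.fieldDeriv hX.smooth_vecY)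
    (-Complex.I) (√2 : ℝ)
  simp only [neg_mul, ← sub_eq_add_neg] at h1
  exact h1

include hX in
theorem IsUnitaryFrame.vectorDeriv_dZbar (V : ∀ x : M, TangentSpace (𝓡 3) x)
    (hf : SmoothNear f p) :
    vectorDeriv V (S.dZbar X f) p = (vectorDeriv V (vectorDeriv (S.vecX X) f) p
      + Complex.I * vectorDeriv V (vectorDeriv (S.vecY X) f) p) / (√2 : ℝ) :=
  vectorDeriv_linear V (hf.fieldDeriv hX.smooth_vecX) (hf.fieldDeriv hX.smooth_vecY)
    Complex.I (√2 : ℝ)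

include h hX in
-- Decompose [X, JX] in the frame: its θ-component -1 produces iT, and its θ¹-component is ω(Z̄) up
-- to the factor i.
theorem IsContactForm.comm_dZbar_dZ (hf : SmoothNear f p) :
    S.dZbar X (S.dZ X f) p = S.dZ X (S.dZbar X f) p + Complex.I * dT θ f p
      + S.omegaZbar θ X p * S.dZ X f p - conj (S.omegaZbar θ X p) * S.dZbar X f p := by
  have h1 := vectorDeriv_commutator hf hX.smooth_vecX hX.smooth_vecY
  rw [h.diffAt_eq hX, h.apply_bracket_vecX_vecY hX] at h1
  rw [dZbar, dZ, hX.vectorDeriv_dZ _ hf, hX.vectorDeriv_dZ _ hf, hX.vectorDeriv_dZbar _ hf,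
    hX.vectorDeriv_dZbar _ hf]
  simp only [omegaZbar, map_mul, map_neg, Complex.conj_I]
  push_cast at h1
  field_simp
  linear_combination (-2 * Complex.I) * h1 - Complex.I * (dT θ f p
    - S.coframe θ X p (VectorField.mlieBracket (𝓡 3) (S.vecX X) (S.vecY X) p) * S.dZ X f p
    - conj (S.coframe θ X p (VectorField.mlieBracket (𝓡 3) (S.vecX X) (S.vecY X) p))
      * S.dZbar X f p) * sqrt_two_mul_self

include h hX in
theorem IsContactForm.comm_dT_dZ (hf : SmoothNear f p) :
    dT θ (S.dZ X f) p = S.dZ X (dT θ f) p + S.omegaT θ X p * S.dZ X f p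
      - S.torsion θ X p * S.dZbar X f p := by
  have h1 := vectorDeriv_commutator hf (h.smooth_reeb hX) hX.smooth_vecX
  have h2 := vectorDeriv_commutator hf (h.smooth_reeb hX) hX.smooth_vecY
  rw [h.diffAt_eq hX, h.apply_bracket_reeb_vecX hX] at h1
  rw [h.diffAt_eq hX, h.apply_bracket_reeb_vecY hX] at h2
  have h3 : dT θ (S.dZ X f) p = _ := hX.vectorDeriv_dZ (reeb θ) hf
  have h4 : S.dZ X (dT θ f) p = (vectorDeriv (S.vecX X) (vectorDeriv (reeb θ) f) p
    - Complex.I * vectorDeriv (S.vecY X) (vectorDeriv (reeb θ) f) p) / (√2 : ℝ) := rfl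
  rw [h3, h4]
  simp only [omegaT, torsion, map_mul, map_neg, Complex.conj_I, map_div₀, map_add,
    Complex.conj_ofReal]
  push_cast at h1 h2
  linear_combination (h1 - Complex.I * h2) / (√2 : ℝ)

include h hX in
-- The conjugate of ω(T) appears here; it can be replaced by -ω(T) only after the Jacobi identity
-- has been used (`germ_omegaT`).
theorem IsContactForm.comm_dT_dZbar (hf : SmoothNear f p) :
    dT θ (S.dZbar X f) p = S.dZbar X (dT θ f) p + conj (S.omegaT θ X p) * S.dZbar X f p
      - conj (S.torsion θ X p) * S.dZ X f p := by
  have h1 := vectorDeriv_commutator hf (h.smooth_reeb hX) hX.smooth_vecX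
  have h2 := vectorDeriv_commutator hf (h.smooth_reeb hX) hX.smooth_vecY
  rw [h.diffAt_eq hX, h.apply_bracket_reeb_vecX hX] at h1
  rw [h.diffAt_eq hX, h.apply_bracket_reeb_vecY hX] at h2
  have h3 : dT θ (S.dZbar X f) p = _ := hX.vectorDeriv_dZbar (reeb θ) hf
  have h4 : S.dZbar X (dT θ f) p = (vectorDeriv (S.vecX X) (vectorDeriv (reeb θ) f) p
    + Complex.I * vectorDeriv (S.vecY X) (vectorDeriv (reeb θ) f) p) / (√2 : ℝ) := rfl
  rw [h3, h4]
  simp only [omegaT, torsion, map_mul, map_sub, Complex.conj_I, map_div₀, Complex.conj_conj,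
    Complex.conj_ofReal]
  push_cast at h1 h2
  linear_combination (h1 + Complex.I * h2) / (√2 : ℝ)

end Commutators

end CRStructure

end

/-! ### The Jacobi identity and the ring of germs of smooth functions. -/

section

/-- If three derivations satisfy commutation relations of pseudohermitian type, the Jacobi
identity forces the `T`-component of the connection form to be imaginary. -/
theorem Derivation.add_eq_zero_of_commutators {𝒜 : Type*} [CommRing 𝒜] {i w wb t tb A Ab : 𝒜}
    {Z Zb T : Derivation ℤ 𝒜 𝒜} (i_sq : i * i = -1) (T_i : T i = 0)
    (comm_Zb_Z : ∀ f, Zb (Z f) = Z (Zb f) + i * T f + w * Z f - wb * Zb f)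
    (comm_T_Z : ∀ f, T (Z f) = Z (T f) + t * Z f - A * Zb f)
    (comm_T_Zb : ∀ f, T (Zb f) = Zb (T f) + tb * Zb f - Ab * Z f)
    (indep : ∀ a b c, (∀ f, a * T f + b * Z f + c * Zb f = 0) → a = 0 ∧ b = 0 ∧ c = 0) :
    t + tb = 0 := by
  -- T Z̄ Z f is reduced in two ways. In the resulting first order relation the coefficient of T f
  -- is -i(t + t̄), and by independence it vanishes.
  have h : ∀ f, (-(i * (t + tb))) * T f
      + (T w - Z Ab + wb * Ab - Zb t - tb * w) * Z f
      + (Z tb - w * A - T wb + t * wb + Zb A) * Zb f = 0 := by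
    intro f
    have h1 := comm_T_Zb (Z f)
    rw [comm_T_Z f, comm_Zb_Z f] at h1
    simp only [map_add, map_sub, Derivation.leibniz, smul_eq_mul, T_i, comm_T_Z,
      comm_T_Zb, comm_Zb_Z] at h1
    linear_combination h1
  linear_combination i * (indep _ _ _ h).1 + (t + tb) * i_sq

variable {M : Type*} [TopologicalSpace M] [ChartedSpace R3 M]

/-- The ring of germs at `p` of functions that are smooth near `p`. -/
def smoothGerm (p : M) : Subring (Filter.Germ (𝓝 p) ℂ) where
  carrier := {g | ∃ f : M → ℂ, SmoothNear f p ∧ (f : Filter.Germ (𝓝 p) ℂ) = g}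
  mul_mem' := by
    rintro _ _ ⟨f, hf, rfl⟩ ⟨g, hg, rfl⟩
    exact ⟨fun x => f x * g x, hf.mul hg, rfl⟩
  one_mem' := ⟨fun _ => 1, SmoothNear.const 1, rfl⟩
  add_mem' := by
    rintro _ _ ⟨f, hf, rfl⟩ ⟨g, hg, rfl⟩
    exact ⟨fun x => f x + g x, hf.add hg, rfl⟩
  zero_mem' := ⟨fun _ => 0, SmoothNear.const 0, rfl⟩
  neg_mem' := by
    rintro _ ⟨f, hf, rfl⟩
    exact ⟨fun x => -f x, hf.neg, rfl⟩

namespace smoothGerm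

variable {p : M} {f g : M → ℂ}

/-- The germ of a smooth function. -/
def mk (f : M → ℂ) (hf : SmoothNear f p) : smoothGerm p := ⟨f, f, hf, rfl⟩

theorem ind {P : smoothGerm p → Prop} (h : ∀ f hf, P (mk f hf)) (a : smoothGerm p) : P a := by
  obtain ⟨_, f, hf, rfl⟩ := a
  exact h f hf

theorem mk_eq_mk {hf : SmoothNear f p} {hg : SmoothNear g p} :
    mk f hf = mk g hg ↔ f =ᶠ[𝓝 p] g :=
  Subtype.ext_iff.trans Filter.Germ.coe_eq

theorem mk_add (hf : SmoothNear f p) (hg : SmoothNear g p) :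
    mk f hf + mk g hg = mk (fun x => f x + g x) (hf.add hg) := rfl

theorem mk_sub (hf : SmoothNear f p) (hg : SmoothNear g p) :
    mk f hf - mk g hg = mk (fun x => f x - g x) (hf.sub hg) := rfl

theorem mk_mul (hf : SmoothNear f p) (hg : SmoothNear g p) :
    mk f hf * mk g hg = mk (fun x => f x * g x) (hf.mul hg) := rfl

theorem mk_neg (hf : SmoothNear f p) : -mk f hf = mk (fun x => -f x) hf.neg := rfl

/-- The value of a germ. -/
def eval (p : M) : smoothGerm p →+* ℂ :=
  Filter.Germ.valueRingHom.comp (smoothGerm p).subtype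

theorem eval_mk (hf : SmoothNear f p) : eval p (mk f hf) = f p := rfl

/-- A smooth function representing a germ. -/
noncomputable def rep (a : smoothGerm p) : M → ℂ := a.2.choose

theorem smooth_rep (a : smoothGerm p) : SmoothNear (rep a) p := a.2.choose_spec.1

theorem mk_rep (a : smoothGerm p) : mk (rep a) (smooth_rep a) = a :=
  Subtype.ext a.2.choose_spec.2

theorem rep_mk (hf : SmoothNear f p) : rep (mk f hf) =ᶠ[𝓝 p] f :=
  mk_eq_mk.1 (mk_rep (mk f hf))

/-- Complex conjugation of germs. -/
noncomputable def conjHom (p : M) : smoothGerm p →+* smoothGerm p where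
  toFun a := mk (fun x => conj (rep a x)) (smooth_rep a).conj
  map_one' := mk_eq_mk (hg := SmoothNear.const 1).2 <|
    (rep_mk (p := p) (SmoothNear.const 1)).mono fun x hx => by
      exact (congrArg conj hx).trans (map_one _)
  map_zero' := mk_eq_mk (hg := SmoothNear.const 0).2 <|
    (rep_mk (p := p) (SmoothNear.const 0)).mono fun x hx => by
      exact (congrArg conj hx).trans (map_zero _)
  map_add' := by
    intro a b
    induction a using ind with | h f hf
    induction b using ind with | h g hg
    rw [mk_add, mk_add]
    rw [mk_eq_mk]
    filter_upwards [rep_mk hf, rep_mk hg, rep_mk (hf.add hg)] with x h1 h2 h3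
    rw [h1, h2, h3, map_add]
  map_mul' := by
    intro a b
    induction a using ind with | h f hf
    induction b using ind with | h g hg
    rw [mk_mul, mk_mul]
    rw [mk_eq_mk]
    filter_upwards [rep_mk hf, rep_mk hg, rep_mk (hf.mul hg)] with x h1 h2 h3
    rw [h1, h2, h3, map_mul]

theorem conjHom_mk (hf : SmoothNear f p) :
    conjHom p (mk f hf) = mk (fun x => conj (f x)) hf.conj :=
  (mk_eq_mk (hf := (smooth_rep (mk f hf)).conj)).2 <| (rep_mk hf).mono fun _ hx => congrArg conj hx

theorem eval_conjHom (a : smoothGerm p) : eval p (conjHom p a) = conj (eval p a) := by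
  induction a using ind with | h f hf
  rw [conjHom_mk, eval_mk, eval_mk]

/-- The derivation of the ring of germs defined by a local differential operator. -/
noncomputable def derivation (L : (M → ℂ) → M → ℂ) (smooth : ∀ f, SmoothNear f p → SmoothNear (L f) p)
    (congr : ∀ f g, f =ᶠ[𝓝 p] g → L f =ᶠ[𝓝 p] L g)
    (add : ∀ f g (q : M), SmoothNear f q → SmoothNear g q →
      L (fun x => f x + g x) q = L f q + L g q)
    (mul : ∀ f g (q : M), SmoothNear f q → SmoothNear g q →
      L (fun x => f x * g x) q = f q * L g q + g q * L f q) :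
    Derivation ℤ (smoothGerm p) (smoothGerm p) :=
  Derivation.mk' (AddMonoidHom.toIntLinearMap (AddMonoidHom.mk'
    (fun a => mk (L (rep a)) (smooth _ (smooth_rep a))) (by
      intro a b
      induction a using ind with | h f hf
      induction b using ind with | h g hg
      rw [mk_add, mk_add, mk_eq_mk]
      filter_upwards [congr _ _ (rep_mk hf), congr _ _ (rep_mk hg), congr _ _ (rep_mk (hf.add hg)),
        hf.eventually_nhds, hg.eventually_nhds] with x h1 h2 h3 h4 h5
      rw [h1, h2, h3, add f g x h4 h5]))) (by
    intro a b
    induction a using ind with | h f hf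
    induction b using ind with | h g hg
    change mk (L (rep (mk f hf * mk g hg))) (smooth _ (smooth_rep _))
      = mk f hf * mk (L (rep (mk g hg))) (smooth _ (smooth_rep _))
        + mk g hg * mk (L (rep (mk f hf))) (smooth _ (smooth_rep _))
    rw [mk_mul, mk_mul, mk_mul, mk_add, mk_eq_mk]
    filter_upwards [congr _ _ (rep_mk hf), congr _ _ (rep_mk hg), congr _ _ (rep_mk (hf.mul hg)),
      hf.eventually_nhds, hg.eventually_nhds] with x h1 h2 h3 h4 h5
    rw [h1, h2, h3, mul f g x h4 h5])

theorem derivation_mk {L : (M → ℂ) → M → ℂ} (smooth : ∀ f, SmoothNear f p → SmoothNear (L f) p)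
    (congr : ∀ f g, f =ᶠ[𝓝 p] g → L f =ᶠ[𝓝 p] L g)
    (add : ∀ f g (q : M), SmoothNear f q → SmoothNear g q →
      L (fun x => f x + g x) q = L f q + L g q)
    (mul : ∀ f g (q : M), SmoothNear f q → SmoothNear g q →
      L (fun x => f x * g x) q = f q * L g q + g q * L f q) (hf : SmoothNear f p) :
    derivation L smooth congr add mul (mk f hf) = mk (L f) (smooth f hf) :=
  (mk_eq_mk (hf := smooth _ (smooth_rep (mk f hf)))).2 (congr _ _ (rep_mk hf))

end smoothGerm

end

/-! ### Conjugation, and the Webster algebra of germs attached to a unitary frame. -/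

section

namespace WebsterAlgebra

variable {𝒜 : Type*} [CommRing 𝒜] {i : 𝒜} {P : WebsterAlgebra i}

/-- A ring homomorphism that behaves like complex conjugation. -/
structure Conjugation (P : WebsterAlgebra i) (c : 𝒜 →+* 𝒜) : Prop where
  map_i : c i = -i
  map_Z : ∀ f, c (P.Z f) = P.Zb (c f)
  map_Zb : ∀ f, c (P.Zb f) = P.Z (c f)
  map_T : ∀ f, c (P.T f) = P.T (c f)
  map_w : c P.w = P.wb
  map_wb : c P.wb = P.w
  map_t : c P.t = -P.t
  map_A : c P.A = P.Ab

namespace Conjugation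

variable {c : 𝒜 →+* 𝒜} (hc : P.Conjugation c)
include hc

theorem map_R : c P.R = P.R := by
  simp only [R, map_add, map_sub, map_mul, hc.map_Z, hc.map_Zb, hc.map_w, hc.map_wb, hc.map_i,
    hc.map_t, map_ofNat]
  ring

theorem map_lap (f : 𝒜) : c (P.lap f) = P.lap (c f) := by
  simp only [lap, div, divb, map_add, map_sub, map_mul, map_neg, hc.map_Z, hc.map_Zb, hc.map_w,
    hc.map_wb]
  ring

theorem map_div (f : 𝒜) : c (P.div f) = P.divb (c f) := by
  simp only [div, divb, map_sub, map_mul, hc.map_Zb, hc.map_w]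

theorem map_W : c P.W = P.Wb := by
  simp only [W, Wb, divA, divAb, map_sub, map_mul, hc.map_Z, hc.map_Zb, hc.map_w, hc.map_i,
    hc.map_A, map_ofNat, hc.map_R]
  ring

theorem map_P1 (s : 𝒜) : c (P.P1 s) = P.P1b (c s) := by
  simp only [P1, P1b, divb, div, map_add, map_sub, map_mul, hc.map_Z, hc.map_Zb, hc.map_wb,
    hc.map_i, hc.map_A]
  ring

theorem map_divA : c P.divA = P.divAb := by
  simp only [divA, divAb, map_sub, map_mul, hc.map_Zb, hc.map_w, hc.map_A, map_ofNat]

theorem map_divAgrad (f : 𝒜) : c (P.divAgrad f) = P.divAgradb (c f) := by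
  simp only [divAgrad, divAgradb, hc.map_div, map_mul, hc.map_A, hc.map_Zb]

theorem map_flux (s : 𝒜) : c (P.flux s) = P.fluxb (c s) := by
  simp only [flux, fluxb, map_add, map_sub, map_mul, map_neg, map_pow, hc.map_Z, hc.map_Zb,
    hc.map_i, hc.map_A, hc.map_lap, hc.map_R, map_ofNat]
  ring

end Conjugation

/-- Taking the divergence of ZR = i∇A and adding the conjugate gives Δ_b R = 2 Im ∇∇A. Hence the
zeroth order term of P'₄ vanishes for pseudo-Einstein forms. -/
theorem lap_R_of_W_eq_zero (hW : P.W = 0) (hWb : P.Wb = 0) :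
    P.lap P.R = -i * (P.div P.divA - P.divb P.divAb) := by
  unfold W at hW
  unfold Wb at hWb
  have h1 : P.Z P.R = i * P.divA := by linear_combination hW
  have h2 : P.Zb P.R = -i * P.divAb := by linear_combination hWb
  unfold lap div divb
  rw [h1, h2]
  simp only [Derivation.leibniz, map_neg, P.Z_i, P.Zb_i, smul_eq_mul]
  ring

end WebsterAlgebra

theorem diffAt_clm_extChartAt {M : Type*} [TopologicalSpace M] [ChartedSpace R3 M]
    [IsManifold (𝓡 3) ∞ M] (L : R3 →L[ℝ] ℂ) {c x : M} (hx : x ∈ (extChartAt (𝓡 3) c).source)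
    (v : TangentSpace (𝓡 3) x) :
    diffAt (fun y => L (extChartAt (𝓡 3) c y)) x v
      = L (mfderiv (𝓡 3) 𝓘(ℝ, R3) (extChartAt (𝓡 3) c) x v) := by
  have : IsManifold (𝓡 3) 1 M := IsManifold.of_le (n := ∞) (by simp)
  exact DFunLike.congr_fun
    ((L.hasMFDerivAt (x := extChartAt (𝓡 3) c x)).comp x
      ((mdifferentiableAt_extChartAt (by rwa [extChartAt_source] at hx)).hasMFDerivAt)).mfderiv v

theorem SmoothNear.clm_extChartAt {M : Type*} [TopologicalSpace M] [ChartedSpace R3 M]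
    [IsManifold (𝓡 3) ∞ M] (L : R3 →L[ℝ] ℂ) (p : M) :
    SmoothNear (fun y => L (extChartAt (𝓡 3) p y)) p := by
  refine SmoothNear.contDiff_comp L.contDiff ?_
  filter_upwards [(isOpen_extChartAt_source (I := 𝓡 3) p).mem_nhds (mem_extChartAt_source p)]
    with x hx
  exact contMDiffAt_extChartAt' (by rwa [extChartAt_source] at hx)

namespace CRStructure

variable {M : Type*} [TopologicalSpace M] [ChartedSpace R3 M] [IsManifold (𝓡 3) ∞ M]
  {S : CRStructure M} {θ : OneForm M} {X : ∀ x, S.H x} {p : M} {f : M → ℂ}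

section Independence

variable (h : S.IsContactForm θ) (hX : S.IsUnitaryFrame θ X p)
include h hX

theorem IsContactForm.eq_zero_of_combination {a b c : ℝ}
    (h0 : a • reeb θ p + b • S.vecX X p + c • S.vecY X p = 0) : a = 0 ∧ b = 0 ∧ c = 0 := by
  have h1 := congrArg (θ p) h0
  have h2 := congrArg (fun v => θ.extDeriv p v (S.vecX X p)) h0
  have h3 := congrArg (fun v => θ.extDeriv p v (S.vecY X p)) h0
  have e : ∀ w : TangentSpace (𝓡 3) p, θ.extDeriv p 0 w = 0 := fun w => by
    have := θ.extDeriv_smul_left p 0 0 w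
    rwa [zero_smul, zero_mul] at this
  simp only [map_add, map_smul, h.apply_vecX, h.apply_vecY, h.apply_reeb hX, map_zero,
    smul_eq_mul] at h1
  simp only [θ.extDeriv_add_left, θ.extDeriv_smul_left, h.extDeriv_reeb hX, θ.extDeriv_self,
    hX.extDeriv_eq, e] at h2 h3
  rw [θ.extDeriv_swap, hX.extDeriv_eq] at h2
  exact ⟨by linarith, by linarith, by linarith⟩

/-- The three chart coordinates are enough test functions, since their differentials separate
tangent vectors. Rewriting in T, X, JX and splitting into real and imaginary parts reduces to the
real frame. -/
theorem IsContactForm.eq_zero_of_forall_diff {c : M} (hc : p ∈ (extChartAt (𝓡 3) c).source)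
    {a b d : ℂ} (h0 : ∀ j : Fin 3,
      a * dT θ (fun y => Complex.ofRealCLM.comp (EuclideanSpace.proj j) (extChartAt (𝓡 3) c y)) p
      + b * S.dZ X
        (fun y => Complex.ofRealCLM.comp (EuclideanSpace.proj j) (extChartAt (𝓡 3) c y)) p
      + d * S.dZbar X
        (fun y => Complex.ofRealCLM.comp (EuclideanSpace.proj j) (extChartAt (𝓡 3) c y)) p = 0) :
    a = 0 ∧ b = 0 ∧ d = 0 := by
  let D : TangentSpace (𝓡 3) p →L[ℝ] R3 := mfderiv (𝓡 3) 𝓘(ℝ, R3) (extChartAt (𝓡 3) c) p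
  have hinj : ∀ v, D v = 0 → v = 0 := fun v hv => by
    rw [← mfderiv_extChartAt_symm_apply hc v]
    exact (congrArg _ hv).trans (map_zero _)
  have key : ∀ j : Fin 3, a * (D (reeb θ p) j : ℂ)
      + ((b + d) / (√2 : ℝ)) * (D (S.vecX X p) j : ℂ)
      + (Complex.I * (d - b) / (√2 : ℝ)) * (D (S.vecY X p) j : ℂ) = 0 := by
    intro j
    have := h0 j
    simp only [dT, dZ, dZbar, vectorDeriv, diffAt_clm_extChartAt _ hc] at this
    rw [← this]
    change _ = a * (D (reeb θ p) j : ℂ) + b * (((D (S.vecX X p) j : ℂ)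
      - Complex.I * (D (S.vecY X p) j : ℂ)) / (√2 : ℝ)) +
      d * (((D (S.vecX X p) j : ℂ)
      + Complex.I * (D (S.vecY X p) j : ℂ)) / (√2 : ℝ))
    ring
  generalize hB : (b + d) / ((√2 : ℝ) : ℂ) = B at key
  generalize hE : Complex.I * (d - b) / ((√2 : ℝ) : ℂ) = E at key
  have hre : a.re = 0 ∧ B.re = 0 ∧ E.re = 0 := by
    apply h.eq_zero_of_combination hX
    apply hinj
    rw [map_add, map_add, map_smul, map_smul, map_smul]
    refine PiLp.ext fun j => ?_
    have := congrArg Complex.re (key j)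
    simpa using this
  have him : a.im = 0 ∧ B.im = 0 ∧ E.im = 0 := by
    apply h.eq_zero_of_combination hX
    apply hinj
    rw [map_add, map_add, map_smul, map_smul, map_smul]
    refine PiLp.ext fun j => ?_
    have := congrArg Complex.im (key j)
    simpa using this
  have hB0 : b + d = 0 := by
    have : (b + d) / ((√2 : ℝ) : ℂ) = 0 := hB.trans (Complex.ext hre.2.1 him.2.1)
    simpa using this
  have hE0 : d - b = 0 := by
    have : Complex.I * (d - b) / ((√2 : ℝ) : ℂ) = 0 := hE.trans (Complex.ext hre.2.2 him.2.2)
    simpa using this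
  exact ⟨Complex.ext hre.1 him.1, by linear_combination (hB0 - hE0) / 2,
    by linear_combination (hB0 + hE0) / 2⟩

end Independence

section Germs

/-- `Z` on germs. -/
noncomputable def IsUnitaryFrame.germZ (hX : S.IsUnitaryFrame θ X p) :
    Derivation ℤ (smoothGerm p) (smoothGerm p) :=
  smoothGerm.derivation (S.dZ X) (fun _ => hX.smooth_dZ) (fun _ _ => dZ_congr)
    (fun _ _ _ => dZ_add) (fun _ _ _ => dZ_mul)

/-- `Z̄` on germs. -/
noncomputable def IsUnitaryFrame.germZbar (hX : S.IsUnitaryFrame θ X p) :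
    Derivation ℤ (smoothGerm p) (smoothGerm p) :=
  smoothGerm.derivation (S.dZbar X) (fun _ => hX.smooth_dZbar) (fun _ _ => dZbar_congr)
    (fun _ _ _ => dZbar_add) (fun _ _ _ => dZbar_mul)

variable (h : S.IsContactForm θ) (hX : S.IsUnitaryFrame θ X p)

/-- `T` on germs. -/
noncomputable def IsContactForm.germT :
    Derivation ℤ (smoothGerm p) (smoothGerm p) :=
  smoothGerm.derivation (dT θ) (fun _ => h.smooth_dT hX) (fun _ _ => dT_congr)
    (fun _ _ _ => dT_add) (fun _ _ _ => dT_mul)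

theorem IsUnitaryFrame.germZ_mk (hf : SmoothNear f p) :
    hX.germZ (smoothGerm.mk f hf) = smoothGerm.mk (S.dZ X f) (hX.smooth_dZ hf) :=
  smoothGerm.derivation_mk _ _ _ _ hf

theorem IsUnitaryFrame.germZbar_mk (hf : SmoothNear f p) :
    hX.germZbar (smoothGerm.mk f hf) = smoothGerm.mk (S.dZbar X f) (hX.smooth_dZbar hf) :=
  smoothGerm.derivation_mk _ _ _ _ hf

theorem IsContactForm.germT_mk (hf : SmoothNear f p) :
    h.germT hX (smoothGerm.mk f hf) = smoothGerm.mk (dT θ f) (h.smooth_dT hX hf) :=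
  smoothGerm.derivation_mk _ _ _ _ hf

/-- The coordinates of the one chart at p serve as test functions at all nearby q, so the
coefficients vanish on a neighbourhood and therefore as germs. -/
theorem IsContactForm.germ_indep (a b c : smoothGerm p)
    (h0 : ∀ f, a * h.germT hX f + b * hX.germZ f + c * hX.germZbar f = 0) :
    a = 0 ∧ b = 0 ∧ c = 0 := by
  induction a using smoothGerm.ind with | h a ha
  induction b using smoothGerm.ind with | h b hb
  induction c using smoothGerm.ind with | h c hc
  have h1 : ∀ᶠ q in 𝓝 p, a q = 0 ∧ b q = 0 ∧ c q = 0 := by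
    have h2 : ∀ j : Fin 3, ∀ᶠ q in 𝓝 p, a q * dT θ (fun y =>
        Complex.ofRealCLM.comp (EuclideanSpace.proj j) (extChartAt (𝓡 3) p y)) q
      + b q * S.dZ X (fun y =>
        Complex.ofRealCLM.comp (EuclideanSpace.proj j) (extChartAt (𝓡 3) p y)) q
      + c q * S.dZbar X (fun y =>
        Complex.ofRealCLM.comp (EuclideanSpace.proj j) (extChartAt (𝓡 3) p y)) q = 0 := by
      intro j
      have h3 := h0 (smoothGerm.mk _
        (SmoothNear.clm_extChartAt (Complex.ofRealCLM.comp (EuclideanSpace.proj j)) p))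
      rw [h.germT_mk, hX.germZ_mk, hX.germZbar_mk, smoothGerm.mk_mul, smoothGerm.mk_mul,
        smoothGerm.mk_mul, smoothGerm.mk_add, smoothGerm.mk_add] at h3
      exact (smoothGerm.mk_eq_mk (hg := SmoothNear.const 0)).1 h3
    filter_upwards [Filter.eventually_all.2 h2, hX.eventually,
      (isOpen_extChartAt_source (I := 𝓡 3) p).mem_nhds (mem_extChartAt_source p)] with q h4 h5 h6
    exact h.eq_zero_of_forall_diff h5 h6 h4
  exact ⟨(smoothGerm.mk_eq_mk (hg := SmoothNear.const 0)).2 (h1.mono fun _ h => h.1),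
    (smoothGerm.mk_eq_mk (hg := SmoothNear.const 0)).2 (h1.mono fun _ h => h.2.1),
    (smoothGerm.mk_eq_mk (hg := SmoothNear.const 0)).2 (h1.mono fun _ h => h.2.2)⟩

theorem germ_I_mul_I : smoothGerm.mk (p := p) (fun _ => Complex.I) (SmoothNear.const _)
    * smoothGerm.mk (fun _ => Complex.I) (SmoothNear.const _) = -1 :=
  (smoothGerm.mk_eq_mk (hf := (SmoothNear.const _).mul (SmoothNear.const _))
    (hg := (SmoothNear.const 1).neg)).2 (Filter.Eventually.of_forall fun _ => Complex.I_mul_I)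

theorem IsUnitaryFrame.germZ_const (a : ℂ) :
    hX.germZ (smoothGerm.mk (fun _ => a) (SmoothNear.const a)) = 0 := by
  rw [hX.germZ_mk]
  exact (smoothGerm.mk_eq_mk (hg := SmoothNear.const 0)).2
    (Filter.Eventually.of_forall fun _ => dZ_const a)

theorem IsUnitaryFrame.germZbar_const (a : ℂ) :
    hX.germZbar (smoothGerm.mk (fun _ => a) (SmoothNear.const a)) = 0 := by
  rw [hX.germZbar_mk]
  exact (smoothGerm.mk_eq_mk (hg := SmoothNear.const 0)).2
    (Filter.Eventually.of_forall fun _ => dZbar_const a)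

theorem IsContactForm.germT_const (a : ℂ) :
    h.germT hX (smoothGerm.mk (fun _ => a) (SmoothNear.const a)) = 0 := by
  rw [h.germT_mk]
  exact (smoothGerm.mk_eq_mk (hg := SmoothNear.const 0)).2
    (Filter.Eventually.of_forall fun _ => dT_const a)

theorem IsContactForm.germ_comm_Zbar_Z (f : smoothGerm p) :
    hX.germZbar (hX.germZ f) = hX.germZ (hX.germZbar f)
      + smoothGerm.mk (fun _ => Complex.I) (SmoothNear.const _) * h.germT hX f
      + smoothGerm.mk _ (h.smooth_omegaZbar hX) * hX.germZ f
      - smoothGerm.mk _ (h.smooth_omegaZbar hX).conj * hX.germZbar f := by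
  induction f using smoothGerm.ind with | h f hf
  simp only [hX.germZ_mk, hX.germZbar_mk, h.germT_mk, smoothGerm.mk_mul, smoothGerm.mk_add,
    smoothGerm.mk_sub]
  rw [smoothGerm.mk_eq_mk]
  filter_upwards [hX.eventually, hf.eventually_nhds] with q h1 h2
  exact h.comm_dZbar_dZ h1 h2

theorem IsContactForm.germ_comm_T_Z (f : smoothGerm p) :
    h.germT hX (hX.germZ f) = hX.germZ (h.germT hX f)
      + smoothGerm.mk _ (h.smooth_omegaT hX) * hX.germZ f
      - smoothGerm.mk _ (h.smooth_torsion hX) * hX.germZbar f := by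
  induction f using smoothGerm.ind with | h f hf
  simp only [hX.germZ_mk, hX.germZbar_mk, h.germT_mk, smoothGerm.mk_mul, smoothGerm.mk_add,
    smoothGerm.mk_sub]
  rw [smoothGerm.mk_eq_mk]
  filter_upwards [hX.eventually, hf.eventually_nhds] with q h1 h2
  exact h.comm_dT_dZ h1 h2

theorem IsContactForm.germ_comm_T_Zbar (f : smoothGerm p) :
    h.germT hX (hX.germZbar f) = hX.germZbar (h.germT hX f)
      + smoothGerm.mk _ (h.smooth_omegaT hX).conj * hX.germZbar f
      - smoothGerm.mk _ (h.smooth_torsion hX).conj * hX.germZ f := by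
  induction f using smoothGerm.ind with | h f hf
  simp only [hX.germZ_mk, hX.germZbar_mk, h.germT_mk, smoothGerm.mk_mul, smoothGerm.mk_add,
    smoothGerm.mk_sub]
  rw [smoothGerm.mk_eq_mk]
  filter_upwards [hX.eventually, hf.eventually_nhds] with q h1 h2
  exact h.comm_dT_dZbar h1 h2

/-- The defining formula of ω(T) does not show that it is imaginary; the Jacobi identity does. -/
theorem IsContactForm.germ_omegaT : smoothGerm.mk _ (h.smooth_omegaT hX)
    + smoothGerm.mk _ (h.smooth_omegaT hX).conj = 0 :=
  Derivation.add_eq_zero_of_commutators germ_I_mul_I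
    (T := h.germT hX) (h.germT_const hX _)
    (h.germ_comm_Zbar_Z hX) (h.germ_comm_T_Z hX) (h.germ_comm_T_Zbar hX)
    (h.germ_indep hX)

include h hX in
theorem IsContactForm.conj_omegaT : conj (S.omegaT θ X p) = -S.omegaT θ X p := by
  have h1 := congrArg (smoothGerm.eval p) (h.germ_omegaT hX)
  rw [map_add, map_zero, smoothGerm.eval_mk, smoothGerm.eval_mk] at h1
  linear_combination h1

/-- The Tanaka-Webster structure functions of a unitary frame, as germs at `p`. -/
noncomputable def IsContactForm.webster :
    WebsterAlgebra (smoothGerm.mk (p := p) (fun _ => Complex.I) (SmoothNear.const _)) where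
  Z := hX.germZ
  Zb := hX.germZbar
  T := h.germT hX
  w := smoothGerm.mk _ (h.smooth_omegaZbar hX)
  wb := smoothGerm.mk _ (h.smooth_omegaZbar hX).conj
  t := smoothGerm.mk _ (h.smooth_omegaT hX)
  A := smoothGerm.mk _ (h.smooth_torsion hX)
  Ab := smoothGerm.mk _ (h.smooth_torsion hX).conj
  i_sq := germ_I_mul_I
  Z_i := hX.germZ_const _
  Zb_i := hX.germZbar_const _
  T_i := h.germT_const hX _
  comm_Zb_Z := h.germ_comm_Zbar_Z hX
  comm_T_Z := h.germ_comm_T_Z hX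
  comm_T_Zb f := by
    rw [h.germ_comm_T_Zbar hX, eq_neg_of_add_eq_zero_right (h.germ_omegaT hX)]
    ring
  indep := h.germ_indep hX

theorem IsContactForm.webster_conjugation :
    (h.webster hX).Conjugation (smoothGerm.conjHom p) where
  map_i := (smoothGerm.conjHom_mk _).trans <| (smoothGerm.mk_eq_mk (hf := (SmoothNear.const _).conj)
    (hg := (SmoothNear.const _).neg)).2 (Filter.Eventually.of_forall fun _ => Complex.conj_I)
  map_Z f := by
    induction f using smoothGerm.ind with | h f hf
    rw [show (h.webster hX).Z = hX.germZ from rfl, show (h.webster hX).Zb = hX.germZbar from rfl,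
      hX.germZ_mk, smoothGerm.conjHom_mk, smoothGerm.conjHom_mk, hX.germZbar_mk,
      smoothGerm.mk_eq_mk]
    exact hf.eventually_nhds.mono fun q hq => (dZbar_conj hq).symm
  map_Zb f := by
    induction f using smoothGerm.ind with | h f hf
    rw [show (h.webster hX).Z = hX.germZ from rfl, show (h.webster hX).Zb = hX.germZbar from rfl,
      hX.germZbar_mk, smoothGerm.conjHom_mk, smoothGerm.conjHom_mk, hX.germZ_mk,
      smoothGerm.mk_eq_mk]
    exact hf.eventually_nhds.mono fun q hq => (dZ_conj hq).symm
  map_T f := by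
    induction f using smoothGerm.ind with | h f hf
    rw [show (h.webster hX).T = h.germT hX from rfl,
      h.germT_mk, smoothGerm.conjHom_mk, smoothGerm.conjHom_mk, h.germT_mk,
      smoothGerm.mk_eq_mk]
    exact hf.eventually_nhds.mono fun q hq => (dT_conj hq).symm
  map_w := smoothGerm.conjHom_mk (h.smooth_omegaZbar hX)
  map_wb := (smoothGerm.conjHom_mk (h.smooth_omegaZbar hX).conj).trans <| (smoothGerm.mk_eq_mk
    (hf := (h.smooth_omegaZbar hX).conj.conj) (hg := h.smooth_omegaZbar hX)).2
      (Filter.Eventually.of_forall fun _ => Complex.conj_conj _)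
  map_t := (smoothGerm.conjHom_mk (h.smooth_omegaT hX)).trans
    (eq_neg_of_add_eq_zero_right (h.germ_omegaT hX))
  map_A := smoothGerm.conjHom_mk (h.smooth_torsion hX)

end Germs

end CRStructure

end

/-! ### Dictionary between the Webster algebra and the geometric quantities. -/

section

theorem Filter.EventuallyEq.vectorDeriv_eq {M : Type*} [TopologicalSpace M] [ChartedSpace R3 M]
    {V : ∀ x : M, TangentSpace (𝓡 3) x} {f g : M → ℂ} {p : M} (h : f =ᶠ[𝓝 p] g) :
    vectorDeriv V f p = vectorDeriv V g p := h.diffAt_eq _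

namespace CRStructure

variable {M : Type*} [TopologicalSpace M] [ChartedSpace R3 M] [IsManifold (𝓡 3) ∞ M]
  {S : CRStructure M} {θ : OneForm M} {X : ∀ x, S.H x} {p : M} {f : M → ℂ}

variable (h : S.IsContactForm θ) (hX : S.IsUnitaryFrame θ X p)

include hX in
theorem IsUnitaryFrame.coframe_vecX : S.coframe θ X p (S.vecX X p) = 1 / (√2 : ℝ) := by
  rw [coframe, θ.extDeriv_self, hX.extDeriv_eq]
  push_cast
  linear_combination (-1 / ((√2 : ℝ) : ℂ)) * Complex.I_mul_I

include hX in
theorem IsUnitaryFrame.coframe_vecY :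
    S.coframe θ X p (S.vecY X p) = Complex.I / (√2 : ℝ) := by
  rw [coframe, θ.extDeriv_self, θ.extDeriv_swap, hX.extDeriv_eq]
  push_cast
  ring

include h hX in
-- The shape (f + a g) / b, with the explicit factor -1, is the one that `vectorDeriv_linear`
-- differentiates.
theorem IsContactForm.omega_vecX : S.omega θ X p (S.vecX X p)
    = (S.omegaZbar θ X p + (-1) * conj (S.omegaZbar θ X p)) / (√2 : ℝ) := by
  rw [omega, h.apply_vecX, hX.coframe_vecX, omegaZ]
  simp only [map_div₀, map_one, Complex.conj_ofReal]
  push_cast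
  ring

include h hX in
theorem IsContactForm.omega_vecY : S.omega θ X p (S.vecY X p)
    = (S.omegaZbar θ X p + 1 * conj (S.omegaZbar θ X p)) / (Complex.I * (√2 : ℝ)) := by
  rw [omega, h.apply_vecY, hX.coframe_vecY, omegaZ]
  simp only [map_div₀, Complex.conj_I, Complex.conj_ofReal]
  push_cast
  field_simp
  linear_combination (-conj (S.omegaZbar θ X p) - S.omegaZbar θ X p) * Complex.I_sq

include h hX in
theorem IsContactForm.omega_bracket :
    S.omega θ X p (VectorField.mlieBracket (𝓡 3) (S.vecX X) (S.vecY X) p)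
      = -S.omegaT θ X p
        - 2 * Complex.I * (S.omegaZbar θ X p * conj (S.omegaZbar θ X p)) := by
  have h1 : S.coframe θ X p (VectorField.mlieBracket (𝓡 3) (S.vecX X) (S.vecY X) p)
      = Complex.I * S.omegaZbar θ X p := by
    rw [omegaZbar]
    linear_combination (S.coframe θ X p
      (VectorField.mlieBracket (𝓡 3) (S.vecX X) (S.vecY X) p)) * Complex.I_mul_I
  rw [omega, h.apply_bracket_vecX_vecY hX, h1, omegaZ, map_mul, Complex.conj_I]
  push_cast
  ring

include h hX in
-- The right side is invariant under conjugation because ω(T) is imaginary, so taking the real part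
-- in the definition of the curvature loses nothing.
theorem IsContactForm.ofReal_scalarCurv : (S.scalarCurv θ X p : ℂ)
    = S.dZ X (S.omegaZbar θ X) p + S.dZbar X (fun x => conj (S.omegaZbar θ X x)) p
      + Complex.I * S.omegaT θ X p
      - 2 * S.omegaZbar θ X p * conj (S.omegaZbar θ X p) := by
  have hw := h.smooth_omegaZbar hX
  set r := S.dZ X (S.omegaZbar θ X) p + S.dZbar X (fun x => conj (S.omegaZbar θ X x)) p
    + Complex.I * S.omegaT θ X p - 2 * S.omegaZbar θ X p * conj (S.omegaZbar θ X p) with hr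
  have hreal : conj r = r := by
    simp only [hr, map_add, map_sub, map_mul, Complex.conj_I, h.conj_omegaT hX, dZbar_conj hw,
      Complex.conj_conj, map_ofNat]
    rw [← dZbar_conj hw]
    ring
  rw [← Complex.conj_eq_iff_re.1 hreal, scalarCurv, Filter.EventuallyEq.vectorDeriv_eq
    (hX.eventually.mono fun q hq => h.omega_vecY hq), Filter.EventuallyEq.vectorDeriv_eq
    (hX.eventually.mono fun q hq => h.omega_vecX hq), vectorDeriv_linear _ hw hw.conj,
    vectorDeriv_linear _ hw hw.conj, h.omega_bracket hX, vectorDeriv_vecX, vectorDeriv_vecX,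
    vectorDeriv_vecY, vectorDeriv_vecY]
  congr 2
  rw [hr]
  field_simp
  linear_combination (-S.dZ X (S.omegaZbar θ X) p + S.dZbar X (S.omegaZbar θ X) p
    + S.dZ X (fun x => conj (S.omegaZbar θ X x)) p
    - S.dZbar X (fun x => conj (S.omegaZbar θ X x)) p
    + 2 * ((√2 : ℝ) : ℂ) ^ 2 * S.omegaZbar θ X p * conj (S.omegaZbar θ X p)) * Complex.I_mul_I
    - (S.dZ X (S.omegaZbar θ X) p + S.dZbar X (fun x => conj (S.omegaZbar θ X x)) p)
      * sqrt_two_mul_self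

include h hX in
theorem IsContactForm.smooth_ofReal_scalarCurv :
    SmoothNear (fun x => (S.scalarCurv θ X x : ℂ)) p := by
  have hw := h.smooth_omegaZbar hX
  refine SmoothNear.congr ?_ (hX.eventually.mono fun q hq => h.ofReal_scalarCurv hq)
  exact (((hX.smooth_dZ hw).add (hX.smooth_dZbar hw.conj)).add
    ((SmoothNear.const _).mul (h.smooth_omegaT hX))).sub
    (((SmoothNear.const 2).mul hw).mul hw.conj)

include h hX in
theorem IsContactForm.smooth_div (hf : SmoothNear f p) : SmoothNear (S.div θ X f) p :=
  (hX.smooth_dZbar hf).sub ((h.smooth_omegaZbar hX).mul hf)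

include h hX in
theorem IsContactForm.smooth_subLap (hf : SmoothNear f p) : SmoothNear (S.subLap θ X f) p :=
  ((h.smooth_div hX (hX.smooth_dZ hf)).add ((hX.smooth_dZ (hX.smooth_dZbar hf)).sub
    ((h.smooth_omegaZbar hX).conj.mul (hX.smooth_dZbar hf)))).neg

include h hX in
theorem IsContactForm.smooth_divTorsion : SmoothNear (S.divTorsion θ X) p :=
  (hX.smooth_dZbar (h.smooth_torsion hX)).sub
    (((SmoothNear.const 2).mul (h.smooth_omegaZbar hX)).mul (h.smooth_torsion hX))

include h hX in
theorem IsContactForm.smooth_W : SmoothNear (S.W θ X) p :=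
  (hX.smooth_dZ (h.smooth_ofReal_scalarCurv hX)).sub
    ((SmoothNear.const _).mul (h.smooth_divTorsion hX))

include h hX in
theorem IsContactForm.smooth_divTorsionGrad (hf : SmoothNear f p) :
    SmoothNear (S.divTorsionGrad θ X f) p :=
  h.smooth_div hX ((h.smooth_torsion hX).mul (hX.smooth_dZbar hf))

theorem IsContactForm.webster_Z_mk (hf : SmoothNear f p) :
    (h.webster hX).Z (smoothGerm.mk f hf) = smoothGerm.mk (S.dZ X f) (hX.smooth_dZ hf) :=
  hX.germZ_mk hf

theorem IsContactForm.webster_Zb_mk (hf : SmoothNear f p) :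
    (h.webster hX).Zb (smoothGerm.mk f hf)
      = smoothGerm.mk (S.dZbar X f) (hX.smooth_dZbar hf) :=
  hX.germZbar_mk hf

theorem IsContactForm.webster_T_mk (hf : SmoothNear f p) :
    (h.webster hX).T (smoothGerm.mk f hf) = smoothGerm.mk (dT θ f) (h.smooth_dT hX hf) :=
  h.germT_mk hX hf

theorem IsContactForm.webster_R : (h.webster hX).R
    = smoothGerm.mk (fun x => (S.scalarCurv θ X x : ℂ)) (h.smooth_ofReal_scalarCurv hX) := by
  have hw := h.smooth_omegaZbar hX
  have e : (h.webster hX).R = hX.germZ (smoothGerm.mk _ hw) + hX.germZbar (smoothGerm.mk _ hw.conj)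
    + smoothGerm.mk _ (SmoothNear.const Complex.I) * smoothGerm.mk _ (h.smooth_omegaT hX)
    - smoothGerm.mk _ (SmoothNear.const 2) * smoothGerm.mk _ hw * smoothGerm.mk _ hw.conj := rfl
  rw [e, hX.germZ_mk, hX.germZbar_mk, smoothGerm.mk_mul, smoothGerm.mk_mul, smoothGerm.mk_mul,
    smoothGerm.mk_add, smoothGerm.mk_add, smoothGerm.mk_sub, smoothGerm.mk_eq_mk]
  exact hX.eventually.mono fun q hq => (h.ofReal_scalarCurv hq).symm

theorem IsContactForm.webster_div (hf : SmoothNear f p) :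
    (h.webster hX).div (smoothGerm.mk f hf)
      = smoothGerm.mk (S.div θ X f) (h.smooth_div hX hf) := by
  rw [WebsterAlgebra.div, h.webster_Zb_mk]
  rfl

theorem IsContactForm.webster_lap (hf : SmoothNear f p) :
    (h.webster hX).lap (smoothGerm.mk f hf)
      = smoothGerm.mk (S.subLap θ X f) (h.smooth_subLap hX hf) := by
  rw [WebsterAlgebra.lap, h.webster_Z_mk, h.webster_div, WebsterAlgebra.divb, h.webster_Zb_mk,
    h.webster_Z_mk]
  rfl

theorem IsContactForm.webster_divA :
    (h.webster hX).divA = smoothGerm.mk (S.divTorsion θ X) (h.smooth_divTorsion hX) := by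
  rw [WebsterAlgebra.divA, show (h.webster hX).A = smoothGerm.mk _ (h.smooth_torsion hX) from rfl,
    h.webster_Zb_mk]
  rfl

theorem IsContactForm.webster_W :
    (h.webster hX).W = smoothGerm.mk (S.W θ X) (h.smooth_W hX) := by
  rw [WebsterAlgebra.W, h.webster_R, h.webster_divA, h.webster_Z_mk]
  rfl

theorem IsContactForm.webster_divAgrad (hf : SmoothNear f p) :
    (h.webster hX).divAgrad (smoothGerm.mk f hf)
      = smoothGerm.mk (S.divTorsionGrad θ X f) (h.smooth_divTorsionGrad hX hf) := by
  rw [WebsterAlgebra.divAgrad, show (h.webster hX).A = smoothGerm.mk _ (h.smooth_torsion hX)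
    from rfl, h.webster_Zb_mk, smoothGerm.mk_mul, h.webster_div]
  rfl

theorem smoothGerm.conj_mk_ofReal {f : M → ℝ} (hf : SmoothNear (fun x => (f x : ℂ)) p) :
    smoothGerm.conjHom p (smoothGerm.mk _ hf) = smoothGerm.mk _ hf :=
  (smoothGerm.conjHom_mk hf).trans <| (smoothGerm.mk_eq_mk (hf := hf.conj)).2
    (Filter.Eventually.of_forall fun _ => Complex.conj_ofReal _)

theorem smoothGerm.eval_eq_re {a : smoothGerm p} (ha : smoothGerm.conjHom p a = a) :
    smoothGerm.eval p a = ((smoothGerm.eval p a).re : ℂ) := by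
  refine (Complex.conj_eq_iff_re.1 ?_).symm
  rw [← smoothGerm.eval_conjHom, ha]

theorem smoothGerm.eval_I :
    smoothGerm.eval p (smoothGerm.mk (fun _ => Complex.I) (SmoothNear.const _)) = Complex.I := rfl

theorem IsContactForm.eval_webster_Q :
    smoothGerm.eval p (h.webster hX).Q = (S.qPrimeIn θ X p : ℂ) := by
  have hc := h.webster_conjugation hX
  have h1 := smoothGerm.eval_eq_re ((hc.map_lap _).trans (congrArg _ hc.map_R))
  rw [WebsterAlgebra.Q]
  simp only [map_add, map_sub, map_mul, map_pow, map_ofNat]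
  rw [h1, h.webster_R, h.webster_lap, smoothGerm.eval_mk, smoothGerm.eval_mk, qPrimeIn]
  have h2 : smoothGerm.eval p (h.webster hX).A = S.torsion θ X p := rfl
  have h3 : smoothGerm.eval p (h.webster hX).Ab = conj (S.torsion θ X p) := rfl
  rw [h2, h3]
  push_cast
  linear_combination (-4) * Complex.mul_conj' (S.torsion θ X p)

variable {u : M → ℝ}

theorem IsContactForm.eval_webster_paneitz (hu : SmoothNear (fun x => (u x : ℂ)) p) :
    smoothGerm.eval p ((h.webster hX).paneitz (smoothGerm.mk _ hu))
      = (S.paneitzIn θ X (fun x => (u x : ℂ)) p : ℂ) := by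
  have hc := h.webster_conjugation hX
  have hr := smoothGerm.conj_mk_ofReal hu
  have h1 := smoothGerm.eval_eq_re (a := (h.webster hX).lap ((h.webster hX).lap _))
    (by rw [hc.map_lap, hc.map_lap, hr])
  have h2 := smoothGerm.eval_eq_re (a := (h.webster hX).T ((h.webster hX).T _))
    (by rw [hc.map_T, hc.map_T, hr])
  have h3 := hc.map_divAgrad (smoothGerm.mk _ hu)
  rw [hr] at h3
  rw [WebsterAlgebra.paneitz, ← h3]
  simp only [map_add, map_sub, map_mul, map_ofNat, smoothGerm.eval_conjHom, smoothGerm.eval_I]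
  rw [h1, h2, Complex.sub_conj, h.webster_lap, h.webster_lap, h.webster_T_mk, h.webster_T_mk,
    h.webster_divAgrad, smoothGerm.eval_mk, smoothGerm.eval_mk, smoothGerm.eval_mk, paneitzIn]
  push_cast
  linear_combination 4 * ((S.divTorsionGrad θ X (fun x => (u x : ℂ)) p).im : ℂ) * Complex.I_mul_I

/-- The algebraic P' omits the terms with W and the zeroth order term. Both vanish when W = 0, the
latter by `lap_R_of_W_eq_zero`. -/
theorem IsContactForm.eval_webster_pPrime (hW : (h.webster hX).W = 0)
    (hu : SmoothNear (fun x => (u x : ℂ)) p) :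
    smoothGerm.eval p ((h.webster hX).pPrime (smoothGerm.mk _ hu))
      = (S.pPrimeIn θ X (fun x => (u x : ℂ)) p : ℂ) := by
  have hc := h.webster_conjugation hX
  have hr := smoothGerm.conj_mk_ofReal hu
  have hWb : (h.webster hX).Wb = 0 := by rw [← hc.map_W, hW, map_zero]
  have h0 := congrArg (smoothGerm.eval p) (WebsterAlgebra.lap_R_of_W_eq_zero hW hWb)
  rw [← hc.map_divA, ← hc.map_div] at h0
  simp only [map_sub, map_mul, map_neg, smoothGerm.eval_conjHom, smoothGerm.eval_I] at h0
  rw [Complex.sub_conj, h.webster_R, h.webster_lap, h.webster_divA, h.webster_div,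
    smoothGerm.eval_mk, smoothGerm.eval_mk] at h0
  have h0' := congrArg Complex.re h0
  have hW0 : S.W θ X p = 0 := by
    have := congrArg (smoothGerm.eval p) hW
    rwa [h.webster_W, smoothGerm.eval_mk, map_zero] at this
  have h1 := smoothGerm.eval_eq_re (a := (h.webster hX).lap ((h.webster hX).lap _))
    (by rw [hc.map_lap, hc.map_lap, hr])
  have h3 := hc.map_divAgrad (smoothGerm.mk _ hu)
  have h4 := hc.map_div ((h.webster hX).R * (h.webster hX).Z (smoothGerm.mk _ hu))
  rw [map_mul, hc.map_R, hc.map_Z, hr] at h4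
  rw [hr] at h3
  rw [WebsterAlgebra.pPrime, ← h3, ← h4]
  simp only [map_add, map_sub, map_mul, map_ofNat, smoothGerm.eval_conjHom, smoothGerm.eval_I]
  rw [h1, Complex.sub_conj, Complex.add_conj, h.webster_lap, h.webster_lap,
    h.webster_divAgrad, h.webster_R, h.webster_Z_mk, smoothGerm.mk_mul, h.webster_div,
    smoothGerm.eval_mk, smoothGerm.eval_mk, smoothGerm.eval_mk, pPrimeIn, hW0]
  have h5 : (S.subLap θ X (fun y => (S.scalarCurv θ X y : ℂ)) p).re
      - 2 * (S.div θ X (S.divTorsion θ X) p).im = 0 := by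
    rw [h0']
    simp
  rw [h5]
  push_cast
  simp only [zero_mul, Complex.zero_re, mul_zero, add_zero, Complex.ofReal_zero]
  linear_combination 8 * ((S.divTorsionGrad θ X (fun x => (u x : ℂ)) p).im : ℂ) * Complex.I_mul_I

theorem IsContactForm.webster_W_eq_zero (hW : S.IsPseudoEinstein θ) : (h.webster hX).W = 0 := by
  rw [h.webster_W]
  exact (smoothGerm.mk_eq_mk (hg := SmoothNear.const 0)).2
    (hX.eventually.mono fun q hq => hW q X hq)

end CRStructure

end

/-! ### Existence of unitary frames and conformal change of the contact form. -/

section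

theorem WebsterAlgebra.conformalQ_zero {𝒜 : Type*} [CommRing 𝒜] {i : 𝒜} (P : WebsterAlgebra i) :
    P.conformalQ 0 = P.Q := by
  simp [conformalQ, Q, lap, div, divb]

variable {M : Type*} [TopologicalSpace M] [ChartedSpace R3 M]

theorem SmoothNear.comp_contDiffAt {F G : Type*} [NormedAddCommGroup F] [NormedSpace ℝ F]
    [NormedAddCommGroup G] [NormedSpace ℝ G] {L : F → G} {f : M → F} {p : M}
    (hf : SmoothNear f p) (hL : ∀ᶠ x in 𝓝 p, ContDiffAt ℝ ∞ L (f x)) :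
    SmoothNear (fun x => L (f x)) p := by
  filter_upwards [hf, hL] with x h1 h2 using h2.comp_contMDiffAt h1

theorem SmoothNear.exp {f : M → ℝ} {p : M} (hf : SmoothNear f p) :
    SmoothNear (fun x => Real.exp (f x)) p :=
  hf.contDiff_comp Real.contDiff_exp

variable [IsManifold (𝓡 3) ∞ M]

theorem SmoothFieldNear.smul {V : ∀ x : M, TangentSpace (𝓡 3) x} {f : M → ℝ} {p : M}
    (hf : SmoothNear f p) (hV : SmoothFieldNear V p) :
    SmoothFieldNear (fun x => f x • V x) p := by
  filter_upwards [hf, hV] with x h1 h2 using h1.smul_section h2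

theorem diffAt_exp_neg {σ : M → ℝ} {x : M} (hσ : MDifferentiableAt (𝓡 3) 𝓘(ℝ, ℝ) σ x)
    (v : TangentSpace (𝓡 3) x) :
    diffAt (fun y => (Real.exp (-σ y) : ℂ)) x v
      = -(Real.exp (-σ x) : ℂ) * diffAt (fun y => (σ y : ℂ)) x v := by
  have h1 : HasMFDerivAt 𝓘(ℝ, ℝ) 𝓘(ℝ, ℝ) (fun t => Real.exp (-t)) (σ x)
      ((-Real.exp (-σ x)) • ContinuousLinearMap.id ℝ ℝ) := by
    apply HasFDerivAt.hasMFDerivAt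
    have := ((Real.hasDerivAt_exp (-σ x)).comp (σ x) (hasDerivAt_neg (σ x))).hasFDerivAt
    refine this.congr_fderiv ?_
    ext
    simp
  have h2 := h1.comp x hσ.hasMFDerivAt
  rw [diffAt_ofReal hσ]
  refine (diffAt_ofReal (f := fun y => Real.exp (-σ y)) h2.mdifferentiableAt v).trans ?_
  let d : ℝ := mfderiv (𝓡 3) 𝓘(ℝ, ℝ) σ x v
  have h3 : mfderiv (𝓡 3) 𝓘(ℝ, ℝ) (fun y => Real.exp (-σ y)) x v = -Real.exp (-σ x) * d :=
    DFunLike.congr_fun h2.mfderiv v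
  exact (congrArg Complex.ofReal h3).trans (by push_cast; rfl)

namespace CRStructure

variable {S : CRStructure M} {θ : OneForm M} {X : ∀ x, S.H x} {p : M} {f : M → ℂ}

theorem IsUnitaryFrame.of_eventually (h1 : SmoothFieldNear (S.vecX X) p)
    (h2 : SmoothFieldNear (S.vecY X) p)
    (h3 : ∀ᶠ x in 𝓝 p, θ.extDeriv x (S.vecX X x) (S.vecY X x) = 1) : S.IsUnitaryFrame θ X p := by
  obtain ⟨U, hU, hUo, hp⟩ := mem_nhds_iff.1 (h1.and (h2.and h3))
  exact ⟨U, hUo, hp, fun x hx => (hU hx).1.contMDiffWithinAt,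
    fun x hx => (hU hx).2.1.contMDiffWithinAt, fun x hx => (hU hx).2.2⟩

/-- A local frame X, JX is divided by the square root of dθ(X, JX), which is positive and smooth. -/
theorem IsContactForm.exists_isUnitaryFrame (h : S.IsContactForm θ) (p : M) :
    ∃ X, S.IsUnitaryFrame θ X p := by
  obtain ⟨U, hU, hp, X, h1, h2, h3⟩ := S.smooth p
  have hX : SmoothFieldNear (S.vecX X) p := by
    filter_upwards [hU.mem_nhds hp] with q hq using h1.contMDiffAt (hU.mem_nhds hq)
  have hY : SmoothFieldNear (S.vecY X) p := by
    filter_upwards [hU.mem_nhds hp] with q hq using h2.contMDiffAt (hU.mem_nhds hq)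
  have hpos : ∀ᶠ x in 𝓝 p, 0 < θ.extDeriv x (S.vecX X x) (S.vecY X x) := by
    filter_upwards [hU.mem_nhds hp] with q hq using h.pos q (X q) (h3 q hq)
  have hφ : SmoothNear (fun x => (√(θ.extDeriv x (S.vecX X x) (S.vecY X x)))⁻¹) p := by
    refine SmoothNear.comp_contDiffAt (L := fun t => (√t)⁻¹) (h.smooth.smoothNear_extDeriv hX hY) ?_
    filter_upwards [hpos] with x hx
    exact (Real.contDiffAt_sqrt hx.ne').inv (Real.sqrt_pos.2 hx).ne'
  have eY : S.vecY (fun x => (√(θ.extDeriv x (S.vecX X x) (S.vecY X x)))⁻¹ • X x)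
      = fun x => (√(θ.extDeriv x (S.vecX X x) (S.vecY X x)))⁻¹ • S.vecY X x := by
    funext x
    rw [vecY, map_smul]
    rfl
  refine ⟨fun x => (√(θ.extDeriv x (S.vecX X x) (S.vecY X x)))⁻¹ • X x,
    .of_eventually (hX.smul hφ) (eY ▸ hY.smul hφ) ?_⟩
  filter_upwards [hpos] with x hx
  rw [eY]
  change θ.extDeriv x ((√(θ.extDeriv x (S.vecX X x) (S.vecY X x)))⁻¹ • S.vecX X x) _ = 1
  rw [θ.extDeriv_smul_left, θ.extDeriv_smul_right, ← mul_assoc, ← mul_inv,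
    Real.mul_self_sqrt hx.le, inv_mul_cancel₀ hx.ne']

theorem IsContactForm.isUnitaryFrame_frameAt (h : S.IsContactForm θ) (p : M) :
    S.IsUnitaryFrame θ (S.frameAt θ p) p :=
  Classical.epsilon_spec (h.exists_isUnitaryFrame p)

section Conformal

variable {σ : M → ℝ}

omit [IsManifold (𝓡 3) ∞ M] in
theorem expSmul_apply (v : TangentSpace (𝓡 3) p) :
    OneForm.expSmul σ θ p v = Real.exp (σ p) * θ p v := rfl

theorem OneForm.IsSmooth.expSmul (hθ : θ.IsSmooth) (hσ : ContMDiff (𝓡 3) 𝓘(ℝ, ℝ) ∞ σ) :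
    (OneForm.expSmul σ θ).IsSmooth := fun x =>
  (Real.contDiff_exp.contDiffAt.comp_contMDiffAt (hσ x)).smul_section (hθ x)

/-- The extra term e^σ dσ ∧ θ vanishes on H. By bilinearity the pair X, JX suffices, and there both
forms are given by θ([X, JX]). -/
theorem IsContactForm.extDeriv_expSmul (h : S.IsContactForm θ)
    (h' : (OneForm.expSmul σ θ).IsSmooth) {v w : TangentSpace (𝓡 3) p} (hv : v ∈ S.H p)
    (hw : w ∈ S.H p) :
    (OneForm.expSmul σ θ).extDeriv p v w = Real.exp (σ p) * θ.extDeriv p v w := by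
  obtain ⟨X, hX⟩ := h.exists_isUnitaryFrame p
  have h1 := h'.extDeriv_eq hX.smooth_vecX hX.smooth_vecY
  simp only [expSmul_apply, h.apply_vecX, h.apply_vecY, mul_zero, fieldDeriv_zero_fun,
    h.apply_bracket_vecX_vecY hX] at h1
  rw [eq_of_mem hX.extDeriv_eq hv, eq_of_mem hX.extDeriv_eq hw]
  generalize θ.extDeriv p v (S.vecX X p) = a
  generalize θ.extDeriv p v (S.vecY X p) = b
  generalize θ.extDeriv p w (S.vecX X p) = c
  generalize θ.extDeriv p w (S.vecY X p) = d
  simp only [sub_eq_add_neg, ← neg_smul, OneForm.extDeriv_add_left, OneForm.extDeriv_add_right,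
    OneForm.extDeriv_smul_left, OneForm.extDeriv_smul_right, OneForm.extDeriv_self, h1,
    (OneForm.expSmul σ θ).extDeriv_swap _ (S.vecY X p) (S.vecX X p),
    θ.extDeriv_swap _ (S.vecY X p) (S.vecX X p), hX.extDeriv_eq]
  ring

theorem IsContactForm.expSmul (h : S.IsContactForm θ) (hσ : ContMDiff (𝓡 3) 𝓘(ℝ, ℝ) ∞ σ) :
    S.IsContactForm (OneForm.expSmul σ θ) where
  smooth := OneForm.IsSmooth.expSmul h.smooth hσ
  ker_eq x v := by
    rw [expSmul_apply, ← h.ker_eq, mul_eq_zero, or_iff_right (Real.exp_pos _).ne']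
  pos x v hv := by
    rw [h.extDeriv_expSmul (OneForm.IsSmooth.expSmul h.smooth hσ) v.2 (S.J x v).2]
    exact mul_pos (Real.exp_pos _) (h.pos x v hv)

variable {X' : ∀ x, S.H x}

/-- The factor `g` of the change of unitary frames `Z' = g Z`. -/
noncomputable def frameFactor (S : CRStructure M) (θ : OneForm M) (X X' : ∀ x, S.H x) (x : M) : ℂ :=
  (θ.extDeriv x (S.vecX X' x) (S.vecY X x) : ℂ)
    - Complex.I * (θ.extDeriv x (S.vecX X' x) (S.vecX X x) : ℂ)

theorem vecX_eq (hX : S.IsUnitaryFrame θ X p) (X' : ∀ x, S.H x) :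
    S.vecX X' p = (S.frameFactor θ X X' p).re • S.vecX X p
      + (S.frameFactor θ X X' p).im • S.vecY X p := by
  refine (eq_of_mem hX.extDeriv_eq (X' p).2).trans ?_
  rw [sub_eq_add_neg, ← neg_smul]
  simp [frameFactor, vecX]

theorem vecY_eq (hX : S.IsUnitaryFrame θ X p) (X' : ∀ x, S.H x) :
    S.vecY X' p = (S.frameFactor θ X X' p).re • S.vecY X p
      - (S.frameFactor θ X X' p).im • S.vecX X p := by
  have h1 : X' p = (S.frameFactor θ X X' p).re • X p
      + (S.frameFactor θ X X' p).im • S.J p (X p) := Subtype.ext (vecX_eq hX X')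
  rw [vecY, h1, map_add, map_smul, map_smul, S.J_J, smul_neg, ← sub_eq_add_neg]
  rfl

/-- dθ(X', JX') = |g|², while e^σ dθ(X', JX') = 1. -/
theorem IsContactForm.frameFactor_mul_conj (h : S.IsContactForm θ)
    (h' : S.IsContactForm (OneForm.expSmul σ θ)) (hX : S.IsUnitaryFrame θ X p)
    (hX' : S.IsUnitaryFrame (OneForm.expSmul σ θ) X' p) :
    S.frameFactor θ X X' p * conj (S.frameFactor θ X X' p) = (Real.exp (-σ p) : ℂ) := by
  have h1 := hX'.extDeriv_eq
  rw [h.extDeriv_expSmul (v := S.vecX X' p) (w := S.vecY X' p) h'.smooth (X' p).2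
    (S.J p (X' p)).2, vecX_eq hX X', vecY_eq hX X',
    sub_eq_add_neg, ← neg_smul] at h1
  simp only [OneForm.extDeriv_add_left, OneForm.extDeriv_add_right,
    OneForm.extDeriv_smul_left, OneForm.extDeriv_smul_right, OneForm.extDeriv_self,
    θ.extDeriv_swap _ (S.vecY X p) (S.vecX X p), hX.extDeriv_eq] at h1
  rw [Complex.mul_conj, Complex.normSq_apply, Real.exp_neg]
  congr 1
  refine eq_inv_of_mul_eq_one_right ?_
  linarith

theorem dZ_eq (hX : S.IsUnitaryFrame θ X p) (X' : ∀ x, S.H x) (f : M → ℂ) :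
    S.dZ X' f p = S.frameFactor θ X X' p * S.dZ X f p := by
  rw [dZ, vectorDeriv, vectorDeriv, vecX_eq hX X', vecY_eq hX X', diffAt_add_right,
    diffAt_sub_right, diffAt_smul_right, diffAt_smul_right, diffAt_smul_right, diffAt_smul_right]
  conv_rhs => rw [← Complex.re_add_im (S.frameFactor θ X X' p)]
  rw [dZ, vectorDeriv, vectorDeriv]
  linear_combination ((S.frameFactor θ X X' p).im * diffAt f p (S.vecY X p) / (√2 : ℝ))
    * Complex.I_mul_I

theorem dZbar_eq (hX : S.IsUnitaryFrame θ X p) (X' : ∀ x, S.H x) (f : M → ℂ) :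
    S.dZbar X' f p = conj (S.frameFactor θ X X' p) * S.dZbar X f p := by
  rw [dZbar, vectorDeriv, vectorDeriv, vecX_eq hX X', vecY_eq hX X', diffAt_add_right,
    diffAt_sub_right, diffAt_smul_right, diffAt_smul_right, diffAt_smul_right, diffAt_smul_right]
  have e : conj (S.frameFactor θ X X' p) = (S.frameFactor θ X X' p).re
      - Complex.I * (S.frameFactor θ X X' p).im := by
    apply Complex.ext <;> simp
  rw [e, dZbar, vectorDeriv, vectorDeriv]
  linear_combination ((S.frameFactor θ X X' p).im * diffAt f p (S.vecY X p) / (√2 : ℝ))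
    * Complex.I_mul_I

theorem IsContactForm.smooth_frameFactor (h : S.IsContactForm θ) {θ' : OneForm M}
    (hX : S.IsUnitaryFrame θ X p) (hX' : S.IsUnitaryFrame θ' X' p) :
    SmoothNear (S.frameFactor θ X X') p :=
  SmoothNear.sub (h.smooth.smoothNear_extDeriv hX'.smooth_vecX hX.smooth_vecY).ofReal
    ((SmoothNear.const _).mul
      (h.smooth.smoothNear_extDeriv hX'.smooth_vecX hX.smooth_vecX).ofReal)

theorem IsContactForm.germ_frameFactor_mul (h : S.IsContactForm θ)
    (h' : S.IsContactForm (OneForm.expSmul σ θ)) (hX : S.IsUnitaryFrame θ X p)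
    (hX' : S.IsUnitaryFrame (OneForm.expSmul σ θ) X' p) (hσ : SmoothNear σ p) :
    smoothGerm.mk _ (h.smooth_frameFactor hX hX')
      * smoothGerm.mk _ (h.smooth_frameFactor hX hX').conj
      = smoothGerm.mk _ hσ.neg.exp.ofReal := by
  rw [smoothGerm.mk_mul, smoothGerm.mk_eq_mk]
  filter_upwards [hX.eventually, hX'.eventually] with q h1 h2
  exact h.frameFactor_mul_conj h' h1 h2

/-- The change of unitary frames associated with a conformal change of the contact form. -/
noncomputable def IsContactForm.frameChange (h : S.IsContactForm θ)
    (h' : S.IsContactForm (OneForm.expSmul σ θ)) (hX : S.IsUnitaryFrame θ X p)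
    (hX' : S.IsUnitaryFrame (OneForm.expSmul σ θ) X' p) (hσ : SmoothNear σ p) :
    (h.webster hX).FrameChange (h'.webster hX') (smoothGerm.mk _ hσ.ofReal) where
  g := smoothGerm.mk _ (h.smooth_frameFactor hX hX')
  gb := smoothGerm.mk _ (h.smooth_frameFactor hX hX').conj
  -- From g ḡ = e^{-σ}, the inverse of g is ḡ e^σ.
  gi := smoothGerm.mk _ ((h.smooth_frameFactor hX hX').conj.mul hσ.exp.ofReal)
  gbi := smoothGerm.mk _ ((h.smooth_frameFactor hX hX').mul hσ.exp.ofReal)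
  g_gi := by
    rw [smoothGerm.mk_mul]
    refine (smoothGerm.mk_eq_mk (hg := SmoothNear.const 1)).2 ?_
    filter_upwards [hX.eventually, hX'.eventually] with q h1 h2
    rw [← mul_assoc, h.frameFactor_mul_conj h' h1 h2, ← Complex.ofReal_mul, ← Real.exp_add]
    simp
  gb_gbi := by
    rw [smoothGerm.mk_mul]
    refine (smoothGerm.mk_eq_mk (hg := SmoothNear.const 1)).2 ?_
    filter_upwards [hX.eventually, hX'.eventually] with q h1 h2
    rw [← mul_assoc, mul_comm (conj _), h.frameFactor_mul_conj h' h1 h2, ← Complex.ofReal_mul,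
      ← Real.exp_add]
    simp
  Z_eq f := by
    induction f using smoothGerm.ind with | h f hf
    rw [h.webster_Z_mk, h'.webster_Z_mk, smoothGerm.mk_mul, smoothGerm.mk_eq_mk]
    exact hX.eventually.mono fun q hq => dZ_eq hq X' f
  Zb_eq f := by
    induction f using smoothGerm.ind with | h f hf
    rw [h.webster_Zb_mk, h'.webster_Zb_mk, smoothGerm.mk_mul, smoothGerm.mk_eq_mk]
    exact hX.eventually.mono fun q hq => dZbar_eq hq X' f
  Z_e := by
    rw [h.germ_frameFactor_mul h' hX hX' hσ, h.webster_Z_mk, h.webster_Z_mk, smoothGerm.mk_neg, smoothGerm.mk_mul,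
      smoothGerm.mk_eq_mk]
    filter_upwards [hσ.eventually_nhds] with q hq
    have := SmoothNear.mdifferentiableAt hq
    simp only [dZ, vectorDeriv, diffAt_exp_neg this]
    ring
  Zb_e := by
    rw [h.germ_frameFactor_mul h' hX hX' hσ, h.webster_Zb_mk, h.webster_Zb_mk, smoothGerm.mk_neg, smoothGerm.mk_mul,
      smoothGerm.mk_eq_mk]
    filter_upwards [hσ.eventually_nhds] with q hq
    have := SmoothNear.mdifferentiableAt hq
    simp only [dZbar, vectorDeriv, diffAt_exp_neg this]
    ring

theorem IsContactForm.frameChange_mul (h : S.IsContactForm θ)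
    (h' : S.IsContactForm (OneForm.expSmul σ θ)) (hX : S.IsUnitaryFrame θ X p)
    (hX' : S.IsUnitaryFrame (OneForm.expSmul σ θ) X' p) (hσ : SmoothNear σ p) :
    (h.frameChange h' hX hX' hσ).g * (h.frameChange h' hX hX' hσ).gb
      = smoothGerm.mk _ hσ.neg.exp.ofReal :=
  h.germ_frameFactor_mul h' hX hX' hσ

end Conformal

end CRStructure

end

/-! ### Frame independence, smoothness of Q', and the transformation laws. -/

section

namespace CRStructure

variable {M : Type*} [TopologicalSpace M] [ChartedSpace R3 M] [IsManifold (𝓡 3) ∞ M]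
  {S : CRStructure M} {θ : OneForm M} {X X' : ∀ x, S.H x} {p : M} {σ : M → ℝ}

theorem expSmul_zero : OneForm.expSmul (fun _ => 0) θ = θ := by
  funext x
  simp [OneForm.expSmul]

theorem germ_ofReal_zero :
    smoothGerm.mk (p := p) (fun _ => ((0 : ℝ) : ℂ)) (SmoothNear.const (0 : ℝ)).ofReal = 0 :=
  (smoothGerm.mk_eq_mk (hg := SmoothNear.const 0)).2
    (Filter.Eventually.of_forall fun _ => Complex.ofReal_zero)

/-- Two unitary frames of the same θ are the case σ = 0 of the conformal change. -/
theorem IsContactForm.exists_frameChange (h : S.IsContactForm θ) (hX : S.IsUnitaryFrame θ X p)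
    (hX' : S.IsUnitaryFrame θ X' p) :
    ∃ C : (h.webster hX).FrameChange (h.webster hX') 0, C.g * C.gb = 1 ∧
      C.g = smoothGerm.mk _ (h.smooth_frameFactor hX hX') := by
  -- `expSmul 0 θ` equals θ only propositionally, so the form and the germ of σ are made variables
  -- before substituting.
  have key : ∀ θ', θ' = OneForm.expSmul (fun _ => 0) θ → ∀ (h' : S.IsContactForm θ')
      (hX' : S.IsUnitaryFrame θ' X' p), ∀ s, s = smoothGerm.mk (p := p)
        (fun _ => ((0 : ℝ) : ℂ)) (SmoothNear.const (0 : ℝ)).ofReal →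
      ∃ C : (h.webster hX).FrameChange (h'.webster hX') s, C.g * C.gb = 1 ∧
        C.g = smoothGerm.mk _ (h.smooth_frameFactor hX hX') := by
    rintro _ rfl h' hX' _ rfl
    refine ⟨h.frameChange h' hX hX' (SmoothNear.const 0), ?_, rfl⟩
    rw [h.frameChange_mul]
    refine (smoothGerm.mk_eq_mk (hg := SmoothNear.const 1)).2 (Filter.Eventually.of_forall ?_)
    simp
  exact key θ expSmul_zero.symm h hX' 0 germ_ofReal_zero.symm

theorem IsContactForm.qPrimeIn_eq (h : S.IsContactForm θ) (hX : S.IsUnitaryFrame θ X p)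
    (hX' : S.IsUnitaryFrame θ X' p) : S.qPrimeIn θ X' p = S.qPrimeIn θ X p := by
  obtain ⟨C, hC, -⟩ := h.exists_frameChange hX hX'
  have h1 := congrArg (smoothGerm.eval p) C.Q'_eq
  rw [hC, one_pow, one_mul, WebsterAlgebra.conformalQ_zero, h.eval_webster_Q,
    h.eval_webster_Q] at h1
  exact_mod_cast h1

theorem IsContactForm.qPrime_eq (h : S.IsContactForm θ) (hX : S.IsUnitaryFrame θ X p) :
    S.qPrime θ p = S.qPrimeIn θ X p :=
  h.qPrimeIn_eq hX (h.isUnitaryFrame_frameAt p)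

theorem IsContactForm.smooth_qPrimeIn (h : S.IsContactForm θ) (hX : S.IsUnitaryFrame θ X p) :
    SmoothNear (S.qPrimeIn θ X) p := by
  have hR := h.smooth_ofReal_scalarCurv hX
  have hA := h.smooth_torsion hX
  have h1 := (((SmoothNear.const 2).mul (h.smooth_subLap hX hR).re).sub
    ((SmoothNear.const 4).mul (hA.mul hA.conj).re)).add (hR.re.mul hR.re)
  refine h1.congr (Filter.Eventually.of_forall fun x => ?_)
  beta_reduce
  rw [Complex.mul_conj, Complex.ofReal_re, Complex.ofReal_re, Complex.normSq_eq_norm_sq, ← pow_two]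
  rfl

/-- The frame in `qPrime` changes with the point; by frame independence the frame chosen at p
computes it on a whole neighbourhood of p. -/
theorem IsContactForm.contMDiff_qPrime (h : S.IsContactForm θ) :
    ContMDiff (𝓡 3) 𝓘(ℝ, ℝ) ∞ (S.qPrime θ) := by
  intro p
  have hX := h.isUnitaryFrame_frameAt p
  refine (SmoothNear.congr (h.smooth_qPrimeIn hX) ?_).self_of_nhds
  exact hX.eventually.mono fun q hq => h.qPrime_eq hq

section Conformal

variable (h : S.IsContactForm θ) (h' : S.IsContactForm (OneForm.expSmul σ θ))
  (hX : S.IsUnitaryFrame θ X p) (hX' : S.IsUnitaryFrame (OneForm.expSmul σ θ) X' p)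
  (hσ : SmoothNear σ p)

include h' hX' in
-- The law of W read backwards: if both forms are pseudo-Einstein, the obstruction vanishes. The
-- invariance of the integral therefore needs no description of the kernel of P₁.
theorem IsContactForm.P1_eq_zero (hW : S.IsPseudoEinstein θ)
    (hW' : S.IsPseudoEinstein (OneForm.expSmul σ θ)) :
    (h.webster hX).P1 (smoothGerm.mk _ hσ.ofReal) = 0 := by
  let C := h.frameChange h' hX hX' hσ
  have h1 := C.W'_eq
  rw [h'.webster_W_eq_zero hX' hW', h.webster_W_eq_zero hX hW] at h1
  have h2 : C.g ^ 2 * C.gb * (3 * (h.webster hX).P1 (smoothGerm.mk _ hσ.ofReal)) = 0 := by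
    linear_combination h1
  have h3 : 3 * (h.webster hX).P1 (smoothGerm.mk _ hσ.ofReal) = 0 := by
    linear_combination C.gi ^ 2 * C.gbi * h2
      - 3 * (h.webster hX).P1 (smoothGerm.mk _ hσ.ofReal)
        * (C.gb * C.gbi * (C.g * C.gi + 1) * C.g_gi + C.gb_gbi)
  -- 3 is invertible among germs, with inverse the constant 1/3.
  have h4 : smoothGerm.mk (p := p) (fun _ => (1 / 3 : ℂ)) (SmoothNear.const _) * 3 = 1 :=
    (smoothGerm.mk_eq_mk (hf := (SmoothNear.const _).mul (SmoothNear.const 3))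
      (hg := SmoothNear.const 1)).2 (Filter.Eventually.of_forall fun _ => by norm_num)
  linear_combination smoothGerm.mk (p := p) (fun _ => (1 / 3 : ℂ)) (SmoothNear.const _) * h3
    - (h.webster hX).P1 (smoothGerm.mk _ hσ.ofReal) * h4

include h hX in
-- Near p, σ = v/2 + v̄/2 with v a CR function, and conjugation turns Z̄v = 0 into Z v̄ = 0.
theorem IsContactForm.P1_eq_zero_of_isPluriharmonic (hp : S.IsPluriharmonic σ) :
    (h.webster hX).P1 (smoothGerm.mk _ hσ.ofReal) = 0 := by
  obtain ⟨-, hp⟩ := hp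
  obtain ⟨U, hU, hpU, v, hv, hU'⟩ := hp p
  have hv' : SmoothNear v p := by
    filter_upwards [hU.mem_nhds hpU] with q hq using hv.contMDiffAt (hU.mem_nhds hq)
  let a := smoothGerm.mk (p := p) (fun _ => (1 / 2 : ℂ)) (SmoothNear.const _)
  have h1 : smoothGerm.mk _ hσ.ofReal
      = a * smoothGerm.mk v hv' + a * smoothGerm.mk _ hv'.conj := by
    rw [smoothGerm.mk_mul, smoothGerm.mk_mul, smoothGerm.mk_add, smoothGerm.mk_eq_mk]
    filter_upwards [hU.mem_nhds hpU] with q hq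
    rw [← mul_add, Complex.add_conj, (hU' q hq).1]
    push_cast
    ring
  have h2 : (h.webster hX).Zb (smoothGerm.mk v hv') = 0 := by
    rw [h.webster_Zb_mk]
    refine (smoothGerm.mk_eq_mk (hg := SmoothNear.const 0)).2 ?_
    filter_upwards [hU.mem_nhds hpU] with q hq
    have := (hU' q hq).2 (X q)
    simp only [dZbar, vectorDeriv, vecX, vecY, this, zero_div]
  have h3 : (h.webster hX).Z (smoothGerm.mk _ hv'.conj) = 0 := by
    have := (h.webster_conjugation hX).map_Zb (smoothGerm.mk v hv')
    rw [h2, map_zero, smoothGerm.conjHom_mk] at this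
    exact this.symm
  rw [h1]
  apply WebsterAlgebra.P1_eq_zero
  · rw [Derivation.leibniz, h2, show (h.webster hX).Zb a = 0 from hX.germZbar_const _]
    simp
  · rw [Derivation.leibniz, h3, show (h.webster hX).Z a = 0 from hX.germZ_const _]
    simp

include h in
theorem IsContactForm.isPseudoEinstein_expSmul (hp : S.IsPluriharmonic σ)
    (hW : S.IsPseudoEinstein θ) : S.IsPseudoEinstein (OneForm.expSmul σ θ) := by
  intro p X' hX'
  have h' := h.expSmul hp.1
  have hX := h.isUnitaryFrame_frameAt p
  have hσ : SmoothNear σ p := Filter.Eventually.of_forall hp.1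
  have h1 := (h.frameChange h' hX hX' hσ).W'_eq
  rw [h.webster_W_eq_zero hX hW, h.P1_eq_zero_of_isPluriharmonic hX hσ hp, mul_zero, sub_zero,
    mul_zero, h'.webster_W] at h1
  exact (smoothGerm.eval_mk _).symm.trans ((congrArg (smoothGerm.eval p) h1).trans (map_zero _))

theorem germ_ofReal_sq (hσ : SmoothNear σ p) : smoothGerm.mk _ hσ.ofReal ^ 2
    = smoothGerm.mk (fun x => ((σ x ^ 2 : ℝ) : ℂ))
      (hσ.contDiff_comp (contDiff_id.pow 2)).ofReal := by
  rw [pow_two, smoothGerm.mk_mul, smoothGerm.mk_eq_mk]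
  exact Filter.Eventually.of_forall fun x => by push_cast; ring

include h h' hσ in
-- Stated for two pseudo-Einstein forms instead of pluriharmonic σ, so that it serves both the
-- pointwise law and the integral.
theorem IsContactForm.qPrime_expSmul (hW : S.IsPseudoEinstein θ)
    (hW' : S.IsPseudoEinstein (OneForm.expSmul σ θ)) :
    Real.exp (2 * σ p) * S.qPrime (OneForm.expSmul σ θ) p
      = S.qPrime θ p + S.pPrime θ σ p + 1 / 2 * S.paneitz θ (fun x => σ x ^ 2) p := by
  have hX := h.isUnitaryFrame_frameAt p
  have hX' := h'.isUnitaryFrame_frameAt p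
  have hc := h.webster_conjugation hX
  have h1 := h.P1_eq_zero h' hX hX' hσ hW hW'
  have h1b : (h.webster hX).P1b (smoothGerm.mk _ hσ.ofReal) = 0 := by
    rw [← smoothGerm.conj_mk_ofReal hσ.ofReal, ← hc.map_P1, h1, map_zero]
  have hW0 := h.webster_W_eq_zero hX hW
  have hWb0 : (h.webster hX).Wb = 0 := by rw [← hc.map_W, hW0, map_zero]
  have h2 := congrArg (smoothGerm.eval p) (WebsterAlgebra.two_mul_conformal_Q h1 h1b hW0 hWb0)
  have h3 := congrArg (smoothGerm.eval p) (h.frameChange h' hX hX' hσ).Q'_eq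
  rw [h.frameChange_mul h' hX hX' hσ, h'.eval_webster_Q, map_mul, map_pow, smoothGerm.eval_mk] at h3
  rw [germ_ofReal_sq hσ] at h2
  simp only [map_add, map_mul, map_ofNat, h.eval_webster_Q, h.eval_webster_pPrime hX hW0,
    h.eval_webster_paneitz] at h2
  -- The weight (g ḡ)² = e^{-2σ} in the law of Q' is compensated by e^{2σ}.
  have h4 : (Real.exp (2 * σ p) : ℂ) * (Real.exp (-σ p) : ℂ) ^ 2 = 1 := by
    rw [← Complex.ofReal_pow, ← Complex.ofReal_mul, ← Real.exp_nat_mul, ← Real.exp_add]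
    simp
  have h5 : (Real.exp (2 * σ p) : ℂ) * (S.qPrimeIn (OneForm.expSmul σ θ)
      (S.frameAt (OneForm.expSmul σ θ) p) p : ℂ) = S.qPrimeIn θ (S.frameAt θ p) p
      + S.pPrimeIn θ (S.frameAt θ p) (fun x => (σ x : ℂ)) p
      + 1 / 2 * S.paneitzIn θ (S.frameAt θ p) (fun x => ((σ x ^ 2 : ℝ) : ℂ)) p := by
    linear_combination (Real.exp (2 * σ p) : ℂ) * h3 + 1 / 2 * h2
      + smoothGerm.eval p ((h.webster hX).conformalQ (smoothGerm.mk _ hσ.ofReal)) * h4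
  have h6 : (1 / 2 : ℂ) = ((1 / 2 : ℝ) : ℂ) := by norm_num
  rw [h6] at h5
  simp only [← Complex.ofReal_mul, ← Complex.ofReal_add] at h5
  exact Complex.ofReal_injective h5

end Conformal

end CRStructure

end

/-! ### Determinants and divergence in ℝ³. -/

section

/-- The determinant of three vectors of `ℝ³`. -/
def det3 (u v w : R3) : ℝ :=
  u 0 * (v 1 * w 2 - v 2 * w 1) - u 1 * (v 0 * w 2 - v 2 * w 0) + u 2 * (v 0 * w 1 - v 1 * w 0)

/-- The divergence of a vector field on `ℝ³`. -/
noncomputable def diverg (U : R3 → R3) (y : R3) : ℝ :=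
  ∑ j : Fin 3, fderiv ℝ U y (EuclideanSpace.single j 1) j

theorem R3.eq_sum (u : R3) : u = u 0 • EuclideanSpace.single 0 1 + u 1 • EuclideanSpace.single 1 1
    + u 2 • EuclideanSpace.single 2 1 := by
  refine PiLp.ext fun j => ?_
  fin_cases j <;> simp

theorem R3.clm_apply (L : R3 →L[ℝ] R3) (u : R3) (k : Fin 3) :
    L u k = u 0 * L (EuclideanSpace.single 0 1) k + u 1 * L (EuclideanSpace.single 1 1) k
      + u 2 * L (EuclideanSpace.single 2 1) k := by
  conv_lhs => rw [R3.eq_sum u]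
  simp [map_add, map_smul]

/-- The infinitesimal form of `det3_map`: the trace is the derivative of the determinant at the
identity. -/
theorem det3_trace (L : R3 →L[ℝ] R3) (u v w : R3) :
    det3 (L u) v w + det3 u (L v) w + det3 u v (L w)
      = (∑ j : Fin 3, L (EuclideanSpace.single j 1) j) * det3 u v w := by
  simp only [det3, R3.clm_apply L u, R3.clm_apply L v, R3.clm_apply L w, Fin.sum_univ_three]
  ring

theorem det3_map (L : R3 →L[ℝ] R3) (u v w : R3) :
    det3 (L u) (L v) (L w) = LinearMap.det (L : R3 →ₗ[ℝ] R3) * det3 u v w := by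
  rw [← LinearMap.det_toMatrix (EuclideanSpace.basisFun (Fin 3) ℝ).toBasis, Matrix.det_fin_three]
  simp only [LinearMap.toMatrix_apply, OrthonormalBasis.coe_toBasis, EuclideanSpace.basisFun_apply,
    OrthonormalBasis.coe_toBasis_repr_apply, EuclideanSpace.basisFun_repr,
    ContinuousLinearMap.coe_coe]
  simp only [det3, R3.clm_apply L u, R3.clm_apply L v, R3.clm_apply L w]
  ring

theorem hasFDerivAt_coord {U : R3 → R3} {y : R3} (hU : DifferentiableAt ℝ U y) (j : Fin 3) :
    HasFDerivAt (fun z => U z j) ((EuclideanSpace.proj j).comp (fderiv ℝ U y)) y :=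
  (EuclideanSpace.proj j : R3 →L[ℝ] ℝ).hasFDerivAt.comp y hU.hasFDerivAt

theorem fderiv_det3 {U V W : R3 → R3} {y : R3} (hU : DifferentiableAt ℝ U y)
    (hV : DifferentiableAt ℝ V y) (hW : DifferentiableAt ℝ W y) (v : R3) :
    fderiv ℝ (fun z => det3 (U z) (V z) (W z)) y v = det3 (fderiv ℝ U y v) (V y) (W y)
      + det3 (U y) (fderiv ℝ V y v) (W y) + det3 (U y) (V y) (fderiv ℝ W y v) := by
  have u := hasFDerivAt_coord hU
  have v := hasFDerivAt_coord hV
  have w := hasFDerivAt_coord hW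
  have h := (((u 0).mul (((v 1).mul (w 2)).sub ((v 2).mul (w 1)))).sub
    ((u 1).mul (((v 0).mul (w 2)).sub ((v 2).mul (w 0))))).add
    ((u 2).mul (((v 0).mul (w 1)).sub ((v 1).mul (w 0))))
  have h' : HasFDerivAt (fun z => det3 (U z) (V z) (W z)) _ y := h
  rw [h'.fderiv]
  simp only [add_apply, sub_apply, smul_apply, ContinuousLinearMap.comp_apply,
    PiLp.proj_apply, Pi.mul_apply, Pi.sub_apply, smul_eq_mul, det3]
  ring

/-- The divergence of `V` with respect to the density `m`, if the frame `U₀, U₁, U₂` has constant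
volume `κ`. -/
theorem mul_diverg_smul {κ : ℝ} {m : R3 → ℝ} {U₀ U₁ U₂ V : R3 → R3} {y : R3}
    (hm : DifferentiableAt ℝ m y) (h₀ : DifferentiableAt ℝ U₀ y) (h₁ : DifferentiableAt ℝ U₁ y)
    (h₂ : DifferentiableAt ℝ U₂ y) (hV : DifferentiableAt ℝ V y)
    (hdet : ∀ᶠ z in 𝓝 y, m z * det3 (U₀ z) (U₁ z) (U₂ z) = κ) :
    κ * diverg (fun z => m z • V z) y
      = m y * (m y * (det3 (VectorField.lieBracket ℝ U₀ V y) (U₁ y) (U₂ y)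
        + det3 (U₀ y) (VectorField.lieBracket ℝ U₁ V y) (U₂ y)
        + det3 (U₀ y) (U₁ y) (VectorField.lieBracket ℝ U₂ V y))) := by
  have e1 : diverg (fun z => m z • V z) y = m y * diverg V y + fderiv ℝ m y (V y) := by
    unfold diverg
    rw [fderiv_fun_smul hm hV]
    conv_rhs => rw [R3.eq_sum (V y)]
    simp only [Fin.sum_univ_three, add_apply, smul_apply, ContinuousLinearMap.smulRight_apply,
      map_add, map_smul, smul_eq_mul, PiLp.add_apply, PiLp.smul_apply]
    ring
  have hd : DifferentiableAt ℝ (fun z => det3 (U₀ z) (U₁ z) (U₂ z)) y := by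
    unfold det3
    have c : ∀ {U : R3 → R3}, DifferentiableAt ℝ U y → ∀ j, DifferentiableAt ℝ (fun z => U z j) y :=
      fun hU j => (hasFDerivAt_coord hU j).differentiableAt
    have u := c h₀
    have v := c h₁
    have w := c h₂
    exact (((u 0).mul (((v 1).mul (w 2)).sub ((v 2).mul (w 1)))).sub
      ((u 1).mul (((v 0).mul (w 2)).sub ((v 2).mul (w 0))))).add
      ((u 2).mul (((v 0).mul (w 1)).sub ((v 1).mul (w 0))))
  -- Differentiate the constant m · det(U₀, U₁, U₂) = κ along V. Together with the trace formula for
  -- DV this converts the brackets [Uᵢ, V] into the divergence.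
  have e2 : m y * fderiv ℝ (fun z => det3 (U₀ z) (U₁ z) (U₂ z)) y (V y)
      + det3 (U₀ y) (U₁ y) (U₂ y) * fderiv ℝ m y (V y) = 0 := by
    have h1 : fderiv ℝ (fun z => m z * det3 (U₀ z) (U₁ z) (U₂ z)) y = 0 := by
      rw [Filter.EventuallyEq.fderiv_eq (show _ =ᶠ[𝓝 y] fun _ => κ from hdet)]
      simp
    rw [fderiv_fun_mul hm hd] at h1
    have := DFunLike.congr_fun h1 (V y)
    simpa using this
  rw [fderiv_det3 h₀ h₁ h₂] at e2
  have e3 := det3_trace (fderiv ℝ V y) (U₀ y) (U₁ y) (U₂ y)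
  have e4 : m y * det3 (U₀ y) (U₁ y) (U₂ y) = κ := hdet.self_of_nhds
  have hdiv : ∑ j : Fin 3, fderiv ℝ V y (EuclideanSpace.single j 1) j = diverg V y := rfl
  rw [hdiv] at e3
  rw [e1]
  simp only [VectorField.lieBracket_eq]
  have s0 : ∀ a b v w : R3, det3 (a - b) v w = det3 a v w - det3 b v w := by
    intros; simp [det3]; ring
  have s1 : ∀ a b v w : R3, det3 v (a - b) w = det3 v a w - det3 v b w := by
    intros; simp [det3]; ring
  have s2 : ∀ a b v w : R3, det3 v w (a - b) = det3 v w a - det3 v w b := by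
    intros; simp [det3]; ring
  rw [s0, s1, s2]
  linear_combination m y * e2 - m y ^ 2 * e3 - (m y * diverg V y + fderiv ℝ m y (V y)) * e4

/-- The integral of the divergence of a compactly supported vector field vanishes. -/
theorem integral_diverg_eq_zero {U : R3 → R3} (hU : ContDiff ℝ 1 U) (hc : HasCompactSupport U) :
    ∫ y, diverg U y = 0 := by
  have hd : ∀ j : Fin 3, ContDiff ℝ 1 fun y => U y j := fun j =>
    (EuclideanSpace.proj j : R3 →L[ℝ] ℝ).contDiff.comp hU
  have hcj : ∀ j : Fin 3, HasCompactSupport fun y => U y j := fun j =>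
    hc.comp_left (g := fun u : R3 => u j) rfl
  have he : ∀ y (j : Fin 3), fderiv ℝ U y (EuclideanSpace.single j 1) j
      = fderiv ℝ (fun y => U y j) y (EuclideanSpace.single j 1) := fun y j => by
    rw [(hasFDerivAt_coord (hU.differentiable one_ne_zero y) j).fderiv]
    rfl
  have hi : ∀ j : Fin 3, MeasureTheory.Integrable
      fun y => fderiv ℝ (fun y => U y j) y (EuclideanSpace.single j 1) := fun j =>
    (((hd j).continuous_fderiv one_ne_zero).clm_apply continuous_const).integrable_of_hasCompactSupport
      ((hcj j).fderiv_apply (𝕜 := ℝ) _)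
  unfold diverg
  simp only [he]
  rw [MeasureTheory.integral_finsetSum _ fun j _ => hi j]
  refine Finset.sum_eq_zero fun j _ => ?_
  -- Integration by parts against the constant function 1.
  have := integral_mul_fderiv_eq_neg_fderiv_mul_of_integrable (μ := MeasureTheory.volume)
    (f := fun _ : R3 => (1 : ℝ)) (g := fun y => U y j) (v := EuclideanSpace.single j 1)
    (by simp) (by simpa using hi j)
    (by simpa using (hd j).continuous.integrable_of_hasCompactSupport (hcj j))
    (by simp) (fun x _ => (hd j).differentiable one_ne_zero x)
  simpa using this

end

/-! ### The volume form θ ∧ dθ in charts, change of variables, and divergence in a frame. -/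

section

variable {M : Type*} [TopologicalSpace M] [ChartedSpace R3 M]

/-- The three-form `θ ∧ dθ` in the chart around `c`. -/
noncomputable def OneForm.wedgeInChart (θ : OneForm M) (c : M) (y u v w : R3) : ℝ :=
  θ.inChart c y u * θ.extDerivInChart c y v w + θ.inChart c y v * θ.extDerivInChart c y w u
    + θ.inChart c y w * θ.extDerivInChart c y u v

/-- An alternating three-form on ℝ³ is a multiple of the determinant. -/
theorem OneForm.wedgeInChart_eq (θ : OneForm M) (c : M) (y u v w : R3) :
    θ.wedgeInChart c y u v w = θ.volumeCoeff c y * det3 u v w := by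
  unfold OneForm.wedgeInChart OneForm.volumeCoeff OneForm.extDerivInChart
  generalize fderiv ℝ (θ.inChart c) y = L
  rw [R3.eq_sum u, R3.eq_sum v, R3.eq_sum w]
  simp only [map_add, map_smul, add_apply, smul_apply, smul_eq_mul, det3, PiLp.add_apply,
    PiLp.smul_apply, PiLp.single_apply]
  simp
  ring

variable [IsManifold (𝓡 3) ∞ M]

theorem OneForm.inChart_mfderiv (θ : OneForm M) {c x : M} (hx : x ∈ (extChartAt (𝓡 3) c).source)
    (v : TangentSpace (𝓡 3) x) : θ.inChart c (extChartAt (𝓡 3) c x)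
      (mfderiv (𝓡 3) 𝓘(ℝ, R3) (extChartAt (𝓡 3) c) x v) = θ x v := by
  obtain ⟨V, -, rfl⟩ := exists_smoothFieldNear x v
  have h := θ.inChart_chartField ((extChartAt (𝓡 3) c).map_source hx) V
  rw [chartField_eq_mfderiv hx] at h
  exact h.trans (congrArg (fun x => θ x (V x)) ((extChartAt (𝓡 3) c).left_inv hx))

theorem OneForm.IsSmooth.wedgeInChart_mfderiv {θ : OneForm M} (hθ : θ.IsSmooth) {c x : M}
    (hx : x ∈ (extChartAt (𝓡 3) c).source) (u v w : TangentSpace (𝓡 3) x) :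
    θ.wedgeInChart c (extChartAt (𝓡 3) c x)
      (mfderiv (𝓡 3) 𝓘(ℝ, R3) (extChartAt (𝓡 3) c) x u)
      (mfderiv (𝓡 3) 𝓘(ℝ, R3) (extChartAt (𝓡 3) c) x v)
      (mfderiv (𝓡 3) 𝓘(ℝ, R3) (extChartAt (𝓡 3) c) x w)
    = θ x u * θ.extDeriv x v w + θ x v * θ.extDeriv x w u + θ x w * θ.extDeriv x u v := by
  unfold OneForm.wedgeInChart
  simp only [θ.inChart_mfderiv hx, hθ.extDerivInChart_mfderiv hx]

theorem OneForm.IsSmooth.volumeCoeff_transition {θ : OneForm M} (hθ : θ.IsSmooth) {c c' : M} {y : R3}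
    (hy : y ∈ (extChartAt (𝓡 3) c).target)
    (hy' : (extChartAt (𝓡 3) c).symm y ∈ (extChartAt (𝓡 3) c').source) :
    ∃ D : R3 →L[ℝ] R3, HasFDerivAt (fun z => extChartAt (𝓡 3) c' ((extChartAt (𝓡 3) c).symm z)) D y ∧
      θ.volumeCoeff c y
        = D.det * θ.volumeCoeff c' (extChartAt (𝓡 3) c' ((extChartAt (𝓡 3) c).symm y)) := by
  have : IsManifold (𝓡 3) 1 M := IsManifold.of_le (n := ∞) (by simp)
  have h1 := ((contMDiffAt_extChartAt_symm' hy).mdifferentiableAt (by simp)).hasMFDerivAt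
  have h2 := (mdifferentiableAt_extChartAt (I := 𝓡 3) (by rwa [extChartAt_source] at hy')).hasMFDerivAt
  refine ⟨(mfderiv (𝓡 3) 𝓘(ℝ, R3) (extChartAt (𝓡 3) c') ((extChartAt (𝓡 3) c).symm y)).comp
    (mfderiv 𝓘(ℝ, R3) (𝓡 3) (extChartAt (𝓡 3) c).symm y), (h2.comp y h1).hasFDerivAt, ?_⟩
  set x := (extChartAt (𝓡 3) c).symm y with hxdef
  have hx : x ∈ (extChartAt (𝓡 3) c).source := (extChartAt (𝓡 3) c).map_target hy
  have hxy : extChartAt (𝓡 3) c x = y := (extChartAt (𝓡 3) c).right_inv hy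
  let e : Fin 3 → R3 := fun j => EuclideanSpace.single j 1
  let v : Fin 3 → TangentSpace (𝓡 3) x := fun j =>
    mfderiv 𝓘(ℝ, R3) (𝓡 3) (extChartAt (𝓡 3) c).symm y (e j)
  have hv : ∀ j, mfderiv (𝓡 3) 𝓘(ℝ, R3) (extChartAt (𝓡 3) c) x (v j) = e j := fun j =>
    mfderiv_extChartAt_apply hy (e j)
  have he : det3 (e 0) (e 1) (e 2) = 1 := by simp [det3, e]
  have h3 := hθ.wedgeInChart_mfderiv hx (v 0) (v 1) (v 2)
  rw [← hθ.wedgeInChart_mfderiv hy' (v 0) (v 1) (v 2), hv, hv, hv, hxy] at h3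
  have h4 := θ.wedgeInChart_eq c y (e 0) (e 1) (e 2)
  rw [he, mul_one] at h4
  rw [← h4]
  refine h3.trans ((θ.wedgeInChart_eq _ _ _ _ _).trans ?_)
  have h5 := det3_map ((mfderiv (𝓡 3) 𝓘(ℝ, R3) (extChartAt (𝓡 3) c') x).comp
    (mfderiv 𝓘(ℝ, R3) (𝓡 3) (extChartAt (𝓡 3) c).symm y)) (e 0) (e 1) (e 2)
  rw [he, mul_one] at h5
  rw [mul_comm]
  exact congrArg (· * θ.volumeCoeff c' (extChartAt (𝓡 3) c' x)) h5

/-- The integral of `f θ ∧ dθ` over the domain of the chart around `c`. -/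
noncomputable def OneForm.chartIntegral (θ : OneForm M) (c : M) (f : M → ℝ) : ℝ :=
  ∫ y in (extChartAt (𝓡 3) c).target, f ((extChartAt (𝓡 3) c).symm y) * |θ.volumeCoeff c y|

theorem isOpen_extChartAt_transition (c c' : M) : IsOpen ((extChartAt (𝓡 3) c).target ∩
    (extChartAt (𝓡 3) c).symm ⁻¹' (extChartAt (𝓡 3) c').source) :=
  (continuousOn_extChartAt_symm c).isOpen_inter_preimage (isOpen_extChartAt_target c)
    (isOpen_extChartAt_source c')

theorem chartIntegral_eq_setIntegral (θ : OneForm M) {c c' : M} {f : M → ℝ}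
    (hf : ∀ x, f x ≠ 0 → x ∈ (extChartAt (𝓡 3) c').source) :
    θ.chartIntegral c f = ∫ y in (extChartAt (𝓡 3) c).target ∩
      (extChartAt (𝓡 3) c).symm ⁻¹' (extChartAt (𝓡 3) c').source,
        f ((extChartAt (𝓡 3) c).symm y) * |θ.volumeCoeff c y| := by
  have ho : MeasurableSet (extChartAt (𝓡 3) c).target := (isOpen_extChartAt_target c).measurableSet
  refine MeasureTheory.setIntegral_eq_of_subset_of_forall_sdiff_eq_zero ho Set.inter_subset_left ?_
  intro y hy
  have : f ((extChartAt (𝓡 3) c).symm y) = 0 := by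
    by_contra h
    exact hy.2 ⟨hy.1, hf _ h⟩
  rw [this, zero_mul]

/-- Change of variables by the transition map. The coefficient transforms by the Jacobian
determinant and enters by its absolute value, so charts of either orientation are allowed. -/
theorem OneForm.IsSmooth.chartIntegral_eq {θ : OneForm M} (hθ : θ.IsSmooth) {c c' : M} {f : M → ℝ}
    (hf : ∀ x, f x ≠ 0 → x ∈ (extChartAt (𝓡 3) c).source)
    (hf' : ∀ x, f x ≠ 0 → x ∈ (extChartAt (𝓡 3) c').source) :
    θ.chartIntegral c f = θ.chartIntegral c' f := by
  rw [chartIntegral_eq_setIntegral θ hf', chartIntegral_eq_setIntegral θ hf]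
  set s := (extChartAt (𝓡 3) c).target ∩
    (extChartAt (𝓡 3) c).symm ⁻¹' (extChartAt (𝓡 3) c').source with hs
  set s' := (extChartAt (𝓡 3) c').target ∩
    (extChartAt (𝓡 3) c').symm ⁻¹' (extChartAt (𝓡 3) c).source with hs'
  -- Outside the overlap D is set to 0, so that the derivative can be chosen as a function on all of
  -- ℝ³.
  have h : ∀ y : R3, ∃ D : R3 →L[ℝ] R3, y ∈ s → HasFDerivAt
      (fun z => extChartAt (𝓡 3) c' ((extChartAt (𝓡 3) c).symm z)) D y ∧ θ.volumeCoeff c y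
        = D.det * θ.volumeCoeff c' (extChartAt (𝓡 3) c' ((extChartAt (𝓡 3) c).symm y)) := by
    intro y
    by_cases hy : y ∈ s
    · obtain ⟨D, hD⟩ := hθ.volumeCoeff_transition hy.1 hy.2
      exact ⟨D, fun _ => hD⟩
    · exact ⟨0, fun h => absurd h hy⟩
  choose D hD using h
  have himg : (fun z => extChartAt (𝓡 3) c' ((extChartAt (𝓡 3) c).symm z)) '' s = s' := by
    ext z
    constructor
    · rintro ⟨y, hy, rfl⟩
      refine ⟨(extChartAt (𝓡 3) c').map_source hy.2, ?_⟩
      rw [Set.mem_preimage, (extChartAt (𝓡 3) c').left_inv hy.2]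
      exact (extChartAt (𝓡 3) c).map_target hy.1
    · rintro hz
      refine ⟨extChartAt (𝓡 3) c ((extChartAt (𝓡 3) c').symm z),
        ⟨(extChartAt (𝓡 3) c).map_source hz.2, ?_⟩, ?_⟩
      · rw [Set.mem_preimage, (extChartAt (𝓡 3) c).left_inv hz.2]
        exact (extChartAt (𝓡 3) c').map_target hz.1
      · beta_reduce
        rw [(extChartAt (𝓡 3) c).left_inv hz.2, (extChartAt (𝓡 3) c').right_inv hz.1]
  have hinj : Set.InjOn (fun z => extChartAt (𝓡 3) c' ((extChartAt (𝓡 3) c).symm z)) s := by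
    intro y hy z hz hyz
    exact (extChartAt (𝓡 3) c).symm.injOn hy.1 hz.1
      ((extChartAt (𝓡 3) c').injOn hy.2 hz.2 hyz)
  rw [← himg, MeasureTheory.integral_image_eq_integral_abs_det_fderiv_smul _
    (isOpen_extChartAt_transition c c').measurableSet
    (fun y hy => (hD y hy).1.hasFDerivWithinAt) hinj]
  refine MeasureTheory.setIntegral_congr_fun (isOpen_extChartAt_transition c c').measurableSet ?_
  intro y hy
  beta_reduce
  rw [(hD y hy).2, (extChartAt (𝓡 3) c').left_inv hy.2, abs_mul, smul_eq_mul]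
  ring

theorem OneForm.IsSmooth.contDiffAt_volumeCoeff {θ : OneForm M} (hθ : θ.IsSmooth) {c : M} {y : R3}
    (hy : y ∈ (extChartAt (𝓡 3) c).target) : ContDiffAt ℝ ∞ (θ.volumeCoeff c) y := by
  have h1 := hθ.contDiffAt_inChart hy
  have h2 : ContDiffAt ℝ ∞ (fderiv ℝ (θ.inChart c)) y := h1.fderiv_right (by simp)
  have a : ∀ u : R3, ContDiffAt ℝ ∞ (fun z => θ.inChart c z u) y := fun u =>
    h1.clm_apply contDiffAt_const
  have b : ∀ u v : R3, ContDiffAt ℝ ∞ (fun z => θ.extDerivInChart c z u v) y := fun u v =>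
    ((h2.clm_apply contDiffAt_const).clm_apply contDiffAt_const).sub
      ((h2.clm_apply contDiffAt_const).clm_apply contDiffAt_const)
  exact (((a _).mul (b _ _)).add ((a _).mul (b _ _))).add ((a _).mul (b _ _))

theorem OneForm.IsSmooth.volumeCoeff_mul_det3_chartField {θ : OneForm M} (hθ : θ.IsSmooth) {c : M}
    {y : R3} (hy : y ∈ (extChartAt (𝓡 3) c).target) (U V W : ∀ x : M, TangentSpace (𝓡 3) x) :
    θ.volumeCoeff c y * det3 (chartField c U y) (chartField c V y) (chartField c W y)
      = (fun x => θ x (U x) * θ.extDeriv x (V x) (W x) + θ x (V x) * θ.extDeriv x (W x) (U x)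
        + θ x (W x) * θ.extDeriv x (U x) (V x)) ((extChartAt (𝓡 3) c).symm y) := by
  have hx := (extChartAt (𝓡 3) c).map_target hy
  beta_reduce
  rw [← θ.wedgeInChart_eq, ← hθ.wedgeInChart_mfderiv hx, ← chartField_eq_mfderiv hx,
    ← chartField_eq_mfderiv hx, ← chartField_eq_mfderiv hx, (extChartAt (𝓡 3) c).right_inv hy]

namespace CRStructure

variable {S : CRStructure M} {θ : OneForm M} {X : ∀ x, S.H x}

theorem IsContactForm.volumeCoeff_mul_det3 (h : S.IsContactForm θ) {c : M} {y : R3}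
    (hy : y ∈ (extChartAt (𝓡 3) c).target)
    (hX : S.IsUnitaryFrame θ X ((extChartAt (𝓡 3) c).symm y)) :
    θ.volumeCoeff c y * det3 (chartField c (reeb θ) y) (chartField c (S.vecX X) y)
      (chartField c (S.vecY X) y) = 1 := by
  rw [h.smooth.volumeCoeff_mul_det3_chartField hy]
  beta_reduce
  rw [h.apply_reeb hX, hX.extDeriv_eq, h.apply_vecX,
    h.apply_vecY]
  ring

theorem IsContactForm.volumeCoeff_ne_zero (h : S.IsContactForm θ) {c : M} {y : R3}
    (hy : y ∈ (extChartAt (𝓡 3) c).target) : θ.volumeCoeff c y ≠ 0 := by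
  obtain ⟨X, hX⟩ := h.exists_isUnitaryFrame ((extChartAt (𝓡 3) c).symm y)
  exact left_ne_zero_of_mul_eq_one (h.volumeCoeff_mul_det3 hy hX)

/-- The divergence of a vector field with respect to the volume form `θ ∧ dθ`, computed in a
unitary frame. -/
noncomputable def fieldDiv (S : CRStructure M) (θ : OneForm M) (X : ∀ x, S.H x)
    (V : ∀ x : M, TangentSpace (𝓡 3) x) (x : M) : ℝ :=
  θ x (VectorField.mlieBracket (𝓡 3) (reeb θ) V x)
    + θ.extDeriv x (VectorField.mlieBracket (𝓡 3) (S.vecX X) V x) (S.vecY X x)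
    + θ.extDeriv x (S.vecX X x) (VectorField.mlieBracket (𝓡 3) (S.vecY X) V x)

/-- The frame T, X, JX has constant volume 1 for θ ∧ dθ, so `mul_diverg_smul` applies. Moving the
brackets back to M leaves the dual components of [T, V], [X, V], [JX, V]. -/
theorem IsContactForm.diverg_chartField (h : S.IsContactForm θ) {c : M} {y : R3}
    (hy : y ∈ (extChartAt (𝓡 3) c).target)
    (hX : S.IsUnitaryFrame θ X ((extChartAt (𝓡 3) c).symm y))
    {V : ∀ x : M, TangentSpace (𝓡 3) x} (hV : SmoothFieldNear V ((extChartAt (𝓡 3) c).symm y)) :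
    diverg (fun z => |θ.volumeCoeff c z| • chartField c V z) y
      = |θ.volumeCoeff c y| * S.fieldDiv θ X V ((extChartAt (𝓡 3) c).symm y) := by
  have hne := h.volumeCoeff_ne_zero hy
  have hsm := h.smooth.contDiffAt_volumeCoeff hy
  have hd : ∀ {V : ∀ x : M, TangentSpace (𝓡 3) x},
      SmoothFieldNear V ((extChartAt (𝓡 3) c).symm y) → DifferentiableAt ℝ (chartField c V) y :=
    fun hV => (contDiffAt_chartField hy hV.self_of_nhds).differentiableAt (by simp)
  -- ε is the sign of the volume coefficient, locally constant because the coefficient never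
  -- vanishes; it plays the role of κ.
  obtain ⟨ε, hε, hε1⟩ : ∃ ε : ℝ, (∀ᶠ z in 𝓝 y, |θ.volumeCoeff c z| = ε * θ.volumeCoeff c z)
      ∧ ε ≠ 0 := by
    rcases lt_or_gt_of_ne hne with h0 | h0
    · refine ⟨-1, ?_, by norm_num⟩
      filter_upwards [hsm.continuousAt.eventually_lt continuousAt_const h0] with z hz
      rw [abs_of_neg hz, neg_one_mul]
    · refine ⟨1, ?_, one_ne_zero⟩
      filter_upwards [continuousAt_const.eventually_lt hsm.continuousAt h0] with z hz
      rw [abs_of_pos hz, one_mul]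
  have h1 := mul_diverg_smul (κ := ε) (m := fun z => |θ.volumeCoeff c z|)
    ((hsm.abs hne).differentiableAt (by simp)) (hd (h.smooth_reeb hX)) (hd hX.smooth_vecX)
    (hd hX.smooth_vecY) (hd hV) (by
      filter_upwards [eventually_extChartAt_symm hy hX.eventually, hε] with z hz hz'
      rw [hz', mul_assoc, h.volumeCoeff_mul_det3 hz.1 hz.2, mul_one])
  have hb : ∀ {W : ∀ x : M, TangentSpace (𝓡 3) x},
      SmoothFieldNear W ((extChartAt (𝓡 3) c).symm y) →
      VectorField.lieBracket ℝ (chartField c W) (chartField c V) y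
        = chartField c (VectorField.mlieBracket (𝓡 3) W V) y := fun hW =>
    (chartField_mlieBracket hy hW.self_of_nhds hV.self_of_nhds).symm
  rw [hb (h.smooth_reeb hX), hb hX.smooth_vecX, hb hX.smooth_vecY, hε.self_of_nhds] at h1
  have hw := h.smooth.volumeCoeff_mul_det3_chartField hy
  have h2 : θ.volumeCoeff c y * (det3 (chartField c (VectorField.mlieBracket (𝓡 3) (reeb θ) V) y)
        (chartField c (S.vecX X) y) (chartField c (S.vecY X) y)
      + det3 (chartField c (reeb θ) y) (chartField c (VectorField.mlieBracket (𝓡 3) (S.vecX X) V) y)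
        (chartField c (S.vecY X) y)
      + det3 (chartField c (reeb θ) y) (chartField c (S.vecX X) y)
        (chartField c (VectorField.mlieBracket (𝓡 3) (S.vecY X) V) y))
      = S.fieldDiv θ X V ((extChartAt (𝓡 3) c).symm y) := by
    rw [mul_add, mul_add, hw, hw, hw]
    simp only [h.apply_vecX, h.apply_vecY, h.apply_reeb hX, hX.extDeriv_eq, fieldDiv,
      h.extDeriv_reeb hX, θ.extDeriv_swap _ _ (reeb θ _)]
    ring
  rw [hε.self_of_nhds]
  apply mul_left_cancel₀ hε1
  linear_combination h1 + ε ^ 2 * θ.volumeCoeff c y * h2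

end CRStructure

end

/-! ### Leibniz rule for the divergence and the divergences of T, X, JX. -/

section

/-- Near a point outside s the extension vanishes, because K is closed and contained in s. -/
theorem contDiff_indicator_of_isCompact {E : Type*} [NormedAddCommGroup E] [NormedSpace ℝ E]
    {n : WithTop ℕ∞} {s K : Set R3} {φ : R3 → E} (hs : IsOpen s) (hK : IsCompact K) (hKs : K ⊆ s)
    (hφ : ∀ y ∈ s, ContDiffAt ℝ n φ y) (h0 : ∀ y ∈ s, y ∉ K → φ y = 0) :
    ContDiff ℝ n (s.indicator φ) ∧ HasCompactSupport (s.indicator φ) := by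
  have h1 : ∀ y, y ∉ K → s.indicator φ y = 0 := fun y hy => by
    by_cases hys : y ∈ s
    · rw [Set.indicator_of_mem hys, h0 y hys hy]
    · exact Set.indicator_of_notMem hys _
  refine ⟨contDiff_iff_contDiffAt.2 fun y => ?_, HasCompactSupport.intro hK h1⟩
  by_cases hy : y ∈ s
  · refine (hφ y hy).congr_of_eventuallyEq ?_
    filter_upwards [hs.mem_nhds hy] with z hz using Set.indicator_of_mem hz _
  · refine (contDiffAt_const (c := (0 : E))).congr_of_eventuallyEq ?_
    filter_upwards [hK.isClosed.isOpen_compl.mem_nhds fun h => hy (hKs h)] with z hz using h1 z hz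

variable {M : Type*} [TopologicalSpace M] [ChartedSpace R3 M] [IsManifold (𝓡 3) ∞ M]

theorem mlieBracket_smul_field {f : M → ℝ} {U V : ∀ x : M, TangentSpace (𝓡 3) x} {p : M}
    (hf : SmoothNear f p) (hV : SmoothFieldNear V p) :
    VectorField.mlieBracket (𝓡 3) U (fun x => f x • V x) p
      = fieldDeriv U f p • V p + f p • VectorField.mlieBracket (𝓡 3) U V p :=
  VectorField.mlieBracket_smul_right hf.mdifferentiableAt
    (hV.self_of_nhds.mdifferentiableAt (by simp))

theorem mlieBracket_add_field {U V W : ∀ x : M, TangentSpace (𝓡 3) x} {p : M}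
    (hV : SmoothFieldNear V p) (hW : SmoothFieldNear W p) :
    VectorField.mlieBracket (𝓡 3) U (fun x => V x + W x) p
      = VectorField.mlieBracket (𝓡 3) U V p + VectorField.mlieBracket (𝓡 3) U W p :=
  VectorField.mlieBracket_add_right
    (hV.self_of_nhds.mdifferentiableAt (by simp)) (hW.self_of_nhds.mdifferentiableAt (by simp))

theorem fieldDeriv_add_smul {f : M → ℝ} {p : M} {V : ∀ x : M, TangentSpace (𝓡 3) x}
    {U₀ U₁ U₂ : ∀ x : M, TangentSpace (𝓡 3) x} {a b c : ℝ}
    (hV : V p = a • U₀ p + (b • U₁ p + c • U₂ p)) :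
    fieldDeriv V f p = a * fieldDeriv U₀ f p + (b * fieldDeriv U₁ f p + c * fieldDeriv U₂ f p) := by
  unfold fieldDeriv
  rw [hV, map_add, map_add, map_smul, map_smul, map_smul]
  rfl

namespace CRStructure

variable {S : CRStructure M} {θ : OneForm M} {X : ∀ x, S.H x} {p : M}
  {V W : ∀ x : M, TangentSpace (𝓡 3) x}

theorem fieldDiv_congr (hVW : ∀ᶠ x in 𝓝 p, V x = W x) :
    S.fieldDiv θ X V p = S.fieldDiv θ X W p := by
  have e : ∀ U : ∀ x : M, TangentSpace (𝓡 3) x,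
      VectorField.mlieBracket (𝓡 3) U V p = VectorField.mlieBracket (𝓡 3) U W p := fun U =>
    Filter.EventuallyEq.mlieBracket_vectorField_eq (Filter.EventuallyEq.refl _ U) hVW
  simp only [fieldDiv, e]

theorem fieldDiv_add (hV : SmoothFieldNear V p) (hW : SmoothFieldNear W p) :
    S.fieldDiv θ X (fun x => V x + W x) p = S.fieldDiv θ X V p + S.fieldDiv θ X W p := by
  simp only [fieldDiv, mlieBracket_add_field hV hW, map_add, OneForm.extDeriv_add_left,
    OneForm.extDeriv_add_right]
  ring

variable (h : S.IsContactForm θ) (hX : S.IsUnitaryFrame θ X p)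
include h hX

theorem IsContactForm.fieldDiv_smul {f : M → ℝ} (hf : SmoothNear f p) (hV : SmoothFieldNear V p) :
    S.fieldDiv θ X (fun x => f x • V x) p
      = f p * S.fieldDiv θ X V p + fieldDeriv V f p := by
  rw [fieldDeriv_add_smul (U₀ := reeb θ) (U₁ := S.vecX X) (U₂ := S.vecY X)
    (a := θ p (V p)) (b := θ.extDeriv p (V p) (S.vecY X p))
    (c := -θ.extDeriv p (V p) (S.vecX X p)) (by
      rw [neg_smul, ← sub_eq_add_neg]
      exact h.eq_frame hX (V p))]
  simp only [fieldDiv, mlieBracket_smul_field hf hV, map_add, map_smul, smul_eq_mul,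
    OneForm.extDeriv_add_left, OneForm.extDeriv_add_right, OneForm.extDeriv_smul_left,
    OneForm.extDeriv_smul_right, θ.extDeriv_swap _ (S.vecX X p) (V p)]
  ring

theorem IsContactForm.extDeriv_vecY_eq (w : TangentSpace (𝓡 3) p) :
    θ.extDeriv p w (S.vecY X p) = √2 * (S.coframe θ X p w).re := by
  have e : (√2 : ℝ) * √2 = 2 := Real.mul_self_sqrt (by norm_num)
  have e0 : √2 ≠ 0 := by positivity
  simp [coframe]
  field_simp

theorem IsContactForm.extDeriv_vecX_eq (w : TangentSpace (𝓡 3) p) :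
    θ.extDeriv p (S.vecX X p) w = √2 * (S.coframe θ X p w).im := by
  have e0 : √2 ≠ 0 := by positivity
  rw [θ.extDeriv_swap]
  simp [coframe]
  field_simp

/-- The flow of T preserves θ, hence θ ∧ dθ. In the frame this amounts to Re ω(T) = 0. -/
theorem IsContactForm.fieldDiv_reeb : S.fieldDiv θ X (reeb θ) p = 0 := by
  have h1 := congrArg Complex.re (h.conj_omegaT hX)
  have h2 : (S.omegaT θ X p).re = 0 := by
    rw [Complex.conj_re, Complex.neg_re] at h1
    linarith
  have e : ∀ U : ∀ x : M, TangentSpace (𝓡 3) x, VectorField.mlieBracket (𝓡 3) U (reeb θ) p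
      = -VectorField.mlieBracket (𝓡 3) (reeb θ) U p := fun U =>
    VectorField.mlieBracket_swap_apply
  have e1 : VectorField.mlieBracket (𝓡 3) (reeb θ) (reeb θ) p = 0 := by simp
  rw [fieldDiv, e1, e, e, map_zero, θ.extDeriv_neg_left, θ.extDeriv_neg_right,
    h.extDeriv_vecY_eq hX, h.extDeriv_vecX_eq hX]
  have h3 : (S.omegaT θ X p).re = ((S.coframe θ X p
    (VectorField.mlieBracket (𝓡 3) (reeb θ) (S.vecX X) p)).re + (S.coframe θ X p
    (VectorField.mlieBracket (𝓡 3) (reeb θ) (S.vecY X) p)).im) / √2 := by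
    simp [omegaT]
  rw [h3, div_eq_zero_iff, or_iff_left (by positivity)] at h2
  linear_combination -√2 * h2

theorem IsContactForm.coframe_bracket :
    S.coframe θ X p (VectorField.mlieBracket (𝓡 3) (S.vecX X) (S.vecY X) p)
      = Complex.I * S.omegaZbar θ X p := by
  rw [omegaZbar]
  linear_combination (S.coframe θ X p
    (VectorField.mlieBracket (𝓡 3) (S.vecX X) (S.vecY X) p)) * Complex.I_mul_I

/-- With `fieldDiv_vecY` this yields div(τZ̄ + τ̄Z) = 2 Re(Z̄τ - ω(Z̄)τ), which matches the
divergence `div` of (1,0)-forms. -/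
theorem IsContactForm.fieldDiv_vecX :
    S.fieldDiv θ X (S.vecX X) p = -√2 * (S.omegaZbar θ X p).re := by
  have e : VectorField.mlieBracket (𝓡 3) (S.vecY X) (S.vecX X) p
      = -VectorField.mlieBracket (𝓡 3) (S.vecX X) (S.vecY X) p :=
    VectorField.mlieBracket_swap_apply
  have e1 : VectorField.mlieBracket (𝓡 3) (S.vecX X) (S.vecX X) p = 0 := by simp
  have e2 := θ.extDeriv_smul_left p 0 0 (S.vecY X p)
  rw [zero_smul, zero_mul] at e2
  rw [fieldDiv, e1, e, h.apply_bracket_reeb_vecX hX, e2, θ.extDeriv_neg_right,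
    h.extDeriv_vecX_eq hX, h.coframe_bracket hX]
  simp

theorem IsContactForm.fieldDiv_vecY :
    S.fieldDiv θ X (S.vecY X) p = -√2 * (S.omegaZbar θ X p).im := by
  have e1 : VectorField.mlieBracket (𝓡 3) (S.vecY X) (S.vecY X) p = 0 := by simp
  have e2 := θ.extDeriv_smul_right p 0 (S.vecX X p) 0
  rw [zero_smul, zero_mul] at e2
  rw [fieldDiv, e1, h.apply_bracket_reeb_vecY hX, e2,
    h.extDeriv_vecY_eq hX, h.coframe_bracket hX]
  simp

end CRStructure

end

/-! ### The divergence theorem inside one chart. -/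

section

variable {M : Type*} [TopologicalSpace M] [ChartedSpace R3 M] [IsManifold (𝓡 3) ∞ M]
  [CompactSpace M]

theorem isCompact_image_tsupport {f : M → ℝ} {c : M}
    (hf : tsupport f ⊆ (extChartAt (𝓡 3) c).source) :
    IsCompact (extChartAt (𝓡 3) c '' tsupport f) :=
  (isClosed_tsupport f).isCompact.image_of_continuousOn ((continuousOn_extChartAt c).mono hf)

theorem image_tsupport_subset {f : M → ℝ} {c : M}
    (hf : tsupport f ⊆ (extChartAt (𝓡 3) c).source) :
    extChartAt (𝓡 3) c '' tsupport f ⊆ (extChartAt (𝓡 3) c).target := by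
  rintro _ ⟨x, hx, rfl⟩
  exact (extChartAt (𝓡 3) c).map_source (hf hx)

theorem eq_zero_of_notMem_image {f : M → ℝ} {c : M} {y : R3}
    (hy : y ∈ (extChartAt (𝓡 3) c).target) (hy' : y ∉ extChartAt (𝓡 3) c '' tsupport f) :
    f ((extChartAt (𝓡 3) c).symm y) = 0 := by
  by_contra h
  exact hy' ⟨_, subset_tsupport f h, (extChartAt (𝓡 3) c).right_inv hy⟩

theorem fieldDeriv_eq_zero_of_notMem_tsupport (V : ∀ x : M, TangentSpace (𝓡 3) x) {g : M → ℝ} {x : M}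
    (hx : x ∉ tsupport g) : fieldDeriv V g x = 0 := by
  have : g =ᶠ[𝓝 x] fun _ => 0 := notMem_tsupport_iff_eventuallyEq.1 hx
  unfold fieldDeriv
  rw [this.mfderiv_eq, mfderiv_const]
  rfl

theorem fieldDeriv_sum (V : ∀ x : M, TangentSpace (𝓡 3) x) {ι : Type*} (I : Finset ι)
    {f : ι → M → ℝ} {x : M} (hf : ∀ i, MDifferentiableAt (𝓡 3) 𝓘(ℝ, ℝ) (f i) x) :
    fieldDeriv V (fun x => ∑ i ∈ I, f i x) x = ∑ i ∈ I, fieldDeriv V (f i) x := by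
  classical
  suffices key : MDifferentiableAt (𝓡 3) 𝓘(ℝ, ℝ) (fun x => ∑ i ∈ I, f i x) x ∧
      fieldDeriv V (fun x => ∑ i ∈ I, f i x) x = ∑ i ∈ I, fieldDeriv V (f i) x from key.2
  induction I using Finset.induction_on with
  | empty => exact ⟨mdifferentiableAt_const, CRStructure.fieldDeriv_zero_fun V 0 x⟩
  | insert i I hi ih =>
    simp only [Finset.sum_insert hi]
    refine ⟨(hf i).add ih.1, ?_⟩
    rw [← ih.2]
    exact congrArg (fun L => L (V x)) (mfderiv_add (hf i) ih.1)

namespace CRStructure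

variable {S : CRStructure M} {θ : OneForm M}

section
variable (h : S.IsContactForm θ)
include h

theorem IsContactForm.contDiffAt_abs_volumeCoeff {c : M} {y : R3}
    (hy : y ∈ (extChartAt (𝓡 3) c).target) :
    ContDiffAt ℝ ∞ (fun z => |θ.volumeCoeff c z|) y :=
  (h.smooth.contDiffAt_volumeCoeff hy).abs (h.volumeCoeff_ne_zero hy)

theorem IsContactForm.integrableOn_chart {f : M → ℝ} (hf : ContMDiff (𝓡 3) 𝓘(ℝ, ℝ) ∞ f) {c : M}
    (hs : tsupport f ⊆ (extChartAt (𝓡 3) c).source) :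
    MeasureTheory.IntegrableOn
      (fun y => f ((extChartAt (𝓡 3) c).symm y) * |θ.volumeCoeff c y|)
      (extChartAt (𝓡 3) c).target := by
  have ho : IsOpen (extChartAt (𝓡 3) c).target := isOpen_extChartAt_target c
  rw [← MeasureTheory.integrable_indicator_iff ho.measurableSet]
  obtain ⟨h1, h2⟩ := contDiff_indicator_of_isCompact (n := ∞) ho (isCompact_image_tsupport hs)
    (image_tsupport_subset hs)
    (fun y hy => (ContMDiffAt.contDiffAt_comp_extChartAt_symm hy (hf _)).mul
      (h.contDiffAt_abs_volumeCoeff hy))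
    (fun y hy hy' => mul_eq_zero_of_left (eq_zero_of_notMem_image hy hy') _)
  exact h1.continuous.integrable_of_hasCompactSupport h2

theorem IsContactForm.chartIntegral_add {f g : M → ℝ} (hf : ContMDiff (𝓡 3) 𝓘(ℝ, ℝ) ∞ f)
    (hg : ContMDiff (𝓡 3) 𝓘(ℝ, ℝ) ∞ g) {c : M}
    (hfs : tsupport f ⊆ (extChartAt (𝓡 3) c).source)
    (hgs : tsupport g ⊆ (extChartAt (𝓡 3) c).source) :
    θ.chartIntegral c (fun x => f x + g x) = θ.chartIntegral c f + θ.chartIntegral c g := by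
  unfold OneForm.chartIntegral
  rw [← MeasureTheory.integral_add (h.integrableOn_chart hf hfs) (h.integrableOn_chart hg hgs)]
  simp only [add_mul]

theorem IsContactForm.chartIntegral_sum {ι : Type*} (I : Finset ι) {f : ι → M → ℝ}
    (hf : ∀ i ∈ I, ContMDiff (𝓡 3) 𝓘(ℝ, ℝ) ∞ (f i)) {c : M}
    (hfs : ∀ i ∈ I, tsupport (f i) ⊆ (extChartAt (𝓡 3) c).source) :
    θ.chartIntegral c (fun x => ∑ i ∈ I, f i x) = ∑ i ∈ I, θ.chartIntegral c (f i) := by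
  unfold OneForm.chartIntegral
  rw [← MeasureTheory.integral_finsetSum I fun i hi => h.integrableOn_chart (hf i hi) (hfs i hi)]
  simp only [Finset.sum_mul]

/-- The divergence theorem for a vector field supported in a chart. -/
theorem IsContactForm.chartIntegral_fieldDiv {V : ∀ x : M, TangentSpace (𝓡 3) x}
    (hV : ∀ x, SmoothFieldAt V x) {c : M} {g : M → ℝ}
    (hg : tsupport g ⊆ (extChartAt (𝓡 3) c).source) (hVg : ∀ x, g x = 0 → V x = 0) {F : M → ℝ}
    (hF : ∀ x, F x = S.fieldDiv θ (S.frameAt θ x) V x) :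
    θ.chartIntegral c F = 0 := by
  have ho : IsOpen (extChartAt (𝓡 3) c).target := isOpen_extChartAt_target c
  have hφ : ∀ y ∈ (extChartAt (𝓡 3) c).target,
      ContDiffAt ℝ 1 (fun y => |θ.volumeCoeff c y| • chartField c V y) y := fun y hy =>
    ((h.contDiffAt_abs_volumeCoeff hy).smul (contDiffAt_chartField hy (hV _))).of_le (by simp)
  have h0 : ∀ y ∈ (extChartAt (𝓡 3) c).target, y ∉ extChartAt (𝓡 3) c '' tsupport g →
      |θ.volumeCoeff c y| • chartField c V y = 0 := fun y hy hy' => by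
    unfold chartField
    rw [VectorField.mpullback_apply, hVg _ (eq_zero_of_notMem_image hy hy')]
    exact (congrArg _ (map_zero _)).trans (smul_zero _)
  obtain ⟨h1, h2⟩ := contDiff_indicator_of_isCompact ho (isCompact_image_tsupport hg)
    (image_tsupport_subset hg) hφ h0
  have h3 := integral_diverg_eq_zero h1 h2
  -- Off the target, the extension by zero vanishes in a neighbourhood, so its divergence does too
  -- and the integral may be taken over the whole space.
  have h4 : ∀ y ∉ (extChartAt (𝓡 3) c).target, diverg ((extChartAt (𝓡 3) c).target.indicator
      fun y => |θ.volumeCoeff c y| • chartField c V y) y = 0 := fun y hy => by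
    have : (extChartAt (𝓡 3) c).target.indicator
        (fun y => |θ.volumeCoeff c y| • chartField c V y) =ᶠ[𝓝 y] fun _ => 0 := by
      filter_upwards [(isCompact_image_tsupport hg).isClosed.isOpen_compl.mem_nhds
        fun h => hy (image_tsupport_subset hg h)] with z hz
      by_cases hzt : z ∈ (extChartAt (𝓡 3) c).target
      · rw [Set.indicator_of_mem hzt, h0 z hzt hz]
      · exact Set.indicator_of_notMem hzt _
    unfold diverg
    rw [this.fderiv_eq]
    simp
  rw [← MeasureTheory.setIntegral_eq_integral_of_forall_compl_eq_zero h4] at h3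
  rw [← h3]
  refine MeasureTheory.setIntegral_congr_fun ho.measurableSet fun y hy => ?_
  have h5 : diverg ((extChartAt (𝓡 3) c).target.indicator
      fun y => |θ.volumeCoeff c y| • chartField c V y) y
      = diverg (fun y => |θ.volumeCoeff c y| • chartField c V y) y := by
    have : (extChartAt (𝓡 3) c).target.indicator
        (fun y => |θ.volumeCoeff c y| • chartField c V y) =ᶠ[𝓝 y]
        fun y => |θ.volumeCoeff c y| • chartField c V y := by
      filter_upwards [ho.mem_nhds hy] with z hz using Set.indicator_of_mem hz _
    unfold diverg
    rw [this.fderiv_eq]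
  rw [h5, h.diverg_chartField hy (h.isUnitaryFrame_frameAt _) (Filter.Eventually.of_forall hV), hF,
    mul_comm]

/-- Integration by parts in a chart. -/
theorem IsContactForm.chartIntegral_mul_fieldDiv {V : ∀ x : M, TangentSpace (𝓡 3) x}
    (hV : ∀ x, SmoothFieldAt V x) {F : M → ℝ} (hFs : ContMDiff (𝓡 3) 𝓘(ℝ, ℝ) ∞ F)
    (hF : ∀ x, F x = S.fieldDiv θ (S.frameAt θ x) V x) {c : M} {g : M → ℝ}
    (hgs : ContMDiff (𝓡 3) 𝓘(ℝ, ℝ) ∞ g) (hg : tsupport g ⊆ (extChartAt (𝓡 3) c).source) :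
    θ.chartIntegral c (fun x => g x * F x) = -θ.chartIntegral c (fieldDeriv V g) := by
  -- Divergence theorem for gV, whose divergence is g div V + V g.
  have h1 := h.chartIntegral_fieldDiv (V := fun x => g x • V x)
    (fun x => (hgs x).smul_section (hV x)) hg (fun x hx => by simp [hx])
    (F := fun x => g x * F x + fieldDeriv V g x) (fun x => by
      rw [h.fieldDiv_smul (h.isUnitaryFrame_frameAt x) (Filter.Eventually.of_forall hgs) (Filter.Eventually.of_forall hV),
        hF])
  rw [h.chartIntegral_add (f := fun x => g x * F x) (g := fieldDeriv V g) (hgs.mul hFs) (fun x => (hgs x).fieldDeriv (hV x))] at h1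
  · linarith
  · exact (closure_mono (Function.support_mul_subset_left g F)).trans hg
  · refine (closure_minimal ?_ (isClosed_tsupport g)).trans hg
    intro x hx
    by_contra hxg
    exact hx (fieldDeriv_eq_zero_of_notMem_tsupport V hxg)

end

end CRStructure

end

/-! ### The integral over M and the global divergence theorem. -/

section

variable {M : Type*} [TopologicalSpace M] [ChartedSpace R3 M] [IsManifold (𝓡 3) ∞ M]

/-- The term containing dσ ∧ θ disappears when wedged with θ, leaving the square of e^σ. -/
theorem OneForm.volumeCoeff_expSmul {θ : OneForm M} (hθ : θ.IsSmooth) {σ : M → ℝ}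
    (hσ : ContMDiff (𝓡 3) 𝓘(ℝ, ℝ) ∞ σ) {c : M} {y : R3} (hy : y ∈ (extChartAt (𝓡 3) c).target) :
    (OneForm.expSmul σ θ).volumeCoeff c y
      = Real.exp (2 * σ ((extChartAt (𝓡 3) c).symm y)) * θ.volumeCoeff c y := by
  have h1 : DifferentiableAt ℝ (fun z => Real.exp (σ ((extChartAt (𝓡 3) c).symm z))) y :=
    ((ContMDiffAt.contDiffAt_comp_extChartAt_symm hy (hσ _)).differentiableAt (by simp)).exp
  have h2 := (hθ.contDiffAt_inChart hy).differentiableAt (by simp)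
  have h3 : (OneForm.expSmul σ θ).inChart c
      = fun z => Real.exp (σ ((extChartAt (𝓡 3) c).symm z)) • θ.inChart c z := rfl
  have h4 : ∀ u v : R3, fderiv ℝ ((OneForm.expSmul σ θ).inChart c) y u v
      = Real.exp (σ ((extChartAt (𝓡 3) c).symm y)) * fderiv ℝ (θ.inChart c) y u v
        + fderiv ℝ (fun z => Real.exp (σ ((extChartAt (𝓡 3) c).symm z))) y u * θ.inChart c y v :=
    fun u v => by
      rw [h3, fderiv_fun_smul h1 h2]
      rfl
  have h5 : ∀ u : R3, (OneForm.expSmul σ θ).inChart c y u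
      = Real.exp (σ ((extChartAt (𝓡 3) c).symm y)) * θ.inChart c y u := fun u => rfl
  unfold OneForm.volumeCoeff OneForm.extDerivInChart
  simp only [h4, h5]
  rw [two_mul, Real.exp_add]
  ring

variable [T2Space M] [CompactSpace M]

/-- Compactness makes the index set finite. The same finite partition serves every θ and f, which
allows integrals to be compared term by term. -/
theorem exists_contactIntegral_eq_sum (M : Type*) [TopologicalSpace M] [ChartedSpace R3 M]
    [IsManifold (𝓡 3) ∞ M] [T2Space M] [CompactSpace M] :
    ∃ (I : Finset M) (ρ : M → M → ℝ), (∀ c, ContMDiff (𝓡 3) 𝓘(ℝ, ℝ) ∞ (ρ c)) ∧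
      (∀ c, tsupport (ρ c) ⊆ (extChartAt (𝓡 3) c).source) ∧ (∀ x, ∑ c ∈ I, ρ c x = 1) ∧
      ∀ (θ : OneForm M) (f : M → ℝ),
        θ.contactIntegral f = ∑ c ∈ I, θ.chartIntegral c fun x => ρ c x * f x := by
  let P := SmoothPartitionOfUnity.exists_isSubordinate_chartAt_source (𝓡 3) M
  have hfin := P.choose.locallyFinite.finite_nonempty_of_compact
  have hI : ∀ c, c ∉ hfin.toFinset → ∀ x, P.choose c x = 0 := fun c hc x => by
    by_contra h
    exact hc (hfin.mem_toFinset.2 ⟨x, h⟩)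
  refine ⟨hfin.toFinset, fun c => P.choose c, fun c => (P.choose c).contMDiff, fun c => ?_,
    fun x => ?_, fun θ f => ?_⟩
  · rw [extChartAt_source]
    exact P.choose_spec c
  · rw [← P.choose.sum_eq_one (Set.mem_univ x)]
    refine (finsum_eq_sum_of_support_subset _ fun c hc => ?_).symm
    by_contra h
    exact hc (hI c h x)
  · refine finsum_eq_sum_of_support_subset _ fun c hc => ?_
    by_contra h
    refine hc ?_
    have h0 := hI c h
    have : ∀ y : R3, P.choose c ((extChartAt (𝓡 3) c).symm y) * f ((extChartAt (𝓡 3) c).symm y)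
        * |θ.volumeCoeff c y| = 0 := fun y => by rw [h0]; ring
    exact (MeasureTheory.integral_congr_ae (Filter.Eventually.of_forall this)).trans
      (MeasureTheory.integral_zero _ _)

theorem OneForm.contactIntegral_expSmul {θ : OneForm M} (hθ : θ.IsSmooth) {σ : M → ℝ}
    (hσ : ContMDiff (𝓡 3) 𝓘(ℝ, ℝ) ∞ σ) (f : M → ℝ) :
    (OneForm.expSmul σ θ).contactIntegral f
      = θ.contactIntegral fun x => Real.exp (2 * σ x) * f x := by
  obtain ⟨I, ρ, -, -, -, h⟩ := exists_contactIntegral_eq_sum M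
  rw [h, h]
  refine Finset.sum_congr rfl fun c _ => ?_
  refine MeasureTheory.setIntegral_congr_fun (isOpen_extChartAt_target c).measurableSet
    fun y hy => ?_
  beta_reduce
  rw [OneForm.volumeCoeff_expSmul hθ hσ hy, abs_mul, abs_of_pos (Real.exp_pos _)]
  ring

namespace CRStructure

variable {S : CRStructure M} {θ : OneForm M}

theorem IsContactForm.contactIntegral_add (h : S.IsContactForm θ) {f g : M → ℝ}
    (hf : ContMDiff (𝓡 3) 𝓘(ℝ, ℝ) ∞ f) (hg : ContMDiff (𝓡 3) 𝓘(ℝ, ℝ) ∞ g) :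
    θ.contactIntegral (fun x => f x + g x) = θ.contactIntegral f + θ.contactIntegral g := by
  obtain ⟨I, ρ, hρ, hs, -, hint⟩ := exists_contactIntegral_eq_sum M
  rw [hint, hint, hint, ← Finset.sum_add_distrib]
  refine Finset.sum_congr rfl fun c _ => ?_
  simp only [mul_add]
  exact h.chartIntegral_add ((hρ c).mul hf) ((hρ c).mul hg)
    ((closure_mono (Function.support_mul_subset_left (ρ c) f)).trans (hs c))
    ((closure_mono (Function.support_mul_subset_left (ρ c) g)).trans (hs c))

/-- The divergence theorem for the volume form `θ ∧ dθ`. -/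
theorem IsContactForm.contactIntegral_fieldDiv (h : S.IsContactForm θ)
    {V : ∀ x : M, TangentSpace (𝓡 3) x} (hV : ∀ x, SmoothFieldAt V x) {F : M → ℝ}
    (hFs : ContMDiff (𝓡 3) 𝓘(ℝ, ℝ) ∞ F)
    (hF : ∀ x, F x = S.fieldDiv θ (S.frameAt θ x) V x) :
    θ.contactIntegral F = 0 := by
  obtain ⟨I, ρ, hρ, hs, hsum, hint⟩ := exists_contactIntegral_eq_sum M
  have hd : ∀ c, ContMDiff (𝓡 3) 𝓘(ℝ, ℝ) ∞ (fieldDeriv V (ρ c)) := fun c x =>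
    (hρ c x).fieldDeriv (hV x)
  have hsd : ∀ c c', tsupport (fun x => ρ c' x * fieldDeriv V (ρ c) x)
      ⊆ (extChartAt (𝓡 3) c').source := fun c c' =>
    (closure_mono (Function.support_mul_subset_left _ _)).trans (hs c')
  have h0 : ∀ c x, fieldDeriv V (ρ c) x ≠ 0 → x ∈ (extChartAt (𝓡 3) c).source := by
    intro c x hx
    by_contra hxs
    exact hx (fieldDeriv_eq_zero_of_notMem_tsupport V fun hx' => hxs (hs c hx'))
  -- After integrating by parts, V ρ_c = Σ ρ_{c'} V ρ_c is inserted, and each piece is moved to the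
  -- chart of c', where the sum over c can be formed under the integral.
  have h1 : ∀ c, θ.chartIntegral c (fun x => ρ c x * F x)
      = -∑ c' ∈ I, θ.chartIntegral c' (fun x => ρ c' x * fieldDeriv V (ρ c) x) := fun c => by
    rw [h.chartIntegral_mul_fieldDiv hV hFs hF (hρ c) (hs c)]
    congr 1
    have : fieldDeriv V (ρ c) = fun x => ∑ c' ∈ I, ρ c' x * fieldDeriv V (ρ c) x := by
      funext x
      rw [← Finset.sum_mul, hsum, one_mul]
    conv_lhs => rw [this]
    rw [h.chartIntegral_sum (f := fun c' x => ρ c' x * fieldDeriv V (ρ c) x) I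
      fun c' _ => (hρ c').mul (hd c)]
    · refine Finset.sum_congr rfl fun c' _ => h.smooth.chartIntegral_eq
        (fun x hx => h0 c x (right_ne_zero_of_mul hx))
        fun x hx => hs c' (subset_tsupport _ (left_ne_zero_of_mul hx))
    · intro c' _
      refine (closure_minimal (fun x hx => ?_) (isClosed_tsupport (ρ c))).trans (hs c)
      by_contra hxs
      exact right_ne_zero_of_mul hx (fieldDeriv_eq_zero_of_notMem_tsupport V hxs)
  rw [hint, Finset.sum_congr rfl fun c _ => h1 c, Finset.sum_neg_distrib, neg_eq_zero,
    Finset.sum_comm]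
  refine Finset.sum_eq_zero fun c' _ => ?_
  rw [← h.chartIntegral_sum (f := fun c x => ρ c' x * fieldDeriv V (ρ c) x) I (fun c _ => (hρ c').mul (hd c)) (fun c _ => hsd c c')]
  -- The derivative of Σ ρ_c = 1.
  have h2 : ∀ x, ∑ c ∈ I, fieldDeriv V (ρ c) x = 0 := fun x => by
    rw [← fieldDeriv_sum V I fun c => (hρ c x).mdifferentiableAt (by simp)]
    simp only [hsum]
    exact fieldDeriv_zero_fun V 1 x
  unfold OneForm.chartIntegral
  simp only [← Finset.mul_sum, h2, mul_zero, zero_mul]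
  exact MeasureTheory.integral_zero _ _

end CRStructure

end

/-! ### The global vector field with divergence 2 P'σ + P(σ²). -/

section

variable {M : Type*} [TopologicalSpace M] [ChartedSpace R3 M]

theorem fieldDeriv_clm {V : ∀ x : M, TangentSpace (𝓡 3) x} {f : M → ℂ} {p : M} (L : ℂ →L[ℝ] ℝ)
    (hf : MDifferentiableAt (𝓡 3) 𝓘(ℝ, ℂ) f p) :
    fieldDeriv V (fun x => L (f x)) p = L (vectorDeriv V f p) :=
  DFunLike.congr_fun
    (HasMFDerivAt.comp p (L.hasMFDerivAt (x := f p)) hf.hasMFDerivAt).mfderiv (V p)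

theorem smoothGerm.numeral_mul_mk {f : M → ℂ} {p : M} (hf : SmoothNear f p) (n : ℕ) [n.AtLeastTwo] :
    (ofNat(n) : smoothGerm p) * smoothGerm.mk f hf
      = smoothGerm.mk (fun x => ofNat(n) * f x) ((SmoothNear.const _).mul hf) := rfl

variable [IsManifold (𝓡 3) ∞ M]

namespace CRStructure

/-- The `(1,0)`-form whose real divergence is `2 P'₄ σ + P₄ (σ²) - T² (σ²)`. -/
noncomputable def fluxIn (S : CRStructure M) (θ : OneForm M) (X : ∀ x, S.H x) (σ : M → ℝ) (x : M) :
    ℂ :=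
  -S.dZ X (fun y => 8 * S.subLap θ X (fun z => (σ z : ℂ)) y
      + S.subLap θ X (fun z => ((σ z ^ 2 : ℝ) : ℂ)) y) x
    + 2 * Complex.I * S.torsion θ X x
      * S.dZbar X (fun y => 4 * (σ y : ℂ) + ((σ y ^ 2 : ℝ) : ℂ)) x
    - 4 * S.scalarCurv θ X x * S.dZ X (fun y => (σ y : ℂ)) x

/-- The vector field whose divergence is `2 P'₄ σ + P₄ (σ²)`, computed in a unitary frame. -/
noncomputable def fluxFieldIn (S : CRStructure M) (θ : OneForm M) (X : ∀ x, S.H x) (σ : M → ℝ)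
    (x : M) : TangentSpace (𝓡 3) x :=
  (dT θ (fun y => ((σ y ^ 2 : ℝ) : ℂ)) x).re • reeb θ x
    + ((√2 * (S.fluxIn θ X σ x).re) • S.vecX X x + (-√2 * (S.fluxIn θ X σ x).im) • S.vecY X x)

variable {S : CRStructure M} {θ : OneForm M} {X X' : ∀ x, S.H x} {p : M} {σ : M → ℝ}

variable (h : S.IsContactForm θ) (hX : S.IsUnitaryFrame θ X p) (hσ : SmoothNear σ p)

theorem SmoothNear.ofReal_sq (hσ : SmoothNear σ p) :
    SmoothNear (fun x => ((σ x ^ 2 : ℝ) : ℂ)) p :=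
  (hσ.contDiff_comp (contDiff_id.pow 2)).ofReal

include h hX hσ in
theorem IsContactForm.smooth_fluxIn : SmoothNear (S.fluxIn θ X σ) p :=
  ((hX.smooth_dZ (((SmoothNear.const 8).mul (h.smooth_subLap hX hσ.ofReal)).add
      (h.smooth_subLap hX (SmoothNear.ofReal_sq hσ)))).neg.add
    (((SmoothNear.const _).mul (h.smooth_torsion hX)).mul (hX.smooth_dZbar
      (((SmoothNear.const 4).mul hσ.ofReal).add (SmoothNear.ofReal_sq hσ))))).sub
    (((SmoothNear.const 4).mul (h.smooth_ofReal_scalarCurv hX)).mul (hX.smooth_dZ hσ.ofReal))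

theorem IsContactForm.webster_flux : (h.webster hX).flux (smoothGerm.mk _ hσ.ofReal)
    = smoothGerm.mk (S.fluxIn θ X σ) (h.smooth_fluxIn hX hσ) := by
  rw [WebsterAlgebra.flux, germ_ofReal_sq hσ, h.webster_lap, h.webster_lap, h.webster_R,
    show (h.webster hX).A = smoothGerm.mk _ (h.smooth_torsion hX) from rfl, h.webster_Z_mk,
    smoothGerm.numeral_mul_mk, smoothGerm.numeral_mul_mk hσ.ofReal, smoothGerm.mk_add, smoothGerm.mk_add,
    h.webster_Z_mk, h.webster_Zb_mk]
  rfl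

include h hX hσ in
theorem IsContactForm.fluxIn_eq (hX' : S.IsUnitaryFrame θ X' p) :
    S.fluxIn θ X' σ p = S.frameFactor θ X X' p * S.fluxIn θ X σ p := by
  obtain ⟨C, hC, hg⟩ := h.exists_frameChange hX hX'
  have h1 := C.flux'_eq hC (smoothGerm.mk _ hσ.ofReal)
  rw [hg, h.webster_flux hX' hσ, h.webster_flux hX hσ, smoothGerm.mk_mul] at h1
  exact ((smoothGerm.mk_eq_mk).1 h1).self_of_nhds

include h hX in
theorem IsContactForm.normSq_frameFactor (hX' : S.IsUnitaryFrame θ X' p) :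
    (S.frameFactor θ X X' p).re ^ 2 + (S.frameFactor θ X X' p).im ^ 2 = 1 := by
  have h1 := h.frameFactor_mul_conj (σ := fun _ => 0) (X' := X') (by rwa [expSmul_zero]) hX
    (by rwa [expSmul_zero])
  rw [Complex.mul_conj, Complex.ofReal_inj, Complex.normSq_apply, neg_zero, Real.exp_zero] at h1
  linarith

include h hX hσ in
-- The horizontal part is τZ̄ + τ̄Z. With τ' = gτ and Z' = gZ it acquires the factor |g|² = 1.
theorem IsContactForm.fluxFieldIn_eq (hX' : S.IsUnitaryFrame θ X' p) :
    S.fluxFieldIn θ X' σ p = S.fluxFieldIn θ X σ p := by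
  have h1 := h.normSq_frameFactor hX hX'
  rw [fluxFieldIn, fluxFieldIn, h.fluxIn_eq hX hσ hX', vecX_eq hX X', vecY_eq hX X', Complex.mul_re,
    Complex.mul_im]
  generalize (S.frameFactor θ X X' p).re = a at *
  generalize (S.frameFactor θ X X' p).im = b at *
  generalize (S.fluxIn θ X σ p).re = r
  generalize (S.fluxIn θ X σ p).im = s
  congr 1
  have e : ∀ v w : TangentSpace (𝓡 3) p,
      (√2 * (a * r - b * s)) • (a • v + b • w) + (-√2 * (a * s + b * r)) • (a • w - b • v)
        = (a ^ 2 + b ^ 2) • ((√2 * r) • v + (-√2 * s) • w) := fun v w => by module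
  rw [e, h1, one_smul]

include h hX hσ in
theorem IsContactForm.smooth_fluxFieldIn : SmoothFieldNear (S.fluxFieldIn θ X σ) p := by
  have hτ := h.smooth_fluxIn hX hσ
  have h1 := SmoothFieldNear.smul (h.smooth_dT hX (SmoothNear.ofReal_sq hσ)).re (h.smooth_reeb hX)
  have h2 := SmoothFieldNear.smul ((SmoothNear.const √2).mul hτ.re) hX.smooth_vecX
  have h3 := SmoothFieldNear.smul
    ((SmoothNear.const (-√2)).mul (hτ.contDiff_comp Complex.imCLM.contDiff)) hX.smooth_vecY
  filter_upwards [h1, h2, h3] with q a b c using a.add_section (b.add_section c)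

include h hX hσ in
-- Leibniz rule on each summand, with the known divergences of T, X, JX; T contributes only its
-- derivative of the coefficient T(σ²).
theorem IsContactForm.fieldDiv_fluxFieldIn : S.fieldDiv θ X (S.fluxFieldIn θ X σ) p
    = (dT θ (dT θ (fun y => ((σ y ^ 2 : ℝ) : ℂ))) p).re
      + 2 * (S.div θ X (S.fluxIn θ X σ) p).re := by
  have hτ := h.smooth_fluxIn hX hσ
  have hα := h.smooth_dT hX (SmoothNear.ofReal_sq hσ)
  have hb : SmoothNear (fun x => √2 * (S.fluxIn θ X σ x).re) p := (SmoothNear.const √2).mul hτ.re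
  have hc : SmoothNear (fun x => -√2 * (S.fluxIn θ X σ x).im) p :=
    (SmoothNear.const (-√2)).mul (hτ.contDiff_comp Complex.imCLM.contDiff)
  have h1 := SmoothFieldNear.smul hα.re (h.smooth_reeb hX)
  have h2 := SmoothFieldNear.smul hb hX.smooth_vecX
  have h3 := SmoothFieldNear.smul hc hX.smooth_vecY
  have e1 : fieldDeriv (reeb θ) (fun x => (dT θ (fun y => ((σ y ^ 2 : ℝ) : ℂ)) x).re) p
      = (dT θ (dT θ (fun y => ((σ y ^ 2 : ℝ) : ℂ))) p).re :=
    fieldDeriv_clm Complex.reCLM hα.mdifferentiableAt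
  have e2 : fieldDeriv (S.vecX X) (fun x => √2 * (S.fluxIn θ X σ x).re) p
      = √2 * (vectorDeriv (S.vecX X) (S.fluxIn θ X σ) p).re :=
    fieldDeriv_clm (√2 • Complex.reCLM) hτ.mdifferentiableAt
  have e3 : fieldDeriv (S.vecY X) (fun x => -√2 * (S.fluxIn θ X σ x).im) p
      = -√2 * (vectorDeriv (S.vecY X) (S.fluxIn θ X σ) p).im :=
    fieldDeriv_clm (-√2 • Complex.imCLM) hτ.mdifferentiableAt
  have e4 : S.fieldDiv θ X (S.fluxFieldIn θ X σ) p = _ :=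
    (fieldDiv_add h1 (by filter_upwards [h2, h3] with q b c using b.add_section c)).trans
      (congrArg (_ + ·) (fieldDiv_add h2 h3))
  rw [e4, h.fieldDiv_smul hX hα.re (h.smooth_reeb hX), h.fieldDiv_smul hX hb hX.smooth_vecX,
    h.fieldDiv_smul hX hc hX.smooth_vecY, h.fieldDiv_reeb hX, h.fieldDiv_vecX hX,
    h.fieldDiv_vecY hX, e1, e2, e3, div, dZbar]
  have h4 : √2 * √2 = 2 := Real.mul_self_sqrt (by norm_num)
  have h5 : (2 : ℝ) / √2 = √2 := by rw [div_eq_iff (by positivity), h4]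
  simp only [Complex.sub_re, Complex.mul_re, Complex.div_ofReal_re, Complex.add_re, Complex.I_re,
    Complex.I_im]
  linear_combination (-(S.fluxIn θ X σ p).re * (S.omegaZbar θ X p).re
    + (S.fluxIn θ X σ p).im * (S.omegaZbar θ X p).im) * h4
    - ((vectorDeriv (S.vecX X) (S.fluxIn θ X σ) p).re
      - (vectorDeriv (S.vecY X) (S.fluxIn θ X σ) p).im) * h5

include h in
theorem IsContactForm.two_mul_pPrime_add_paneitz (hW : S.IsPseudoEinstein θ) (hσ : SmoothNear σ p) :
    2 * S.pPrime θ σ p + S.paneitz θ (fun x => σ x ^ 2) p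
      = S.fieldDiv θ (S.frameAt θ p) (S.fluxFieldIn θ (S.frameAt θ p) σ) p := by
  have hX := h.isUnitaryFrame_frameAt p
  have hc := h.webster_conjugation hX
  rw [h.fieldDiv_fluxFieldIn hX hσ]
  have h1 := congrArg (smoothGerm.eval p)
    ((h.webster hX).two_mul_pPrime_add_paneitz (smoothGerm.mk _ hσ.ofReal))
  have h2 : (h.webster hX).fluxb (smoothGerm.mk _ hσ.ofReal)
      = smoothGerm.conjHom p ((h.webster hX).flux (smoothGerm.mk _ hσ.ofReal)) := by
    rw [hc.map_flux, smoothGerm.conj_mk_ofReal hσ.ofReal]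
  rw [h2, ← hc.map_div, germ_ofReal_sq hσ, h.webster_flux hX hσ, h.webster_div, h.webster_T_mk,
    h.webster_T_mk] at h1
  simp only [map_add, map_mul, map_ofNat, h.eval_webster_pPrime hX (h.webster_W_eq_zero hX hW),
    h.eval_webster_paneitz, smoothGerm.eval_conjHom, smoothGerm.eval_mk] at h1
  have h3 := congrArg Complex.re h1
  simp only [Complex.add_re, Complex.mul_re, Complex.conj_re, Complex.ofReal_re, Complex.ofReal_im,
    Complex.re_ofNat, Complex.im_ofNat] at h3
  unfold pPrime paneitz
  linarith

/-- The vector field whose divergence is `2 P'₄ σ + P₄ (σ²)`. -/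
noncomputable def fluxField (S : CRStructure M) (θ : OneForm M) (σ : M → ℝ) (x : M) :
    TangentSpace (𝓡 3) x :=
  S.fluxFieldIn θ (S.frameAt θ x) σ x

include h hX hσ in
-- Frame independence lets one fixed smooth frame replace the frames chosen separately at each
-- point, which gives smoothness and locality of the divergence.
theorem IsContactForm.fluxField_eventuallyEq :
    ∀ᶠ q in 𝓝 p, S.fluxField θ σ q = S.fluxFieldIn θ X σ q := by
  filter_upwards [hX.eventually, hσ.eventually_nhds] with q h1 h2 using
    h.fluxFieldIn_eq h1 h2 (h.isUnitaryFrame_frameAt q)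

end CRStructure

end

/-! ### Comparison of two contact forms and invariance of the total Q'. -/

section

namespace CRStructure

variable {M : Type*} [TopologicalSpace M] [ChartedSpace R3 M] [IsManifold (𝓡 3) ∞ M]
  {S : CRStructure M} {θ θ' : OneForm M}

/-- Both forms have kernel H, so each vector may be replaced by its Reeb component. -/
theorem IsContactForm.apply_eq_mul (h : S.IsContactForm θ) (h' : S.IsContactForm θ') (x : M)
    (v : TangentSpace (𝓡 3) x) : θ' x v = θ' x (reeb θ x) * θ x v := by
  have h1 : θ x (v - θ x v • reeb θ x) = 0 := by
    rw [map_sub, map_smul, h.apply_reeb (h.isUnitaryFrame_frameAt x), smul_eq_mul, mul_one, sub_self]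
  rw [h.ker_eq, ← h'.ker_eq, map_sub, map_smul, smul_eq_mul] at h1
  linear_combination h1

/-- The ratio θ'(T) equals dθ'(X, JX) = -θ'([X, JX]) in a frame unitary for θ, and positivity of dθ'
on H decides its sign. -/
theorem IsContactForm.apply_reeb_pos (h : S.IsContactForm θ) (h' : S.IsContactForm θ') (p : M) :
    0 < θ' p (reeb θ p) := by
  have hX := h.isUnitaryFrame_frameAt p
  have h1 := h'.smooth.extDeriv_eq hX.smooth_vecX hX.smooth_vecY
  simp only [h'.apply_vecX, h'.apply_vecY, fieldDeriv_zero_fun] at h1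
  rw [h.apply_eq_mul h', h.apply_bracket_vecX_vecY hX] at h1
  have h2 := h'.pos p (S.frameAt θ p p) fun h0 => by
    have h3 := θ.extDeriv_smul_left p 0 0 (S.vecY (S.frameAt θ p) p)
    rw [zero_smul, zero_mul] at h3
    have h4 := hX.extDeriv_eq
    rw [vecX, h0] at h4
    exact zero_ne_one (h3.symm.trans h4)
  have h5 : θ'.extDeriv p (S.vecX (S.frameAt θ p) p) (S.vecY (S.frameAt θ p) p)
      = θ' p (reeb θ p) := by linarith
  exact h5 ▸ h2

theorem IsContactForm.exists_eq_expSmul (h : S.IsContactForm θ) (h' : S.IsContactForm θ') :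
    ∃ σ : M → ℝ, ContMDiff (𝓡 3) 𝓘(ℝ, ℝ) ∞ σ ∧ θ' = OneForm.expSmul σ θ := by
  refine ⟨fun x => Real.log (θ' x (reeb θ x)), fun p => ?_, ?_⟩
  · have h1 : ContMDiffAt (𝓡 3) 𝓘(ℝ, ℝ) ∞ (fun x => θ' x (reeb θ x)) p :=
      (h'.smooth.smoothNear_apply (h.smooth_reeb (h.isUnitaryFrame_frameAt p))).self_of_nhds
    exact ContDiffAt.comp_contMDiffAt (f := fun x => θ' x (reeb θ x))
      (Real.contDiffAt_log.2 (h.apply_reeb_pos h' p).ne') h1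
  · funext x
    ext v
    rw [expSmul_apply, Real.exp_log (h.apply_reeb_pos h' x)]
    exact h.apply_eq_mul h' x v

theorem IsContactForm.contactIntegral_qPrime_expSmul [T2Space M] [CompactSpace M]
    (h : S.IsContactForm θ) {σ : M → ℝ} (hσ : ContMDiff (𝓡 3) 𝓘(ℝ, ℝ) ∞ σ)
    (hW : S.IsPseudoEinstein θ) (hW' : S.IsPseudoEinstein (OneForm.expSmul σ θ)) :
    (OneForm.expSmul σ θ).contactIntegral (S.qPrime (OneForm.expSmul σ θ))
      = θ.contactIntegral (S.qPrime θ) := by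
  have h' := h.expSmul hσ
  have hs : ∀ p, SmoothNear σ p := fun p => Filter.Eventually.of_forall hσ
  let Q' : M → ℝ := fun x => Real.exp (2 * σ x) * S.qPrime (OneForm.expSmul σ θ) x
  let F : M → ℝ := fun x => 2 * S.pPrime θ σ x + S.paneitz θ (fun x => σ x ^ 2) x
  have hQ : ContMDiff (𝓡 3) 𝓘(ℝ, ℝ) ∞ (S.qPrime θ) := h.contMDiff_qPrime
  have hQ' : ContMDiff (𝓡 3) 𝓘(ℝ, ℝ) ∞ Q' :=
    (((contDiff_const.mul contDiff_id).exp.comp_contMDiff hσ)).mul h'.contMDiff_qPrime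
  have e : ∀ x, F x = (Q' x + Q' x) - (S.qPrime θ x + S.qPrime θ x) := fun x => by
    simp only [F, Q', h.qPrime_expSmul h' (hs x) hW hW']
    ring
  -- Smoothness of 2P'σ + P(σ²) is inherited from both Q'-curvatures through the transformation law.
  have hF : ContMDiff (𝓡 3) 𝓘(ℝ, ℝ) ∞ F := by
    rw [funext e]
    exact (hQ'.add hQ').sub (hQ.add hQ)
  have h0 : θ.contactIntegral F = 0 := by
    refine h.contactIntegral_fieldDiv (V := S.fluxField θ σ) (fun p => ?_) hF fun p => ?_
    · have hX := h.isUnitaryFrame_frameAt p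
      refine (h.smooth_fluxFieldIn hX (hs p)).self_of_nhds.congr_of_eventuallyEq ?_
      filter_upwards [h.fluxField_eventuallyEq hX (hs p)] with q hq
      rw [hq]
    · rw [fieldDiv_congr (h.fluxField_eventuallyEq (h.isUnitaryFrame_frameAt p) (hs p))]
      exact h.two_mul_pPrime_add_paneitz hW (hs p)
  -- The factor 2 is written as a sum, so that additivity of the integral is the only linearity
  -- needed.
  have h1 := h.contactIntegral_add hQ' hQ'
  have h2 := h.contactIntegral_add (hQ.add hQ) hF
  have h3 := h.contactIntegral_add hQ hQ
  have h4 : (fun x => Q' x + Q' x) = fun x => (S.qPrime θ + S.qPrime θ) x + F x := by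
    funext x
    rw [e, Pi.add_apply]
    ring
  rw [OneForm.contactIntegral_expSmul h.smooth hσ]
  rw [h4, h2, h0] at h1
  change θ.contactIntegral (S.qPrime θ + S.qPrime θ) = _ at h3
  rw [h3] at h1
  change θ.contactIntegral Q' = _
  linarith

end CRStructure

end

theorem mainTheorem3 {M : Type*} [TopologicalSpace M] [ChartedSpace R3 M]
    [IsManifold (𝓡 3) ∞ M] [T2Space M] (S : CRStructure M) :
    (∀ θ : OneForm M, S.IsContactForm θ → S.IsPseudoEinstein θ →
      ContMDiff (𝓡 3) 𝓘(ℝ, ℝ) ∞ (S.qPrime θ) ∧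
      ∀ σ : M → ℝ, S.IsPluriharmonic σ →
        S.IsContactForm (OneForm.expSmul σ θ) ∧
        S.IsPseudoEinstein (OneForm.expSmul σ θ) ∧
        ∀ p : M, Real.exp (2 * σ p) * S.qPrime (OneForm.expSmul σ θ) p
          = S.qPrime θ p + S.pPrime θ σ p + 1 / 2 * S.paneitz θ (fun x => σ x ^ 2) p) ∧
    (∀ [CompactSpace M], ∀ θ θ' : OneForm M,
      S.IsContactForm θ → S.IsPseudoEinstein θ →
      S.IsContactForm θ' → S.IsPseudoEinstein θ' →
        θ'.contactIntegral (S.qPrime θ') = θ.contactIntegral (S.qPrime θ)) := by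
  refine ⟨fun θ h hW => ⟨h.contMDiff_qPrime, fun σ hσ => ?_⟩, fun θ θ' h hW h' hW' => ?_⟩
  · have h' := h.expSmul hσ.1
    have hW' := h.isPseudoEinstein_expSmul hσ hW
    exact ⟨h', hW', fun p => h.qPrime_expSmul h' (Filter.Eventually.of_forall hσ.1) hW hW'⟩
  · obtain ⟨σ, hσ, rfl⟩ := h.exists_eq_expSmul h'
    exact h.contactIntegral_qPrime_expSmul hσ hW hW'
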